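/- **Setting.** Let $U\subseteq\mathbb R^{d_1}$ and $V\subseteq\mathbb R^{d_2}$ be open. A quantum generating function on $U$ with momenta $q=(q_1,\dots,q_n)$ is a formal series $F_\hbar(x,q)=\sum_{l\ge 0}F_\hbar^{a_1\dots a_l}(x)\,q_{a_1}\cdots q_{a_l}$ with coefficients symmetric in the indices, each $F_\hbar^{a_1\dots a_l}(x)=\sum_k\hbar^kF_k^{a_1\dots a_l}(x)$ a formal power series in $\hbar$ with smooth (complex-valued) coefficients on $U$. Fix such an $F_\hbar$ on $U$ with $d_2$ momenta and write $\varphi_\hbar^i=F_\hbar^i$ for its linear coefficients; assume that $\varphi_0=\varphi_\hbar|_{\hbar=0}$ is real, so that it is a map $U\to\mathbb R^{d_2}$. Derivatives of a smooth function at $\varphi_\hbar(x)=\varphi_0(x)+O(\hbar)$ are understood through the Taylor expansion at $\varphi_0(x)$. **Formal integrals.** $\int Dy\,Đq\;e^{\frac i\hbar(\cdots-y^iq_i)}$, with $Đq=(2\pi\hbar)^{-d_2}Dq$, is the formal oscillatory integral expanded at $y=\varphi_0(x)+\eta$, $q=0$: the factor $e^{-\frac i\hbar\eta^iq_i}$ is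 kept as weight, the rest of the exponential is expanded into monomials in $\eta,q$, and these are integrated by $\int D\eta\,Đq\,e^{-\frac i\hbar\eta^iq_i}\eta^Aq_B=\delta_{AB}\,A!\,(\hbar/i)^{|A|}$. Here $e^{\frac i\hbar c}$ with $c\in\mathbb C[[\hbar]]$ is a formal exponential symbol with $e^{\frac i\hbar c}e^{\frac i\hbar c'}=e^{\frac i\hbar(c+c')}$ (so a logarithm is unique, and not only unique modulo $2\pi\hbar$). All sums below are sums of formal series: each coefficient receives only finitely many nonzero contributions. **Graphs.** A bipartite graph $\gamma$ has finitely many black and finitely many white vertices and a multiset of edges, each joining a black vertex to a white one (parallel edges are allowed and are not distinguished). Isomorphisms are pairs of bijections of the black and of the white vertices preserving edge multiplicities (and weights, if $\gamma$ is white-weighted, i.e. each white vertex $w$ carries a weight $\ell_w\in\mathbb Z_{\ge0}$); $\mathrm{sym}(\gamma)$ is the group of automorphisms. Call $\gamma$ white-leaved if no black vertex has degree $1$. Let $|\gamma|_\circ$ be the number of white vertices, $|\gamma|$ the number of all vertices, $|E_\gamma|$ the number of edges, and $b_\gamma=|E_\gamma|-|\gamma|+1$. For a vertex $v$ let $m_v$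 be its degree, $e^v_1,\dots,e^v_{m_v}$ the edges at $v$, and for black $v$ let $k^v_i$ be the number of white vertices joined to $v$ by exactly $i$ edges. If each white vertex $w$ carries a function $h_w$, put (edges being indices summed over) $$\langle F_\hbar,h\rangle_\gamma(x)=\prod_{v\text{ black}}\frac{m_v!}{(1!)^{k^v_1}(2!)^{k^v_2}\cdots}F_\hbar^{e^v_1\dots e^v_{m_v}}(x)\ \prod_{w\text{ white}}\partial_{e^w_1}\cdots\partial_{e^w_{m_w}}h_w(\varphi_\hbar(x)).$$ **(1) Composition.** Let $\varphi_0(U)\subseteq V$ and let $G_\hbar(y,r)$ be a quantum generating function on $V$ with momenta $r_1,\dots,r_{d_3}$. For a white-weighted $\gamma$ put $I_\gamma=(a_{w,j})_{w,\,1\le j\le \ell_w}$, $r_{I_\gamma}=\prod r_{a_{w,j}}$, and let $\langle F_\hbar,G_\hbar\rangle^{I_\gamma}_\gamma$ be the contraction above with $h_w=G_\hbar^{a_{w,1}\dots a_{w,\ell_w}}$. Let either $\varepsilon$ be an additional formal parameter, which counts the order in $G_\hbar$ (expansion as a functional power series in $G_\hbar$), or, if $G^0_\hbar=0$, let $\varepsilon=1$.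 Then for each $x\in U$ there is exactly one formal power series $H_\hbar(x,r)$ in $r$ and $\hbar$ (and in $\varepsilon$, if $\varepsilon$ is a parameter) with $$e^{\frac i\hbar H_\hbar(x,r)}=\int Dy\,Đq\ e^{\frac i\hbar(\varepsilon G_\hbar(y,r)+F_\hbar(x,q)-y^iq_i)},$$ its coefficients are smooth in $x\in U$, and $$H_\hbar(x,r)=\sum_\gamma\varepsilon^{|\gamma|_\circ}\,\frac{r_{I_\gamma}}{|\mathrm{sym}(\gamma)|}\Big(\frac\hbar i\Big)^{b_\gamma}\langle F_\hbar,G_\hbar\rangle_\gamma^{I_\gamma}(x),$$ the sum being over the isomorphism classes of connected white-weighted white-leaved bipartite graphs (and over the indices $I_\gamma$). **(2) Pullback.** Let $\varphi_0(U)\subseteq V$ and let $g:V\to\mathbb R$ be smooth. With a formal parameter $\varepsilon$ that counts the order in $g$, $$\int Dy\,Đq\ e^{\frac i\hbar(F_\hbar(x,q)-y^iq_i)}e^{\frac i\hbar\varepsilon g(y)}=\exp\Big(\frac i\hbar\sum_\gamma\frac{\varepsilon^{|\gamma|_\circ}}{|\mathrm{sym}(\gamma)|}\Big(\frac\hbar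 i\Big)^{b_\gamma}\langle F_\hbar,g\rangle_\gamma(x)\Big),$$ the sum being over the isomorphism classes of connected white-leaved bipartite graphs, with $h_w=g$; the exponent is the only formal power series in $\varepsilon,\hbar$ with this property, and its coefficients are smooth in $x\in U$. **(3) Coordinate transformations.** Let $x=x(x')$, $y=y(y')$ be smooth changes of coordinates between open sets with smooth inverses, the values $x(x')$ forming a subset of $U$ which $\varphi_0$ maps into the set of values $y(y')$. For each $x'$ there is exactly one formal power series $S'_\hbar(x',q')$ in $q'$ and $\hbar$ with $e^{\frac i\hbar S'_\hbar(x',q')}=\int Dy\,Đq\,e^{\frac i\hbar(F_\hbar(x(x'),q)+y'^{\alpha}(y)q'_\alpha-y^iq_i)}$; its coefficients are smooth in $x'$, and $$S'_\hbar(x',q')=\sum_\gamma\frac{q'_{\alpha_\gamma}}{|\mathrm{sym}(\gamma)|}\Big(\frac\hbar i\Big)^{b_\gamma}\langle F_\hbar,y'\rangle^{\alpha_\gamma}_\gamma(x(x')),$$ the sum being over the isomorphism classes of connected white-leaved bipartite graphs and over $\alpha_\gamma=(a_w)_w$, with $q'_{\alpha_\gamma}=\prod_wq'_{a_w}$ and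 $h_w=y'^{a_w}$. **(4) Classical limit.** In each of the three cases, setting $\hbar=0$ in $H_\hbar$, in the exponent $\sum_\gamma$ of (2), and in $S'_\hbar$, respectively, gives the classical sum over the isomorphism classes of (white-weighted, in the case of composition) white-leaved bipartite trees $t$, in which $F_\hbar,G_\hbar$ are replaced by their values $F_0,G_0$ at $\hbar=0$, the factor $(\hbar/i)^{b_\gamma}$ is absent, and the factor of a black vertex $v$ is $m_v!\,F_0^{e^v_1\dots e^v_{m_v}}(x)$. -/

import Mathlib

open scoped ContDiff

noncomputable section

namespace QuantumThick

/-! ### Generating functions -/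

/-- A quantum generating function on an open set `U ⊆ ℝ^d` with `n` momenta,
`∑_l ∑_{a₁ … a_l} F_ħ^{a₁ … a_l}(x) q_{a₁} ⋯ q_{a_l}`, where
`F_ħ^{a₁ … a_l}(x) = ∑_k ħ^k coeff l a k x` has smooth coefficients on `U`, and is symmetric in
the indices. -/
structure GeneratingFunction (d n : ℕ) (U : Set (Fin d → ℝ)) where
  coeff : (l : ℕ) → (Fin l → Fin n) → ℕ → (Fin d → ℝ) → ℂ
  smooth : ∀ l a k, ContDiffOn ℝ ∞ (coeff l a k) U
  symm : ∀ l a k (σ : Equiv.Perm (Fin l)), ∀ x ∈ U, coeff l (a ∘ σ) k x = coeff l a k x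

/-- The coefficient `F_ħ^{a₁ … a_l}(x)` as a formal power series in `ħ`. -/
def GeneratingFunction.at {d n : ℕ} {U : Set (Fin d → ℝ)} (F : GeneratingFunction d n U)
    (x : Fin d → ℝ) (l : ℕ) (a : Fin l → Fin n) : PowerSeries ℂ :=
  PowerSeries.mk fun k => F.coeff l a k x

/-- A function of `y` without `ħ`-corrections, seen as a formal power series in `ħ` with
coefficients functions of `y`. -/
def classicalFunction {d : ℕ} (g : (Fin d → ℝ) → ℝ) (k : ℕ) (y : Fin d → ℝ) : ℂ :=
  if k = 0 then (g y : ℂ) else 0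

/-- The iterated partial derivative `∂_{b₁} ⋯ ∂_{b_l} h (y)`. -/
def partialDeriv {d : ℕ} (h : (Fin d → ℝ) → ℂ) (l : ℕ) (b : Fin l → Fin d)
    (y : Fin d → ℝ) : ℂ :=
  iteratedFDeriv ℝ l h y fun i => Pi.single (b i) 1

/-! ### Formal series -/

/-- The lists of indices in which each index `i` occurs `s i` times. -/
def words {n : ℕ} (s : Fin n →₀ ℕ) : Finset (Fin s.degree → Fin n) :=
  Finset.univ.filter fun a => ∑ i, Finsupp.single (a i) 1 = s

/-- The formal power series `∑_l ∑_{a₁ … a_l} T^{a₁ … a_l} X_{a₁} ⋯ X_{a_l}`. -/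
def tensorSeries {R : Type} [CommRing R] {n : ℕ} (T : (l : ℕ) → (Fin l → Fin n) → R) :
    MvPowerSeries (Fin n) R :=
  fun s => ∑ a ∈ words s, T _ a

/-- The Taylor series of `h(y₀ + η) = ∑_k ħ^k h_k(y₀ + η)` in the variables `η`. -/
def taylorSeries {d : ℕ} (h : ℕ → (Fin d → ℝ) → ℂ) (y₀ : Fin d → ℝ) :
    MvPowerSeries (Fin d) (PowerSeries ℂ) :=
  tensorSeries fun l b =>
    PowerSeries.mk fun k => ((l.factorial : ℂ))⁻¹ * partialDeriv (h k) l b y₀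

/-- The formal power series `G_ħ(y₀ + η, r)` in the variables `η` (left) and `r` (right). -/
def GeneratingFunction.jointSeries {d n : ℕ} {V : Set (Fin d → ℝ)} (G : GeneratingFunction d n V)
    (y₀ : Fin d → ℝ) : MvPowerSeries (Fin d ⊕ Fin n) (PowerSeries ℂ) :=
  fun m =>
    let p := Finsupp.sumFinsuppEquivProdFinsupp m
    ∑ a ∈ words p.2, MvPowerSeries.coeff p.1 (taylorSeries (G.coeff _ a) y₀)

/-- The value `∂_{b₁} ⋯ ∂_{b_l} h (φ_ħ)` as a formal power series in `ħ`, where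
`h = ∑_k ħ^k h_k` and where `φ_ħ = y₀ + O(ħ)` is a point depending formally on `ħ`: this is
`∑_j (1/j!) ∑_{a₁ … a_j} ∏_i (φ_ħ - y₀)^{a_i} ∂_{a₁} ⋯ ∂_{a_j} ∂_{b₁} ⋯ ∂_{b_l} h (y₀)`, in which
the summand with index `j` is divisible by `ħ^j`, so that only `j ≤ N` matters at order `N`. -/
def partialDerivAt {d : ℕ} (h : ℕ → (Fin d → ℝ) → ℂ) (y₀ : Fin d → ℝ)
    (φ : Fin d → PowerSeries ℂ) (l : ℕ) (b : Fin l → Fin d) : PowerSeries ℂ :=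
  PowerSeries.mk fun N => PowerSeries.coeff N <|
    ∑ j ∈ Finset.range (N + 1), ∑ a : Fin j → Fin d,
      PowerSeries.C ((j.factorial : ℂ)⁻¹) * (∏ i, (φ (a i) - PowerSeries.C (y₀ (a i) : ℂ))) *
        PowerSeries.mk fun k => partialDeriv (h k) (j + l) (Fin.append a b) y₀

/-- The family `f` of formal series (given by their coefficients, indexed by `J`) is summable,
i.e. each coefficient is nonzero for finitely many members only, and its sum is `v`. -/
def SumsTo {ι J : Type} (f : ι → J → ℂ) (v : J → ℂ) : Prop :=
  ∀ j, (Function.support fun i => f i j).Finite ∧ v j = ∑ᶠ i, f i j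

/-- The coefficients of a formal power series in the variables `τ` and `ħ`. -/
def coeffs {τ : Type} (f : MvPowerSeries τ (PowerSeries ℂ)) (j : (τ →₀ ℕ) × ℕ) : ℂ :=
  PowerSeries.coeff j.2 (MvPowerSeries.coeff j.1 f)

/-! ### Formal oscillatory exponentials and integrals -/

/-- Formal oscillatory expressions: finite sums of terms `e^{(i/ħ) c} A` with `c ∈ ℂ[[ħ]]` and
`A` a formal power series in the variables `τ` over the Laurent series in `ħ`. The `e^{(i/ħ) c}`
are formal exponentials, with `e^{(i/ħ) c} e^{(i/ħ) c'} = e^{(i/ħ) (c + c')}`. -/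
abbrev Oscillatory (τ : Type) : Type :=
  AddMonoidAlgebra (MvPowerSeries τ (LaurentSeries ℂ)) (PowerSeries ℂ)

/-- `exp ((i/ħ) (Ψ - Ψ(0)))`, where `Ψ(0) ∈ ℂ[[ħ]]` is the constant term of `Ψ` with respect to
the variables `σ`: the exponential series, substituted at a series without constant term. -/
def amplitude {σ : Type} (Ψ : MvPowerSeries σ (PowerSeries ℂ)) :
    MvPowerSeries σ (LaurentSeries ℂ) :=
  (PowerSeries.exp ℂ).subst
    (MvPowerSeries.C (HahnSeries.single (-1) Complex.I : LaurentSeries ℂ) *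
      MvPowerSeries.map (HahnSeries.ofPowerSeries ℤ ℂ)
        (Ψ - MvPowerSeries.C (MvPowerSeries.constantCoeff Ψ)))

/-- The formal exponential `e^{(i/ħ) H}`. -/
def oscExp {τ : Type} (H : MvPowerSeries τ (PowerSeries ℂ)) : Oscillatory τ :=
  AddMonoidAlgebra.single (MvPowerSeries.constantCoeff H) (amplitude H)

/-- The variables of an integrand: `q_i`, `η^i` (with `y = y₀ + η`), and parameters `τ`. -/
abbrev Var (d : ℕ) (τ : Type) : Type := Fin d ⊕ (Fin d ⊕ τ)

/-- The variable `q_i`. -/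
def qVar {d : ℕ} {τ : Type} (i : Fin d) : MvPowerSeries (Var d τ) (PowerSeries ℂ) :=
  MvPowerSeries.X (Sum.inl i)

/-- The variable `η^i`. -/
def etaVar {d : ℕ} {τ : Type} (i : Fin d) : MvPowerSeries (Var d τ) (PowerSeries ℂ) :=
  MvPowerSeries.X (Sum.inr (Sum.inl i))

/-- The phase `S(q) + g - y^i q_i` at `y = y₀ + η`, where `S(q)` is the series with coefficients
`S` and `g` is a series in `η` and the parameters. -/
def phase {d : ℕ} {τ : Type} (S : (l : ℕ) → (Fin l → Fin d) → PowerSeries ℂ) (y₀ : Fin d → ℝ)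
    (g : MvPowerSeries (Fin d ⊕ τ) (PowerSeries ℂ)) : MvPowerSeries (Var d τ) (PowerSeries ℂ) :=
  MvPowerSeries.rename Function.Embedding.inl (tensorSeries S) +
    MvPowerSeries.rename Function.Embedding.inr g -
    ∑ i, (MvPowerSeries.C (PowerSeries.C (y₀ i : ℂ)) + etaVar i) * qVar i

/-- `I` is the formal oscillatory integral `∫ Dy Đq e^{(i/ħ) Ψ}`, with `Đq = (2πħ)^{-d} Dq`, of a
phase `Ψ(η, q, t) = -η^i q_i + ⋯` expanded at `y = y₀ + η`, `q = 0`. As usual, `e^{-(i/ħ) η^i q_i}`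
is kept as the weight, the remaining exponential is expanded into monomials, and each of these is
integrated exactly, by Fourier inversion:
`∫ Dη Đq e^{-(i/ħ) η^i q_i} η^A q_B = (ħ/i)^{|B|} ∂_B η^A (0)`, which is `(ħ/i)^{|A|} A!` for
`A = B` and zero otherwise. The resulting sum over `A` has to converge as a formal series in
the parameters and `ħ`. -/
def HasFormalIntegral {d : ℕ} {τ : Type} (Ψ : MvPowerSeries (Var d τ) (PowerSeries ℂ))
    (I : Oscillatory τ) : Prop :=
  ∃ J : MvPowerSeries τ (LaurentSeries ℂ),
    I = AddMonoidAlgebra.single (MvPowerSeries.constantCoeff Ψ) J ∧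
    SumsTo
      (fun (A : Fin d →₀ ℕ) (j : (τ →₀ ℕ) × ℤ) =>
        ((∏ i, ((A i).factorial : LaurentSeries ℂ)) *
          (HahnSeries.single 1 Complex.I⁻¹ : LaurentSeries ℂ) ^ A.degree *
          MvPowerSeries.coeff (Finsupp.sumElim A (Finsupp.sumElim A j.1))
            (amplitude (Ψ + ∑ i, etaVar i * qVar i))).coeff j.2)
      (fun j => (MvPowerSeries.coeff j.1 J).coeff j.2)

/-! ### Bipartite graphs -/

/-- A bipartite multigraph with black vertices `Fin black`, white vertices `Fin white`, and
`mult b w` (undistinguished) edges between `b` and `w`. -/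
structure BipartiteGraph where
  black : ℕ
  white : ℕ
  mult : Fin black → Fin white → ℕ

/-- A bipartite graph with a weight in `ℤ_{≥ 0}` on each white vertex. -/
structure WeightedBipartiteGraph extends BipartiteGraph where
  weight : Fin white → ℕ

namespace BipartiteGraph

/-- The underlying simple graph. -/
def skeleton (γ : BipartiteGraph) : SimpleGraph (Fin γ.black ⊕ Fin γ.white) :=
  SimpleGraph.fromRel fun u v => ∃ b w, u = Sum.inl b ∧ v = Sum.inr w ∧ 0 < γ.mult b w

/-- The degree `m_b` of a black vertex. -/
abbrev blackDegree (γ : BipartiteGraph) (b : Fin γ.black) : ℕ := ∑ w, γ.mult b w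

/-- The degree `m_w` of a white vertex. -/
abbrev whiteDegree (γ : BipartiteGraph) (w : Fin γ.white) : ℕ := ∑ b, γ.mult b w

/-- All leaves (vertices of degree one) are white. -/
def WhiteLeaved (γ : BipartiteGraph) : Prop := ∀ b, γ.blackDegree b ≠ 1

/-- Connected (in particular nonempty) white-leaved graphs. -/
def IsConnectedWhiteLeaved (γ : BipartiteGraph) : Prop := γ.skeleton.Connected ∧ γ.WhiteLeaved

/-- White-leaved trees: no multiple edges, and the underlying simple graph is a tree. -/
def IsWhiteLeavedTree (γ : BipartiteGraph) : Prop :=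
  ((∀ b w, γ.mult b w ≤ 1) ∧ γ.skeleton.IsTree) ∧ γ.WhiteLeaved

/-- The number of loops `|E| - |V| + 1`, which is nonnegative for connected graphs. -/
def loops (γ : BipartiteGraph) : ℕ := (∑ b, ∑ w, γ.mult b w) + 1 - (γ.black + γ.white)

/-- Isomorphisms: bijections of the black and of the white vertices that respect the multiset of
edges. -/
instance isoSetoid : Setoid BipartiteGraph where
  r γ γ' := ∃ (σ : Fin γ.black ≃ Fin γ'.black) (τ : Fin γ.white ≃ Fin γ'.white),
    ∀ b w, γ'.mult (σ b) (τ w) = γ.mult b w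
  iseqv :=
    { refl := fun γ => ⟨Equiv.refl _, Equiv.refl _, fun _ _ => rfl⟩
      symm := by
        rintro γ γ' ⟨σ, τ, h⟩
        exact ⟨σ.symm, τ.symm, fun b w => by simpa using (h (σ.symm b) (τ.symm w)).symm⟩
      trans := by
        rintro γ γ' γ'' ⟨σ, τ, h⟩ ⟨σ', τ', h'⟩
        exact ⟨σ.trans σ', τ.trans τ', fun b w => by simp [h, h']⟩ }

/-- Isomorphism classes of the graphs with property `P`. -/
def Classes (P : BipartiteGraph → Prop) : Type :=
  Quotient (isoSetoid.comap (Subtype.val : {γ // P γ} → BipartiteGraph))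

/-- A representative of an isomorphism class. -/
def Classes.rep {P : BipartiteGraph → Prop} (c : Classes P) : BipartiteGraph :=
  (Quotient.out c).val

/-- The number `|sym(γ)|` of automorphisms. -/
def symCard (γ : BipartiteGraph) : ℕ :=
  Nat.card {p : Equiv.Perm (Fin γ.black) × Equiv.Perm (Fin γ.white) //
    ∀ b w, γ.mult (p.1 b) (p.2 w) = γ.mult b w}

/-- A choice of an index in `Fin d` for each edge. -/
abbrev Labelling (γ : BipartiteGraph) (d : ℕ) : Type := ∀ b w, Fin (γ.mult b w) → Fin d

/-- The indices of the edges at a black vertex. -/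
def atBlack {γ : BipartiteGraph} {d : ℕ} (e : γ.Labelling d) (b : Fin γ.black) :
    Fin (γ.blackDegree b) → Fin d :=
  fun j => e b (finSigmaFinEquiv.symm j).1 (finSigmaFinEquiv.symm j).2

/-- The indices of the edges at a white vertex. -/
def atWhite {γ : BipartiteGraph} {d : ℕ} (e : γ.Labelling d) (w : Fin γ.white) :
    Fin (γ.whiteDegree w) → Fin d :=
  fun j => e (finSigmaFinEquiv.symm j).1 w (finSigmaFinEquiv.symm j).2

/-- The contraction attached to a bipartite graph, where the black vertices carry the tensors `S`
and the white vertex `w` carries the function `h w`, whose derivatives are taken at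
`φ_ħ = y₀ + O(ħ)` with `φ_ħ^i = S^i`. Since `0! = 1`, the denominator at a black vertex `v` is
`(1!)^{k_1} (2!)^{k_2} ⋯`, with `k_i` the number of white vertices joined to `v` by `i` edges. -/
def contraction (γ : BipartiteGraph) {d : ℕ} (S : (l : ℕ) → (Fin l → Fin d) → PowerSeries ℂ)
    (y₀ : Fin d → ℝ) (h : Fin γ.white → ℕ → (Fin d → ℝ) → ℂ) : PowerSeries ℂ :=
  ∑ e : γ.Labelling d,
    (∏ v, PowerSeries.C
        (((γ.blackDegree v).factorial : ℂ) / ∏ w, ((γ.mult v w).factorial : ℂ)) *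
      S (γ.blackDegree v) (atBlack e v)) *
    ∏ w, partialDerivAt (h w) y₀ (fun i => S 1 fun _ => i) (γ.whiteDegree w) (atWhite e w)

/-- The contraction attached to a bipartite tree in the classical calculus. -/
def classicalContraction (γ : BipartiteGraph) {d : ℕ} (S : (l : ℕ) → (Fin l → Fin d) → ℂ)
    (φ : Fin d → ℝ) (h : Fin γ.white → (Fin d → ℝ) → ℂ) : ℂ :=
  ∑ e : γ.Labelling d,
    (∏ v, ((γ.blackDegree v).factorial : ℂ) * S (γ.blackDegree v) (atBlack e v)) *
    ∏ w, partialDeriv (h w) (γ.whiteDegree w) (atWhite e w) φ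

end BipartiteGraph

namespace WeightedBipartiteGraph

/-- Isomorphisms of bipartite graphs that preserve the weights. -/
instance isoSetoid : Setoid WeightedBipartiteGraph where
  r γ γ' := ∃ (σ : Fin γ.black ≃ Fin γ'.black) (τ : Fin γ.white ≃ Fin γ'.white),
    (∀ b w, γ'.mult (σ b) (τ w) = γ.mult b w) ∧ ∀ w, γ'.weight (τ w) = γ.weight w
  iseqv :=
    { refl := fun γ => ⟨Equiv.refl _, Equiv.refl _, fun _ _ => rfl, fun _ => rfl⟩
      symm := by
        rintro γ γ' ⟨σ, τ, h, k⟩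
        exact ⟨σ.symm, τ.symm, fun b w => by simpa using (h (σ.symm b) (τ.symm w)).symm,
          fun w => by simpa using (k (τ.symm w)).symm⟩
      trans := by
        rintro γ γ' γ'' ⟨σ, τ, h, k⟩ ⟨σ', τ', h', k'⟩
        exact ⟨σ.trans σ', τ.trans τ', fun b w => by simp [h, h'], fun w => by simp [k, k']⟩ }

/-- Isomorphism classes of the weighted graphs whose underlying graph has property `P`. -/
def Classes (P : BipartiteGraph → Prop) : Type :=
  Quotient (isoSetoid.comap
    (Subtype.val : {γ : WeightedBipartiteGraph // P γ.toBipartiteGraph} → WeightedBipartiteGraph))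

/-- A representative of an isomorphism class. -/
def Classes.rep {P : BipartiteGraph → Prop} (c : Classes P) : WeightedBipartiteGraph :=
  (Quotient.out c).val

/-- The number `|sym(γ)|` of automorphisms. -/
def symCard (γ : WeightedBipartiteGraph) : ℕ :=
  Nat.card {p : Equiv.Perm (Fin γ.black) × Equiv.Perm (Fin γ.white) //
    (∀ b w, γ.mult (p.1 b) (p.2 w) = γ.mult b w) ∧ ∀ w, γ.weight (p.2 w) = γ.weight w}

end WeightedBipartiteGraph

/-! ### Composition, pullback and change of coordinates -/

/-- The scalar `(1/s) (ħ/i)^b`. -/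
def loopFactor (s b : ℕ) : PowerSeries ℂ :=
  PowerSeries.C ((s : ℂ)⁻¹) * (PowerSeries.C Complex.I⁻¹ * PowerSeries.X) ^ b

section

variable {d₁ d₂ d₃ : ℕ} {U : Set (Fin d₁ → ℝ)} {V : Set (Fin d₂ → ℝ)} {τ : Type}

/-- `e^{(i/ħ) H(r)} = ∫ Dy Đq e^{(i/ħ) (c G_ħ(y, r) + F_ħ(x, q) - y^i q_i)}`, where `y` is expanded at
`y₀`, the momentum `r_a` is the variable `ρ a`, and `c` is a power series in the variables `τ`. -/
def CompositionLaw (F : GeneratingFunction d₁ d₂ U) (G : GeneratingFunction d₂ d₃ V)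
    (c : MvPowerSeries τ (PowerSeries ℂ)) (ρ : Fin d₃ ↪ τ) (x : Fin d₁ → ℝ) (y₀ : Fin d₂ → ℝ)
    (H : MvPowerSeries τ (PowerSeries ℂ)) : Prop :=
  HasFormalIntegral
    (phase (F.at x) y₀
      (MvPowerSeries.rename Function.Embedding.inr c *
        MvPowerSeries.rename ((Function.Embedding.refl _).sumMap ρ) (G.jointSeries y₀)))
    (oscExp H)

/-- `c^{|γ|_∘} r_{I_γ} (ħ/i)^{b_γ} ⟨F_ħ, G_ħ⟩_γ^{I_γ}(x) / |sym(γ)|`, summed over the indices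
`I_γ = (a_{w,j})`. -/
def compositionTerm (F : GeneratingFunction d₁ d₂ U) (G : GeneratingFunction d₂ d₃ V)
    (c : MvPowerSeries τ (PowerSeries ℂ)) (ρ : Fin d₃ ↪ τ) (x : Fin d₁ → ℝ) (y₀ : Fin d₂ → ℝ)
    (γ : WeightedBipartiteGraph) : MvPowerSeries τ (PowerSeries ℂ) :=
  c ^ γ.white * MvPowerSeries.C (loopFactor γ.symCard γ.loops) *
    ∑ a : (∀ w, Fin (γ.weight w) → Fin d₃),
      (∏ w, ∏ j, MvPowerSeries.X (ρ (a w j))) *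
        MvPowerSeries.C (γ.contraction (F.at x) y₀ fun w => G.coeff (γ.weight w) (a w))

/-- `c^{|t|_∘} r_{I_t} ⟨F, G⟩_t^{I_t}(x) / |sym(t)|` for the classical generating functions
`F = F_ħ|_{ħ=0}`, `G = G_ħ|_{ħ=0}`, summed over the indices `I_t = (a_{w,j})`. -/
def classicalCompositionTerm (F : GeneratingFunction d₁ d₂ U) (G : GeneratingFunction d₂ d₃ V)
    (c : MvPowerSeries τ ℂ) (ρ : Fin d₃ ↪ τ) (x : Fin d₁ → ℝ) (y₀ : Fin d₂ → ℝ)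
    (t : WeightedBipartiteGraph) : MvPowerSeries τ ℂ :=
  c ^ t.white * MvPowerSeries.C ((t.symCard : ℂ)⁻¹) *
    ∑ a : (∀ w, Fin (t.weight w) → Fin d₃),
      (∏ w, ∏ j, MvPowerSeries.X (ρ (a w j))) *
        MvPowerSeries.C (t.classicalContraction (fun l b => F.coeff l b 0 x) y₀
          fun w => G.coeff (t.weight w) (a w) 0)

/-- `e^{(i/ħ) E} = ∫ Dy Đq e^{(i/ħ) (S_ħ(x, q) - y^i q_i)} e^{(i/ħ) ε g(y)}`, where `y` is expanded at
`y₀`, and `ε` is the only variable of the formal power series `E`. -/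
def PullbackLaw (S : GeneratingFunction d₁ d₂ U) (g : (Fin d₂ → ℝ) → ℝ) (x : Fin d₁ → ℝ)
    (y₀ : Fin d₂ → ℝ) (E : MvPowerSeries Unit (PowerSeries ℂ)) : Prop :=
  HasFormalIntegral
    (phase (S.at x) y₀
      (MvPowerSeries.X (Sum.inr ()) *
        MvPowerSeries.rename Function.Embedding.inl (taylorSeries (classicalFunction g) y₀)))
    (oscExp E)

/-- `ε^{|γ|_∘} (ħ/i)^{b_γ} ⟨S_ħ, g⟩_γ(x) / |sym(γ)|`. -/
def pullbackTerm (S : GeneratingFunction d₁ d₂ U) (g : (Fin d₂ → ℝ) → ℝ) (x : Fin d₁ → ℝ)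
    (y₀ : Fin d₂ → ℝ) (γ : BipartiteGraph) : MvPowerSeries Unit (PowerSeries ℂ) :=
  MvPowerSeries.X () ^ γ.white * MvPowerSeries.C (loopFactor γ.symCard γ.loops *
    γ.contraction (S.at x) y₀ fun _ => classicalFunction g)

/-- `ε^{|t|_∘} ⟨S, g⟩_t(x) / |sym(t)|` for the classical generating function `S = S_ħ|_{ħ=0}`. -/
def classicalPullbackTerm (S : GeneratingFunction d₁ d₂ U) (g : (Fin d₂ → ℝ) → ℝ)
    (x : Fin d₁ → ℝ) (y₀ : Fin d₂ → ℝ) (t : BipartiteGraph) : MvPowerSeries Unit ℂ :=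
  MvPowerSeries.X () ^ t.white * MvPowerSeries.C ((t.symCard : ℂ)⁻¹ *
    t.classicalContraction (fun l b => S.coeff l b 0 x) y₀ fun _ y => (g y : ℂ))

/-- `e^{(i/ħ) S'(q')} = ∫ Dy Đq e^{(i/ħ) (S_ħ(x, q) + y'^α(y) q'_α - y^i q_i)}`, where `y` is expanded
at `y₀`, and `y' = ψ(y)`. -/
def TransformationLaw (S : GeneratingFunction d₁ d₂ U) (ψ : (Fin d₂ → ℝ) → (Fin d₂ → ℝ))
    (x : Fin d₁ → ℝ) (y₀ : Fin d₂ → ℝ) (S' : MvPowerSeries (Fin d₂) (PowerSeries ℂ)) : Prop :=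
  HasFormalIntegral
    (phase (S.at x) y₀
      (∑ α, MvPowerSeries.rename Function.Embedding.inl
        (taylorSeries (classicalFunction fun y => ψ y α) y₀) * MvPowerSeries.X (Sum.inr α)))
    (oscExp S')

/-- `q'_{α_γ} (ħ/i)^{b_γ} ⟨S_ħ, y'⟩_γ^{α_γ} / |sym(γ)|`, summed over the indices `α_γ = (a_w)`. -/
def transformationTerm (S : GeneratingFunction d₁ d₂ U) (ψ : (Fin d₂ → ℝ) → (Fin d₂ → ℝ))
    (x : Fin d₁ → ℝ) (y₀ : Fin d₂ → ℝ) (γ : BipartiteGraph) :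
    MvPowerSeries (Fin d₂) (PowerSeries ℂ) :=
  MvPowerSeries.C (loopFactor γ.symCard γ.loops) *
    ∑ a : Fin γ.white → Fin d₂, (∏ w, MvPowerSeries.X (a w)) *
      MvPowerSeries.C (γ.contraction (S.at x) y₀ fun w => classicalFunction fun y => ψ y (a w))

/-- `q'_{α_t} ⟨S, y'⟩_t^{α_t} / |sym(t)|` for the classical generating function `S = S_ħ|_{ħ=0}`,
summed over the indices `α_t = (a_w)`. -/
def classicalTransformationTerm (S : GeneratingFunction d₁ d₂ U)
    (ψ : (Fin d₂ → ℝ) → (Fin d₂ → ℝ)) (x : Fin d₁ → ℝ) (y₀ : Fin d₂ → ℝ) (t : BipartiteGraph) :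
    MvPowerSeries (Fin d₂) ℂ :=
  MvPowerSeries.C ((t.symCard : ℂ)⁻¹) *
    ∑ a : Fin t.white → Fin d₂, (∏ w, MvPowerSeries.X (a w)) *
      MvPowerSeries.C (t.classicalContraction (fun l b => S.coeff l b 0 x) y₀
        fun w y => (ψ y (a w) : ℂ))

end

/-- The equation `law x H` has, for each `x ∈ U`, exactly one solution `H = H_ħ(x, ·)` among the
formal power series in the variables `τ` and `ħ`; its coefficients are smooth functions of `x`; it is
the sum of the family `term`; and its value at `ħ = 0` is the sum of the family `classicalTerm`. -/
def HasGraphExpansion {d : ℕ} {τ ι κ : Type} (U : Set (Fin d → ℝ))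
    (law : (Fin d → ℝ) → MvPowerSeries τ (PowerSeries ℂ) → Prop)
    (term : (Fin d → ℝ) → ι → MvPowerSeries τ (PowerSeries ℂ))
    (classicalTerm : (Fin d → ℝ) → κ → MvPowerSeries τ ℂ) : Prop :=
  ∃ H : (Fin d → ℝ) → MvPowerSeries τ (PowerSeries ℂ),
    (∀ j, ContDiffOn ℝ ∞ (fun x => coeffs (H x) j) U) ∧
    ∀ x ∈ U,
      (∀ H' : MvPowerSeries τ (PowerSeries ℂ), law x H' ↔ H' = H x) ∧
      SumsTo (fun γ => coeffs (term x γ)) (coeffs (H x)) ∧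
      SumsTo (fun t s => MvPowerSeries.coeff s (classicalTerm x t))
        (fun s => MvPowerSeries.coeff s (MvPowerSeries.map PowerSeries.constantCoeff (H x)))

end QuantumThick

end

open QuantumThick

open scoped ContDiff

/-! Once the weight `-η q` is split off, the phase is a series in the momenta `q` plus a series `P`
in `η` and the parameters, so the integrand is a product of two exponentials. Expand both. A term
consists of some coefficients of `F` (black vertices) and some coefficients of `G` (white vertices),
divided by the factorials of their numbers, and the rule `η^A q_B ↦ δ_{AB} A! (ħ/i)^{|A|}` pairs
`q`'s with `η`'s. By `wick` the pairing is a sum over matrices of edge multiplicities, each matrix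
`N` weighted by `∏ 1/N!`. Thus the integral is a sum over all labelled bipartite graphs.

Negative powers of `ħ` are removed by giving each momentum and each parameter a factor `ħ/i`: a
coefficient of degree `m` in these then carries `(ħ/i)^(m-1)`. All sums become locally finite over
`ℂ[[ħ]]`. The terms linear in `q` carry no extra power, but their coefficients `φ_ħ - φ₀` are
`O(ħ)`. They are the black leaves, and summing over the leaves at a white vertex is the Taylor
expansion that moves the point of evaluation from `φ₀` to `φ_ħ` (`coeff_leafSum_interaction`). This
is why only white-leaved graphs remain.

The logarithm is the sum over connected graphs, by the exponential formula. Let `D` be the Euler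
operator in the parameters. Applied to the sum `Z` over all graphs it marks a white vertex; the
component of that vertex splits off, so `D Z = Z · D K` with `K` the sum over connected graphs
(`euler_partitionFunction`). The same equation with the same constant term characterises `exp (K -
K(0))`. The term `F⁰`, which sits in the formal exponential symbol, is restored as the graph with a
single black vertex and no edges.

Undoing the rescaling gives the power of `ħ/i` (`hbarI_pow_mul_coeff_connValue`): black vertices
give `|E| - B`, white vertices give `|s| - W` at the coefficient `s`, and the coefficient `s` of the
logarithm is rescaled by `|s| - 1`, which leaves `b_γ = |E| - B - W + 1`. Orbit counting
(`card_isomorphic_mul_symCard`) turns `1/(B! W!)` for labelled graphs into `1/|sym(γ)|` for classes.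

At a fixed coefficient the loop number, the number of white vertices and the weights are bounded; as
black vertices with edges have degree at least two, only finitely many graphs contribute, the same
ones for all `x`. This gives smoothness. At `ħ = 0` only loop number zero survives, that is, trees.
Pullback and change of coordinates are compositions with a `G` homogeneous of degree 0 or 1 in the
momenta. -/

namespace QuantumThick

open Finset

/-! ### Locally finite sums of formal series -/

/-- The `ħ`-adic (coefficientwise discrete) topology on formal power series in `ħ`. -/
@[reducible] noncomputable def hbarTopology : TopologicalSpace (PowerSeries ℂ) :=
  @PowerSeries.WithPiTopology.instTopologicalSpace ℂ ⊥

attribute [local instance] hbarTopology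

/-- The coefficientwise topology on formal power series in parameters and `ħ`. -/
@[reducible] noncomputable def seriesTopology (τ : Type) :
    TopologicalSpace (MvPowerSeries τ (PowerSeries ℂ)) :=
  MvPowerSeries.WithPiTopology.instTopologicalSpace (PowerSeries ℂ)

attribute [local instance] seriesTopology

theorem hbar_isTopologicalRing : IsTopologicalRing (PowerSeries ℂ) := by
  let _ : TopologicalSpace ℂ := ⊥
  have _ : DiscreteTopology ℂ := ⟨rfl⟩
  exact PowerSeries.WithPiTopology.instIsTopologicalRing ℂ

attribute [local instance] hbar_isTopologicalRing

theorem hbar_t2Space : T2Space (PowerSeries ℂ) := by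
  let _ : TopologicalSpace ℂ := ⊥
  have _ : DiscreteTopology ℂ := ⟨rfl⟩
  exact PowerSeries.WithPiTopology.instT2Space ℂ

attribute [local instance] hbar_t2Space

theorem series_isTopologicalRing (τ : Type) :
    IsTopologicalRing (MvPowerSeries τ (PowerSeries ℂ)) :=
  MvPowerSeries.WithPiTopology.instIsTopologicalRing τ (PowerSeries ℂ)

attribute [local instance] series_isTopologicalRing

theorem series_t2Space (τ : Type) : T2Space (MvPowerSeries τ (PowerSeries ℂ)) :=
  MvPowerSeries.WithPiTopology.instT2Space

attribute [local instance] series_t2Space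

/-- In a discrete group the partial sums must be eventually constant, so summability is finiteness
of the support. This makes the `HasSum` API available for the locally finite sums of the theorem. -/
theorem hasSum_discrete {ι : Type*} {f : ι → ℂ} {v : ℂ} :
    @HasSum ℂ ι _ ⊥ f v (SummationFilter.unconditional ι) ↔
      (Function.support f).Finite ∧ v = ∑ᶠ i, f i := by
  let _ : TopologicalSpace ℂ := ⊥
  have _ : DiscreteTopology ℂ := ⟨rfl⟩
  constructor
  · intro h
    have hf : (Function.support f).Finite := h.summable.hasFiniteSupport_of_discreteTopology
    refine ⟨hf, h.unique ?_⟩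
    rw [finsum_eq_sum_of_support_subset f (s := hf.toFinset) (by simp)]
    exact hasSum_sum_of_ne_finset_zero fun b hb => by simpa using hb
  · rintro ⟨hf, rfl⟩
    rw [finsum_eq_sum_of_support_subset f (s := hf.toFinset) (by simp)]
    exact hasSum_sum_of_ne_finset_zero fun b hb => by simpa using hb

theorem hasSum_hbar_iff {ι : Type*} {f : ι → PowerSeries ℂ} {v : PowerSeries ℂ} :
    HasSum f v ↔ ∀ k, (Function.support fun i => PowerSeries.coeff k (f i)).Finite ∧
      PowerSeries.coeff k v = ∑ᶠ i, PowerSeries.coeff k (f i) := by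
  let _ : TopologicalSpace ℂ := ⊥
  rw [PowerSeries.WithPiTopology.hasSum_iff_hasSum_coeff]
  exact forall_congr' fun k => hasSum_discrete

theorem hasSum_series_iff_coeff {ι : Type*} {τ : Type} {f : ι → MvPowerSeries τ (PowerSeries ℂ)}
    {v : MvPowerSeries τ (PowerSeries ℂ)} :
    HasSum f v ↔ ∀ s, HasSum (fun i => MvPowerSeries.coeff s (f i)) (MvPowerSeries.coeff s v) :=
  MvPowerSeries.WithPiTopology.hasSum_iff_hasSum_coeff

/-- The bridge between `SumsTo`, used in the theorem, and `HasSum`, used in the proof. -/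
theorem hasSum_series_iff {ι : Type} {τ : Type} {f : ι → MvPowerSeries τ (PowerSeries ℂ)}
    {v : MvPowerSeries τ (PowerSeries ℂ)} :
    HasSum f v ↔ SumsTo (fun i => coeffs (f i)) (coeffs v) := by
  simp only [hasSum_series_iff_coeff, hasSum_hbar_iff, SumsTo, Prod.forall, coeffs]

theorem summable_hbar_iff {ι : Type*} {f : ι → PowerSeries ℂ} :
    Summable f ↔ ∀ k, (Function.support fun i => PowerSeries.coeff k (f i)).Finite := by
  constructor
  · rintro ⟨v, hv⟩ k
    exact (hasSum_hbar_iff.1 hv k).1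
  · intro h
    exact ⟨PowerSeries.mk fun k => ∑ᶠ i, PowerSeries.coeff k (f i),
      hasSum_hbar_iff.2 fun k => ⟨h k, by simp⟩⟩

theorem summable_series_iff_coeff {ι : Type*} {τ : Type}
    {f : ι → MvPowerSeries τ (PowerSeries ℂ)} :
    Summable f ↔ ∀ s, Summable fun i => MvPowerSeries.coeff s (f i) :=
  MvPowerSeries.WithPiTopology.summable_iff_summable_coeff

theorem summable_series_iff {ι : Type*} {τ : Type} {f : ι → MvPowerSeries τ (PowerSeries ℂ)} :
    Summable f ↔ ∀ s k, (Function.support fun i =>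
      PowerSeries.coeff k (MvPowerSeries.coeff s (f i))).Finite := by
  simp only [summable_series_iff_coeff, summable_hbar_iff]

/-- A coefficient of a product involves finitely many pairs of coefficients of the factors, and each
of these is nonzero for finitely many indices. `HasSum.mul` needs this as a separate input. -/
theorem summable_hbar_mul {ι κ : Type*} {f : ι → PowerSeries ℂ} {g : κ → PowerSeries ℂ}
    (hf : Summable f) (hg : Summable g) : Summable fun x : ι × κ => f x.1 * g x.2 := by
  rw [summable_hbar_iff] at *
  intro k
  refine Set.Finite.subset (Set.Finite.biUnion (antidiagonal k).finite_toSet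
    fun p _ => (hf p.1).prod (hg p.2)) ?_
  rintro ⟨i, j⟩ h
  simp only [Function.mem_support, PowerSeries.coeff_mul] at h
  obtain ⟨p, hp, h⟩ := Finset.exists_ne_zero_of_sum_ne_zero h
  simp only [Set.mem_iUnion]
  exact ⟨p, by simpa using hp, left_ne_zero_of_mul h, right_ne_zero_of_mul h⟩

theorem summable_series_mul {ι κ : Type*} {τ : Type} {f : ι → MvPowerSeries τ (PowerSeries ℂ)}
    {g : κ → MvPowerSeries τ (PowerSeries ℂ)}
    (hf : Summable f) (hg : Summable g) : Summable fun x : ι × κ => f x.1 * g x.2 := by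
  classical
  refine summable_series_iff_coeff.2 fun s => ?_
  have h : Summable fun x : ι × κ => ∑ p ∈ antidiagonal s,
      MvPowerSeries.coeff p.1 (f x.1) * MvPowerSeries.coeff p.2 (g x.2) :=
    summable_sum fun p _ => summable_hbar_mul
      (f := fun i => MvPowerSeries.coeff p.1 (f i)) (g := fun i => MvPowerSeries.coeff p.2 (g i))
      (summable_series_iff_coeff.1 hf p.1) (summable_series_iff_coeff.1 hg p.2)
  refine h.congr fun x => ?_
  rw [MvPowerSeries.coeff_mul]

theorem hasSum_series_mul {ι κ : Type*} {τ : Type} {f : ι → MvPowerSeries τ (PowerSeries ℂ)}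
    {g : κ → MvPowerSeries τ (PowerSeries ℂ)} {a b : MvPowerSeries τ (PowerSeries ℂ)}
    (hf : HasSum f a) (hg : HasSum g b) : HasSum (fun x : ι × κ => f x.1 * g x.2) (a * b) :=
  hf.mul hg (summable_series_mul hf.summable hg.summable)

/-- A finite product of sums is the sum of the products. -/
theorem hasSum_series_prod {τ : Type} {κ : Type*} {n : ℕ}
    {f : Fin n → κ → MvPowerSeries τ (PowerSeries ℂ)} {v : Fin n → MvPowerSeries τ (PowerSeries ℂ)}
    (h : ∀ i, HasSum (f i) (v i)) :
    HasSum (fun c : Fin n → κ => ∏ i, f i (c i)) (∏ i, v i) := by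
  induction n with
  | zero => simp [hasSum_unique]
  | succ n ih =>
    rw [Fin.prod_univ_succ]
    have := hasSum_series_mul (h 0) (ih fun i => h i.succ)
    rw [← (Fin.consEquiv fun _ => κ).hasSum_iff]
    simpa [Function.comp_def, Fin.prod_univ_succ, Fin.consEquiv] using this

/-- The condition on `g` stands in for continuity: each coefficient of the image is a fixed multiple
of a single coefficient of the argument. It covers the Euler operator and renaming of variables. -/
theorem hasSum_series_map {τ τ' : Type} {ι : Type*} {f : ι → MvPowerSeries τ (PowerSeries ℂ)}
    {v : MvPowerSeries τ (PowerSeries ℂ)} (h : HasSum f v)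
    (g : MvPowerSeries τ (PowerSeries ℂ) →+ MvPowerSeries τ' (PowerSeries ℂ))
    (hg : ∀ s, ∃ (a : PowerSeries ℂ) (s' : τ →₀ ℕ), ∀ x, MvPowerSeries.coeff s (g x) =
      a * MvPowerSeries.coeff s' x) :
    HasSum (fun i => g (f i)) (g v) := by
  rw [hasSum_series_iff_coeff] at *
  intro s
  obtain ⟨a, s', has⟩ := hg s
  simpa only [has] using (h s').mul_left a

/-! ### The exponential of a formal series -/

section Exponential

variable {σ σ' : Type} {R R' : Type} [CommRing R] [CommRing R']

/-- The Euler operator, which multiplies the terms of degree `n` by `n`. -/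
noncomputable def euler : MvPowerSeries σ R →+ MvPowerSeries σ R where
  toFun f := fun m => (m.degree : R) * MvPowerSeries.coeff m f
  map_zero' := by ext m; exact (mul_zero _)
  map_add' f g := by ext m; exact (mul_add _ _ _)

@[simp]
theorem coeff_euler (f : MvPowerSeries σ R) (m : σ →₀ ℕ) :
    MvPowerSeries.coeff m (euler f) = (m.degree : R) * MvPowerSeries.coeff m f := rfl

theorem euler_mul (f g : MvPowerSeries σ R) : euler (f * g) = euler f * g + f * euler g := by
  classical
  ext m
  simp only [coeff_euler, map_add, MvPowerSeries.coeff_mul, mul_sum, ← sum_add_distrib]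
  refine sum_congr rfl fun p hp => ?_
  rw [← mem_antidiagonal.1 hp, map_add]
  push_cast
  ring

theorem euler_C (a : R) : euler (MvPowerSeries.C a : MvPowerSeries σ R) = 0 := by
  classical
  ext m
  rw [coeff_euler, MvPowerSeries.coeff_C]
  split_ifs with h <;> simp [h]

theorem euler_one : euler (1 : MvPowerSeries σ R) = 0 := by
  simpa using euler_C (σ := σ) (1 : R)

theorem euler_C_mul (a : R) (f : MvPowerSeries σ R) :
    euler (MvPowerSeries.C a * f) = MvPowerSeries.C a * euler f := by
  rw [euler_mul, euler_C, zero_mul, zero_add]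

theorem euler_pow_succ (f : MvPowerSeries σ R) (n : ℕ) :
    euler (f ^ (n + 1)) = ((n + 1 : ℕ) : MvPowerSeries σ R) * (f ^ n * euler f) := by
  induction n with
  | zero => simp
  | succ n ih =>
    rw [pow_succ, euler_mul, ih]
    push_cast
    ring

theorem euler_map (φ : R →+* R') (f : MvPowerSeries σ R) :
    euler (MvPowerSeries.map φ f) = MvPowerSeries.map φ (euler f) := by
  ext m
  simp

theorem euler_rename (e : σ ↪ σ') (f : MvPowerSeries σ R) :
    euler (MvPowerSeries.rename e f) = MvPowerSeries.rename e (euler f) := by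
  ext m
  by_cases hm : m ∈ Set.range (Finsupp.mapDomain e)
  · obtain ⟨m, rfl⟩ := hm
    rw [← Finsupp.embDomain_eq_mapDomain, coeff_euler, MvPowerSeries.coeff_embDomain_rename,
      MvPowerSeries.coeff_embDomain_rename, coeff_euler, Finsupp.embDomain_eq_mapDomain,
      Finsupp.degree_mapDomain]
  · rw [coeff_euler, MvPowerSeries.coeff_rename_eq_zero e _ hm,
      MvPowerSeries.coeff_rename_eq_zero e _ hm, mul_zero]

theorem coeff_pow_eq_zero {f : MvPowerSeries σ R} (hf : MvPowerSeries.constantCoeff f = 0)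
    {m : σ →₀ ℕ} {n : ℕ} (h : m.degree < n) : MvPowerSeries.coeff m (f ^ n) = 0 := by
  apply MvPowerSeries.coeff_of_lt_order
  refine lt_of_lt_of_le ?_ (MvPowerSeries.le_order_pow_of_constantCoeff_eq_zero n hf)
  exact_mod_cast h

variable [Algebra ℂ R] [Algebra ℂ R']

theorem cast_mul_cancel {n : ℕ} (hn : n ≠ 0) {a b : R} (h : (n : R) * a = n * b) : a = b := by
  have hu : IsUnit (n : R) := by
    have := (IsUnit.mk0 (n : ℂ) (Nat.cast_ne_zero.2 hn)).map (algebraMap ℂ R)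
    simpa using this
  exact hu.mul_left_cancel h

theorem eq_of_euler_eq {f g : MvPowerSeries σ R} (h : euler f = euler g)
    (h0 : MvPowerSeries.constantCoeff f = MvPowerSeries.constantCoeff g) : f = g := by
  ext m
  by_cases hm : m = 0
  · subst hm
    simpa using h0
  · exact cast_mul_cancel (n := m.degree) (by simpa [Finsupp.degree_eq_zero_iff] using hm)
      (congrArg (MvPowerSeries.coeff m) h)

/-- The solution of `D E = E g` is determined by its constant term. -/
theorem euler_eq_mul_unique {E E' g : MvPowerSeries σ R} (hg : MvPowerSeries.constantCoeff g = 0)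
    (h : euler E = E * g) (h' : euler E' = E' * g)
    (h0 : MvPowerSeries.constantCoeff E = MvPowerSeries.constantCoeff E') : E = E' := by
  classical
  suffices ∀ n : ℕ, ∀ m : σ →₀ ℕ, m.degree = n → MvPowerSeries.coeff m E = MvPowerSeries.coeff m E' by
    ext m
    exact this _ m rfl
  intro n
  induction n using Nat.strong_induction_on with
  | _ n ih =>
    intro m hm
    by_cases hn : n = 0
    · have : m = 0 := by rwa [hn, Finsupp.degree_eq_zero_iff] at hm
      subst this
      simpa using h0
    · refine cast_mul_cancel hn ?_
      have e := congrArg (MvPowerSeries.coeff m) h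
      have e' := congrArg (MvPowerSeries.coeff m) h'
      rw [coeff_euler, hm, MvPowerSeries.coeff_mul] at e e'
      rw [e, e']
      refine sum_congr rfl fun p hp => ?_
      -- Since `g` has no constant term, only coefficients of `E` of degree less than `n` enter, and
      -- the induction hypothesis applies to them.
      by_cases hp2 : p.2 = 0
      · rw [hp2, MvPowerSeries.coeff_zero_eq_constantCoeff_apply, hg, mul_zero, mul_zero]
      · have hd : p.1.degree + p.2.degree = n := by
          rw [← map_add, mem_antidiagonal.1 hp, hm]
        have : p.2.degree ≠ 0 := by simpa [Finsupp.degree_eq_zero_iff] using hp2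
        rw [ih p.1.degree (by omega) p.1 rfl]

/-- The exponential of a series without constant term. -/
noncomputable def expS (f : MvPowerSeries σ R) : MvPowerSeries σ R :=
  (PowerSeries.exp ℂ).subst f

/-- The power `f ^ n` has order at least `n`, so any truncation beyond the degree of `m` gives the
same coefficient. `N` is left free so that different coefficients can be truncated at a common
place. -/
theorem coeff_expS {f : MvPowerSeries σ R} (hf : MvPowerSeries.constantCoeff f = 0)
    (m : σ →₀ ℕ) {N : ℕ} (hN : m.degree < N) :
    MvPowerSeries.coeff m (expS f) =
      ∑ n ∈ range N, ((n.factorial : ℂ)⁻¹) • MvPowerSeries.coeff m (f ^ n) := by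
  rw [expS, PowerSeries.coeff_subst (PowerSeries.HasSubst.of_constantCoeff_zero hf),
    finsum_eq_sum_of_support_subset (s := range N)]
  · simp [PowerSeries.coeff_exp]
  · intro n hn
    by_contra h
    apply hn
    have : N ≤ n := by simpa using h
    simp [coeff_pow_eq_zero hf (lt_of_lt_of_le hN this)]

theorem constantCoeff_expS {f : MvPowerSeries σ R} (hf : MvPowerSeries.constantCoeff f = 0) :
    MvPowerSeries.constantCoeff (expS f) = 1 := by
  rw [← MvPowerSeries.coeff_zero_eq_constantCoeff_apply, coeff_expS hf 0 (N := 1) (by simp)]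
  simp

theorem euler_expS {f : MvPowerSeries σ R} (hf : MvPowerSeries.constantCoeff f = 0) :
    euler (expS f) = expS f * euler f := by
  classical
  ext m
  -- The Euler operator kills the term `n = 0` and lowers the exponent by one. Truncation at
  -- `m.degree + 2` on the left therefore matches truncation at `m.degree + 1` on the right.
  rw [coeff_euler, coeff_expS hf m (N := m.degree + 2) (by omega), sum_range_succ',
    MvPowerSeries.coeff_mul]
  have h1 : ∀ p ∈ antidiagonal m, MvPowerSeries.coeff p.1 (expS f) *
      MvPowerSeries.coeff p.2 (euler f) = ∑ n ∈ range (m.degree + 1), ((n.factorial : ℂ)⁻¹) •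
        (MvPowerSeries.coeff p.1 (f ^ n) * MvPowerSeries.coeff p.2 (euler f)) := by
    intro p hp
    have hd : p.1.degree + p.2.degree = m.degree := by rw [← map_add, mem_antidiagonal.1 hp]
    rw [coeff_expS hf p.1 (N := m.degree + 1) (by omega), sum_mul]
    simp only [smul_mul_assoc]
  rw [sum_congr rfl h1, sum_comm, mul_add, mul_sum]
  have h2 : (m.degree : R) * ((Nat.factorial 0 : ℂ)⁻¹ • MvPowerSeries.coeff m (f ^ 0)) = 0 := by
    have := congrArg (MvPowerSeries.coeff m) (euler_one (σ := σ) (R := R))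
    simpa using this
  rw [h2, add_zero]
  refine sum_congr rfl fun n _ => ?_
  rw [← smul_sum, ← MvPowerSeries.coeff_mul, mul_smul_comm, ← coeff_euler, euler_pow_succ,
    ← map_natCast (MvPowerSeries.C (σ := σ) (R := R)), MvPowerSeries.coeff_C_mul,
    Nat.factorial_succ]
  rw [← nsmul_eq_mul, ← Nat.cast_smul_eq_nsmul ℂ, smul_smul]
  congr 1
  have : ((n + 1 : ℕ) : ℂ) ≠ 0 := Nat.cast_ne_zero.2 n.succ_ne_zero
  push_cast at this ⊢
  field_simp

/-- The differential characterisation of the exponential. The functional equation, the compatibility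
with renaming, and the exponential formula for graphs are all proved by checking these two
conditions. -/
theorem eq_expS_iff {E f : MvPowerSeries σ R} (hf : MvPowerSeries.constantCoeff f = 0) :
    E = expS f ↔ MvPowerSeries.constantCoeff E = 1 ∧ euler E = E * euler f := by
  constructor
  · rintro rfl
    exact ⟨constantCoeff_expS hf, euler_expS hf⟩
  · rintro ⟨h0, h⟩
    exact euler_eq_mul_unique (by rw [← MvPowerSeries.coeff_zero_eq_constantCoeff_apply]; simp) h
      (euler_expS hf) (h0.trans (constantCoeff_expS hf).symm)

theorem expS_add {f g : MvPowerSeries σ R} (hf : MvPowerSeries.constantCoeff f = 0)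
    (hg : MvPowerSeries.constantCoeff g = 0) : expS (f + g) = expS f * expS g := by
  symm
  rw [eq_expS_iff (by simp [hf, hg])]
  refine ⟨by simp [constantCoeff_expS hf, constantCoeff_expS hg], ?_⟩
  rw [euler_mul, euler_expS hf, euler_expS hg, map_add]
  ring

theorem expS_rename (e : σ ↪ σ') {f : MvPowerSeries σ R}
    (hf : MvPowerSeries.constantCoeff f = 0) :
    expS (MvPowerSeries.rename e f) = MvPowerSeries.rename e (expS f) := by
  symm
  rw [eq_expS_iff (by rw [MvPowerSeries.constantCoeff_rename, hf])]
  refine ⟨by rw [MvPowerSeries.constantCoeff_rename, constantCoeff_expS hf], ?_⟩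
  rw [euler_rename, euler_rename, euler_expS hf, map_mul]

/-- The logarithmic derivative recovers `euler f`, because the exponential is a unit, and `euler f`
determines `f` up to its constant term. -/
theorem expS_injective {f g : MvPowerSeries σ R} (hf : MvPowerSeries.constantCoeff f = 0)
    (hg : MvPowerSeries.constantCoeff g = 0) (h : expS f = expS g) : f = g := by
  refine eq_of_euler_eq ?_ (hf.trans hg.symm)
  have hu : IsUnit (expS f) := by
    rw [MvPowerSeries.isUnit_iff_constantCoeff, constantCoeff_expS hf]
    exact isUnit_one
  apply hu.mul_left_cancel
  rw [← euler_expS hf, h, ← euler_expS hg]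

/-- Rescaling the variables: the coefficient with index `m` is multiplied by `t ^ w m`. -/
theorem expS_rescale (φ : R →+* R') {f : MvPowerSeries σ R} {g : MvPowerSeries σ R'}
    (hf : MvPowerSeries.constantCoeff f = 0) (hg : MvPowerSeries.constantCoeff g = 0)
    (w : (σ →₀ ℕ) →+ ℕ) (t : R')
    (h : ∀ m, t ^ w m * MvPowerSeries.coeff m g = φ (MvPowerSeries.coeff m f)) (m : σ →₀ ℕ) :
    t ^ w m * MvPowerSeries.coeff m (expS g) = φ (MvPowerSeries.coeff m (expS f)) := by
  classical
  -- As `w` is additive, this rescaling is multiplicative and commutes with the Euler operator, so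
  -- it carries the equation for the exponential of `g` to that for the image of `f`. It is never
  -- inverted, so `t` need not be a unit.
  let sc : MvPowerSeries σ R' → MvPowerSeries σ R' := fun a m => t ^ w m * MvPowerSeries.coeff m a
  have hsc : ∀ a m, MvPowerSeries.coeff m (sc a) = t ^ w m * MvPowerSeries.coeff m a :=
    fun _ _ => rfl
  have hmul : ∀ a b, sc (a * b) = sc a * sc b := by
    intro a b
    ext m
    rw [hsc, MvPowerSeries.coeff_mul, MvPowerSeries.coeff_mul, mul_sum]
    refine sum_congr rfl fun p hp => ?_
    rw [hsc, hsc, ← mem_antidiagonal.1 hp, map_add, pow_add]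
    ring
  have heu : ∀ a, euler (sc a) = sc (euler a) := by
    intro a
    ext m
    rw [coeff_euler, hsc, hsc, coeff_euler]
    ring
  have hg' : sc g = MvPowerSeries.map φ f := by
    ext m
    rw [hsc, h, MvPowerSeries.coeff_map]
  have key : sc (expS g) = MvPowerSeries.map φ (expS f) := by
    have e : MvPowerSeries.constantCoeff (sc (expS g)) = 1 := by
      rw [← MvPowerSeries.coeff_zero_eq_constantCoeff_apply, hsc, map_zero, pow_zero, one_mul,
        MvPowerSeries.coeff_zero_eq_constantCoeff_apply, constantCoeff_expS hg]
    refine euler_eq_mul_unique (g := MvPowerSeries.map φ (euler f)) ?_ ?_ ?_ ?_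
    · rw [← MvPowerSeries.coeff_zero_eq_constantCoeff_apply]; simp
    · rw [heu, euler_expS hg, hmul, ← heu, hg', euler_map]
    · rw [euler_map, euler_expS hf, map_mul]
    · rw [e, MvPowerSeries.constantCoeff_map, constantCoeff_expS hf, map_one]
  have := congrArg (MvPowerSeries.coeff m) key
  rwa [hsc, MvPowerSeries.coeff_map] at this

end Exponential

/-! ### Series in two sets of variables -/

section Variables

variable {σ₁ σ₂ : Type} {R : Type} [CommRing R]

/-- Only one splitting of the multi-index survives: the first factor has no variables on the right,
and the second none on the left. -/
theorem coeff_rename_inl_mul_rename_inr (f : MvPowerSeries σ₁ R) (g : MvPowerSeries σ₂ R)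
    (a : σ₁ →₀ ℕ) (b : σ₂ →₀ ℕ) :
    MvPowerSeries.coeff (Finsupp.sumElim a b)
      (MvPowerSeries.rename Function.Embedding.inl f *
        MvPowerSeries.rename Function.Embedding.inr g) =
      MvPowerSeries.coeff a f * MvPowerSeries.coeff b g := by
  classical
  rw [MvPowerSeries.coeff_mul,
    sum_eq_single (Finsupp.sumElim a 0, Finsupp.sumElim 0 b)]
  · dsimp only
    rw [← Finsupp.embDomain_inl, ← Finsupp.embDomain_inr, MvPowerSeries.coeff_embDomain_rename,
      MvPowerSeries.coeff_embDomain_rename]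
  · rintro ⟨p, q⟩ hp hne
    by_cases h1 : p ∈ Set.range (Finsupp.mapDomain (Function.Embedding.inl : σ₁ ↪ σ₁ ⊕ σ₂))
    · by_cases h2 : q ∈ Set.range (Finsupp.mapDomain (Function.Embedding.inr : σ₂ ↪ σ₁ ⊕ σ₂))
      · exfalso
        obtain ⟨p, rfl⟩ := h1
        obtain ⟨q, rfl⟩ := h2
        rw [← Finsupp.embDomain_eq_mapDomain, ← Finsupp.embDomain_eq_mapDomain,
          Finsupp.embDomain_inl, Finsupp.embDomain_inr] at hp hne
        rw [HasAntidiagonal.mem_antidiagonal, ← Finsupp.sumElim_add, add_zero, zero_add] at hp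
        have h3 : p = a := by
          ext i
          simpa using DFunLike.congr_fun hp (Sum.inl i)
        have h4 : q = b := by
          ext i
          simpa using DFunLike.congr_fun hp (Sum.inr i)
        exact hne (by rw [h3, h4])
      · dsimp only
        rw [MvPowerSeries.coeff_rename_eq_zero _ _ h2, mul_zero]
    · dsimp only
      rw [MvPowerSeries.coeff_rename_eq_zero _ _ h1, zero_mul]
  · intro h
    exact absurd (HasAntidiagonal.mem_antidiagonal.2 (by rw [← Finsupp.sumElim_add, add_zero, zero_add])) h

/-- The coefficients of a series in two sets of variables with respect to the first set. -/
def curryFun (f : MvPowerSeries (σ₁ ⊕ σ₂) R) : MvPowerSeries σ₁ (MvPowerSeries σ₂ R) :=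
  fun a b => MvPowerSeries.coeff (Finsupp.sumElim a b) f

theorem coeff_coeff_curryFun (f : MvPowerSeries (σ₁ ⊕ σ₂) R) (a : σ₁ →₀ ℕ) (b : σ₂ →₀ ℕ) :
    MvPowerSeries.coeff b (MvPowerSeries.coeff a (curryFun f)) =
      MvPowerSeries.coeff (Finsupp.sumElim a b) f := rfl

/-- A series in two sets of variables as a series in the first set of variables. -/
noncomputable def curryS : MvPowerSeries (σ₁ ⊕ σ₂) R →+* MvPowerSeries σ₁ (MvPowerSeries σ₂ R) where
  toFun := curryFun
  map_zero' := rfl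
  map_one' := by
    classical
    refine MvPowerSeries.ext fun a => MvPowerSeries.ext fun b => ?_
    rw [coeff_coeff_curryFun, MvPowerSeries.coeff_one, MvPowerSeries.coeff_one]
    by_cases ha : a = 0
    · subst ha
      rw [if_pos rfl, MvPowerSeries.coeff_one]
      congr 1
      refine propext ⟨fun h => ?_, fun h => by rw [h, Finsupp.sumElim_zero_zero]⟩
      ext i
      simpa using DFunLike.congr_fun h (Sum.inr i)
    · rw [if_neg ha, if_neg, map_zero]
      intro h
      apply ha
      ext i
      simpa using DFunLike.congr_fun h (Sum.inl i)
  map_add' _ _ := rfl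
  map_mul' f g := by
    classical
    refine MvPowerSeries.ext fun a => MvPowerSeries.ext fun b => ?_
    rw [coeff_coeff_curryFun, MvPowerSeries.coeff_mul, MvPowerSeries.coeff_mul, map_sum]
    simp only [MvPowerSeries.coeff_mul, coeff_coeff_curryFun]
    rw [← sum_product']
    refine sum_nbij' (fun p => ((Finsupp.sumFinsuppEquivProdFinsupp p.1).1,
        (Finsupp.sumFinsuppEquivProdFinsupp p.2).1, (Finsupp.sumFinsuppEquivProdFinsupp p.1).2,
        (Finsupp.sumFinsuppEquivProdFinsupp p.2).2) |> fun q => ((q.1, q.2.1), (q.2.2.1, q.2.2.2)))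
      (fun q => (Finsupp.sumElim q.1.1 q.2.1, Finsupp.sumElim q.1.2 q.2.2)) ?_ ?_ ?_ ?_ ?_
    · rintro ⟨p, q⟩ h
      have h' := mem_antidiagonal.1 h
      simp only [mem_product, HasAntidiagonal.mem_antidiagonal]
      constructor
      · ext i
        simpa using DFunLike.congr_fun h' (Sum.inl i)
      · ext i
        simpa using DFunLike.congr_fun h' (Sum.inr i)
    · rintro ⟨⟨p, p'⟩, q, q'⟩ h
      simp only [mem_product, HasAntidiagonal.mem_antidiagonal] at h ⊢
      rw [← Finsupp.sumElim_add, h.1, h.2]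
    · rintro ⟨p, q⟩ _
      exact Prod.ext (Finsupp.sumFinsuppEquivProdFinsupp.symm_apply_apply p)
        (Finsupp.sumFinsuppEquivProdFinsupp.symm_apply_apply q)
    · rintro ⟨⟨p, p'⟩, q, q'⟩ _
      have h1 := Finsupp.sumFinsuppEquivProdFinsupp.apply_symm_apply (p, q)
      have h2 := Finsupp.sumFinsuppEquivProdFinsupp.apply_symm_apply (p', q')
      change Finsupp.sumFinsuppEquivProdFinsupp (Finsupp.sumElim p q) = _ at h1
      change Finsupp.sumFinsuppEquivProdFinsupp (Finsupp.sumElim p' q') = _ at h2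
      simp only [h1, h2]
    · rintro ⟨p, q⟩ _
      have h1 := Finsupp.sumFinsuppEquivProdFinsupp.symm_apply_apply p
      have h2 := Finsupp.sumFinsuppEquivProdFinsupp.symm_apply_apply q
      change Finsupp.sumElim _ _ = _ at h1 h2
      conv_lhs => rw [← h1, ← h2]

theorem coeff_coeff_curryS (f : MvPowerSeries (σ₁ ⊕ σ₂) R) (a : σ₁ →₀ ℕ) (b : σ₂ →₀ ℕ) :
    MvPowerSeries.coeff b (MvPowerSeries.coeff a (curryS f)) =
      MvPowerSeries.coeff (Finsupp.sumElim a b) f := rfl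

end Variables

/-! ### Divided powers and contingency tables -/

section DividedPowers

variable {d : ℕ} {R : Type} [CommRing R]

/-- The linear form `∑ f_i X_i`. -/
noncomputable def linearForm (f : Fin d → R) : MvPowerSeries (Fin d) R :=
  ∑ i, MvPowerSeries.monomial (Finsupp.single i 1) (f i)

theorem coeff_linearForm (f : Fin d → R) (m : Fin d →₀ ℕ) :
    MvPowerSeries.coeff m (linearForm f) = ∑ i, if m = Finsupp.single i 1 then f i else 0 := by
  rw [linearForm, map_sum]
  exact sum_congr rfl fun i _ => MvPowerSeries.coeff_monomial _ _ _

theorem constantCoeff_linearForm (f : Fin d → R) :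
    MvPowerSeries.constantCoeff (linearForm f) = 0 := by
  rw [← MvPowerSeries.coeff_zero_eq_constantCoeff_apply, coeff_linearForm]
  refine sum_eq_zero fun i _ => if_neg fun h => ?_
  simpa using DFunLike.congr_fun h i

theorem sum_finsuppAntidiag_eq_piAntidiag {ι : Type} [Fintype ι] [DecidableEq ι] {A : Type}
    [AddCommMonoid A] (F : (ι → Fin d →₀ ℕ) → A) (c : Fin d →₀ ℕ) :
    ∑ l ∈ finsuppAntidiag univ c, F l = ∑ l ∈ piAntidiag univ c, F l := by
  refine sum_nbij' (fun l => ⇑l) (fun l => Finsupp.equivFunOnFinite.symm l) ?_ ?_ ?_ ?_ ?_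
  · intro l hl
    simpa using (mem_finsuppAntidiag.1 hl).1
  · intro l hl
    rw [mem_finsuppAntidiag]
    exact ⟨by simpa using (mem_piAntidiag.1 hl).1, subset_univ _⟩
  · intro l _
    ext
    simp
  · intro l _
    rfl
  · intro l _
    rfl

theorem coeff_prod_univ {ι : Type} [Fintype ι] [DecidableEq ι]
    (f : ι → MvPowerSeries (Fin d) R) (c : Fin d →₀ ℕ) :
    MvPowerSeries.coeff c (∏ i, f i) =
      ∑ l ∈ piAntidiag univ c, ∏ i, MvPowerSeries.coeff (l i) (f i) := by
  rw [MvPowerSeries.coeff_prod]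
  exact sum_finsuppAntidiag_eq_piAntidiag (fun l => ∏ i, MvPowerSeries.coeff (l i) (f i)) c

theorem linearForm_sum {ι : Type} [Fintype ι] (f : ι → Fin d → R) :
    linearForm (∑ x, f x) = ∑ x, linearForm (f x) := by
  simp only [linearForm, Finset.sum_apply, map_sum]
  rw [sum_comm]

variable [Algebra ℂ R]

/-- The divided power `f^c / c!`. -/
noncomputable def divPow (f : Fin d → R) (c : Fin d →₀ ℕ) : R :=
  ∏ i, (((c i).factorial : ℂ)⁻¹) • f i ^ c i

/-- The multi-index factorial. -/
def multiFactorial (c : Fin d →₀ ℕ) : ℂ := ∏ i, ((c i).factorial : ℂ)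

theorem multiFactorial_ne_zero (c : Fin d →₀ ℕ) : multiFactorial c ≠ 0 :=
  prod_ne_zero_iff.2 fun _ _ => Nat.cast_ne_zero.2 (Nat.factorial_ne_zero _)

theorem multiFactorial_zero : multiFactorial (0 : Fin d →₀ ℕ) = 1 := by
  simp [multiFactorial]

theorem divPow_eq (f : Fin d → R) (c : Fin d →₀ ℕ) :
    divPow f c = (multiFactorial c)⁻¹ • ∏ i, f i ^ c i := by
  rw [divPow, multiFactorial, prod_smul, prod_inv_distrib]

/-- Divided powers are the coefficients of an exponential, which turns their multinomial theorem
into the functional equation. The Euler equation reads `|m| f^m/m! = ∑ i, f_i f^(m - e_i)/(m -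
e_i)!`, which holds term by term because `m_i/m! = 1/(m - e_i)!`. -/
theorem coeff_expS_linearForm (f : Fin d → R) (c : Fin d →₀ ℕ) :
    MvPowerSeries.coeff c (expS (linearForm f)) = divPow f c := by
  let E : MvPowerSeries (Fin d) R := fun c => divPow f c
  have hE : ∀ c, MvPowerSeries.coeff c E = divPow f c := fun _ => rfl
  suffices E = expS (linearForm f) by rw [← this, hE]
  rw [eq_expS_iff (constantCoeff_linearForm f)]
  constructor
  · rw [← MvPowerSeries.coeff_zero_eq_constantCoeff_apply, hE]
    simp [divPow]
  · have hL : euler (linearForm f) = linearForm f := by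
      ext m
      rw [coeff_euler, coeff_linearForm, mul_sum]
      refine sum_congr rfl fun i _ => ?_
      split_ifs with h
      · rw [h, Finsupp.degree_single, Nat.cast_one, one_mul]
      · rw [mul_zero]
    ext m
    rw [hL, coeff_euler, hE, linearForm, mul_sum, map_sum, Finsupp.degree_eq_sum, Nat.cast_sum,
      sum_mul]
    refine sum_congr rfl fun i _ => ?_
    rw [MvPowerSeries.coeff_mul_monomial, hE]
    split_ifs with h
    · have h1 : 1 ≤ m i := by simpa using h i
      obtain ⟨k, hk⟩ := Nat.exists_eq_add_of_le' h1
      rw [divPow, divPow, ← mul_prod_erase _ _ (mem_univ i), ← mul_prod_erase _ _ (mem_univ i)]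
      have h2 : ∏ x ∈ univ.erase i, (((((m - Finsupp.single i 1 : Fin d →₀ ℕ) x).factorial : ℂ)⁻¹) •
          f x ^ (m - Finsupp.single i 1 : Fin d →₀ ℕ) x) =
          ∏ x ∈ univ.erase i, ((((m x).factorial : ℂ)⁻¹) • f x ^ m x) := by
        refine prod_congr rfl fun x hx => ?_
        have : (m - Finsupp.single i 1 : Fin d →₀ ℕ) x = m x := by
          rw [Finsupp.tsub_apply, Finsupp.single_apply, if_neg (ne_of_mem_erase hx).symm,
            Nat.sub_zero]
        rw [this]
      rw [h2, ← mul_assoc]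
      have h3 : (m - Finsupp.single i 1 : Fin d →₀ ℕ) i = k := by simp [hk]
      have h4 : (m i : R) * (((m i).factorial : ℂ)⁻¹ • f i ^ m i) =
          ((k.factorial : ℂ)⁻¹ • f i ^ k) * f i := by
        rw [hk, smul_mul_assoc, ← pow_succ, ← nsmul_eq_mul, ← Nat.cast_smul_eq_nsmul ℂ, smul_smul,
          Nat.factorial_succ]
        congr 1
        have : ((k + 1 : ℕ) : ℂ) ≠ 0 := Nat.cast_ne_zero.2 k.succ_ne_zero
        push_cast at this ⊢
        field_simp
      rw [h3, h4]
      ring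
    · have h1 : m i = 0 := by
        by_contra h0
        exact h (by simpa [Finsupp.single_le_iff] using Nat.one_le_iff_ne_zero.2 h0)
      simp [h1]

theorem expS_sum {σ : Type} {ι : Type} (s : Finset ι) (f : ι → MvPowerSeries σ R)
    (hf : ∀ x, MvPowerSeries.constantCoeff (f x) = 0) :
    expS (∑ x ∈ s, f x) = ∏ x ∈ s, expS (f x) := by
  classical
  induction s using Finset.induction_on with
  | empty =>
    rw [sum_empty, prod_empty]
    symm
    rw [eq_expS_iff (map_zero _)]
    simp [euler_one]
  | insert a s ha ih =>
    rw [sum_insert ha, prod_insert ha, expS_add (hf a) (by simp [hf]), ih]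

/-- The multinomial theorem for divided powers. -/
theorem divPow_sum {ι : Type} [Fintype ι] [DecidableEq ι] (f : ι → Fin d → R) (c : Fin d →₀ ℕ) :
    divPow (∑ x, f x) c = ∑ l ∈ piAntidiag univ c, ∏ x, divPow (f x) (l x) := by
  rw [← coeff_expS_linearForm, linearForm_sum, expS_sum _ _ fun x => constantCoeff_linearForm _,
    coeff_prod_univ]
  simp only [coeff_expS_linearForm]

/-- The sum of `∏ 1 / N_{xy}!` over the matrices with given row sums and column sums. -/
theorem sum_contingency {X Y : Type} [Fintype X] [Fintype Y] [DecidableEq X] [DecidableEq Y]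
    (A : Fin d →₀ ℕ) {a : X → Fin d →₀ ℕ} {b : Y → Fin d →₀ ℕ} (ha : ∑ x, a x = A)
    (hb : ∑ y, b y = A) :
    (∏ x, multiFactorial (a x)) * (∏ y, multiFactorial (b y)) *
      (∑ N ∈ (piAntidiag (univ : Finset (X × Y)) A).filter
        (fun N => (∀ x, ∑ y, N (x, y) = a x) ∧ ∀ y, ∑ x, N (x, y) = b y),
        ∏ p, (multiFactorial (N p))⁻¹) = multiFactorial A := by
  -- Monomials in a monoid algebra whose exponents are families of multi-indices indexed by the
  -- rows, so that the exponent of a product records its row sums.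
  let f : X → Fin d → AddMonoidAlgebra ℂ (X → Fin d →₀ ℕ) := fun x i =>
    AddMonoidAlgebra.single (Pi.single x (Finsupp.single i 1)) 1
  have hf : ∀ x c, divPow (f x) c = (multiFactorial c)⁻¹ •
      (AddMonoidAlgebra.single (Pi.single x c) 1 : AddMonoidAlgebra ℂ (X → Fin d →₀ ℕ)) := by
    intro x c
    rw [divPow_eq]
    congr 1
    simp only [f, AddMonoidAlgebra.single_pow, AddMonoidAlgebra.prod_single, one_pow, prod_const_one]
    congr 1
    ext y i
    by_cases hy : y = x
    · subst hy
      simp [Finset.sum_apply]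
    · simp [Finset.sum_apply, hy]
  have hprod : ∀ l : X → Fin d →₀ ℕ, ∏ x, divPow (f x) (l x) =
      (∏ x, (multiFactorial (l x))⁻¹) • (AddMonoidAlgebra.single l 1 : AddMonoidAlgebra ℂ (X → Fin d →₀ ℕ)) := by
    intro l
    simp only [hf, prod_smul, AddMonoidAlgebra.prod_single, prod_const_one]
    rw [univ_sum_single]
  -- Both sides are the power of `∑ x, f x` with exponent `A = ∑ y, b y`, up to factorials.
  -- Expanding the left side column by column produces all matrices with column sums `b`.
  have key : ∏ y, divPow (∑ x, f x) (b y) = (multiFactorial A * ∏ y, (multiFactorial (b y))⁻¹) •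
      divPow (∑ x, f x) A := by
    simp only [divPow_eq, prod_smul]
    rw [smul_smul]
    congr 1
    · field_simp [multiFactorial_ne_zero A]
    · rw [prod_comm]
      refine prod_congr rfl fun i _ => ?_
      rw [prod_pow_eq_pow_sum, ← hb, Finsupp.finsetSum_apply]
  -- The coefficient with exponent `a` selects the row sums: on the left it leaves the sum over
  -- matrices with both margins prescribed, on the right the single term `l = a`.
  have h1 := congrArg (fun z : AddMonoidAlgebra ℂ (X → Fin d →₀ ℕ) => z.coeff a) key
  simp only [divPow_sum f, hprod, prod_univ_sum] at h1
  simp only [prod_smul, AddMonoidAlgebra.prod_single, prod_const_one, AddMonoidAlgebra.coeff_sum,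
    AddMonoidAlgebra.coeff_smul, AddMonoidAlgebra.coeff_single, Finsupp.finsetSum_apply,
    Finsupp.smul_apply, Finsupp.single_apply, smul_eq_mul, mul_ite, mul_one, mul_zero] at h1
  rw [sum_ite_eq' (piAntidiag univ A) a, if_pos (by simpa using ha)] at h1
  have h2 : ∑ N ∈ (piAntidiag (univ : Finset (X × Y)) A).filter
        (fun N => (∀ x, ∑ y, N (x, y) = a x) ∧ ∀ y, ∑ x, N (x, y) = b y),
        ∏ p, (multiFactorial (N p))⁻¹ =
      multiFactorial A * (∏ y, (multiFactorial (b y))⁻¹) * ∏ x, (multiFactorial (a x))⁻¹ := by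
    rw [← h1, ← sum_filter]
    refine sum_nbij' (fun N y x => N (x, y)) (fun N p => N p.2 p.1) ?_ ?_ ?_ ?_ ?_
    · intro N hN
      simp only [mem_filter, mem_piAntidiag, Fintype.mem_piFinset] at hN ⊢
      refine ⟨fun y => ⟨hN.2.2 y, by simp⟩, ?_⟩
      ext1 x
      simpa using hN.2.1 x
    · intro N hN
      simp only [mem_filter, mem_piAntidiag, Fintype.mem_piFinset] at hN ⊢
      refine ⟨⟨?_, by simp⟩, fun x => ?_, fun y => (hN.1 y).1⟩
      · rw [Fintype.sum_prod_type_right, ← hb]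
        exact sum_congr rfl fun y _ => (hN.1 y).1
      · rw [← hN.2, Finset.sum_apply]
    · intro N _
      rfl
    · intro N _
      rfl
    · intro N _
      rw [Fintype.prod_prod_type_right]
  rw [h2]
  have ha0 : ∏ x, multiFactorial (a x) ≠ 0 := prod_ne_zero_iff.2 fun _ _ => multiFactorial_ne_zero _
  have hb0 : ∏ y, multiFactorial (b y) ≠ 0 := prod_ne_zero_iff.2 fun _ _ => multiFactorial_ne_zero _
  rw [prod_inv_distrib, prod_inv_distrib]
  field_simp

/-- Wick's formula: the pairing of a product of series in `q` with a product of series in `η` is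
a sum over matrices of contractions. -/
theorem wick {X Y : Type} [Fintype X] [Fintype Y] [DecidableEq X] [DecidableEq Y]
    (p : X → (Fin d →₀ ℕ) → R) (q : Y → (Fin d →₀ ℕ) → R) (A : Fin d →₀ ℕ) :
    multiFactorial A • ((∑ a ∈ piAntidiag univ A, ∏ x, p x (a x)) *
        ∑ b ∈ piAntidiag univ A, ∏ y, q y (b y)) =
      ∑ N ∈ piAntidiag (univ : Finset (X × Y)) A, (∏ z, (multiFactorial (N z))⁻¹) •
        ((∏ x, multiFactorial (∑ y, N (x, y)) • p x (∑ y, N (x, y))) *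
          ∏ y, multiFactorial (∑ x, N (x, y)) • q y (∑ x, N (x, y))) := by
  -- The matrices are grouped by their row and column sums. The vertex factors are constant on a
  -- group, and `sum_contingency` evaluates the sum of `∏ 1/N!`: the factorials of the margins
  -- cancel, and the factor `A!` of the pairing remains.
  have h1 : ∀ N ∈ piAntidiag (univ : Finset (X × Y)) A,
      ((fun x => ∑ y, N (x, y), fun y => ∑ x, N (x, y)) :
        (X → Fin d →₀ ℕ) × (Y → Fin d →₀ ℕ)) ∈ piAntidiag univ A ×ˢ piAntidiag univ A := by
    intro N hN
    have hN' := (mem_piAntidiag.1 hN).1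
    simp only [mem_product, mem_piAntidiag, mem_univ, implies_true, and_true]
    exact ⟨by rw [← hN', ← Fintype.sum_prod_type], by rw [← hN', ← Fintype.sum_prod_type_right]⟩
  rw [← sum_fiberwise_of_maps_to h1, sum_mul_sum, ← sum_product', smul_sum]
  refine sum_congr rfl ?_
  rintro ⟨a, b⟩ hab
  simp only [mem_product, mem_piAntidiag, mem_univ, implies_true, and_true] at hab
  rw [← sum_contingency A hab.1 hab.2, mul_sum, sum_smul]
  refine sum_congr ?_ fun N hN => ?_
  · ext N
    simp [Prod.ext_iff, funext_iff]
  · simp only [mem_filter, Prod.mk.injEq] at hN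
    have hx : ∀ x, ∑ y, N (x, y) = a x := fun x => congrFun hN.2.1 x
    have hy : ∀ y, ∑ x, N (x, y) = b y := fun y => congrFun hN.2.2 y
    simp only [hx, hy, prod_smul, smul_mul_assoc, mul_smul_comm, smul_smul]
    congr 1
    ring

end DividedPowers

/-! ### The exponential formula -/

section Sums

variable {τ : Type} {ι κ : Type*}

theorem hasSum_series_smul {f : ι → MvPowerSeries τ (PowerSeries ℂ)}
    {v : MvPowerSeries τ (PowerSeries ℂ)} (h : HasSum f v) (c : ℂ) :
    HasSum (fun i => c • f i) (c • v) := by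
  simpa only [Algebra.smul_def] using h.mul_left _

theorem hasSum_euler {f : ι → MvPowerSeries τ (PowerSeries ℂ)}
    {v : MvPowerSeries τ (PowerSeries ℂ)} (h : HasSum f v) :
    HasSum (fun i => euler (f i)) (euler v) :=
  hasSum_series_map h euler fun s => ⟨_, s, fun _ => rfl⟩

/-- Summation along the fibres of a map. -/
theorem hasSum_fiber [DecidableEq κ] {f : ι → MvPowerSeries τ (PowerSeries ℂ)}
    {v : MvPowerSeries τ (PowerSeries ℂ)} {T : κ → MvPowerSeries τ (PowerSeries ℂ)} (g : ι → κ)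
    (hf : HasSum f v) (h : ∀ k, HasSum (fun i => if g i = k then f i else 0) (T k)) :
    HasSum T v := by
  refine ((Equiv.sigmaFiberEquiv g).hasSum_iff.2 hf).sigma fun k => ?_
  have h1 := h k
  have h2 : (fun i => if g i = k then f i else 0) = Set.indicator {i | g i = k} f := by
    ext1 i
    rw [Set.indicator_apply]
    rfl
  rw [h2, ← hasSum_subtype_iff_indicator] at h1
  exact h1

theorem summable_ite {f : ι → MvPowerSeries τ (PowerSeries ℂ)} (hf : Summable f) (p : ι → Prop)
    [DecidablePred p] : Summable fun i => if p i then f i else 0 := by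
  rw [summable_series_iff] at *
  refine fun s k => (hf s k).subset fun i hi => ?_
  by_contra h
  apply hi
  have h' : PowerSeries.coeff k (MvPowerSeries.coeff s (f i)) = 0 := by simpa using h
  dsimp only
  split_ifs
  · exact h'
  · simp

theorem coeff_complex_smul {σ R : Type} [CommRing R] [Algebra ℂ R] (c : ℂ)
    (f : MvPowerSeries σ R) (m : σ →₀ ℕ) :
    MvPowerSeries.coeff m (c • f) = c • MvPowerSeries.coeff m f := rfl

theorem euler_smul {σ R : Type} [CommRing R] [Algebra ℂ R] (c : ℂ) (f : MvPowerSeries σ R) :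
    euler (c • f) = c • euler f := by
  ext m
  rw [coeff_euler, coeff_complex_smul, coeff_complex_smul, coeff_euler, mul_smul_comm]

/-- The Leibniz rule, written so that each summand is again a product over all `y` with one factor
modified; this is the shape of a graph with a marked vertex. -/
theorem euler_prod {σ R : Type} [CommRing R] {Y : Type} [Fintype Y] [DecidableEq Y]
    (f : Y → MvPowerSeries σ R) :
    euler (∏ y, f y) = ∑ y, ∏ y', if y' = y then euler (f y') else f y' := by
  have h1 : ∀ s : Finset Y, euler (∏ y ∈ s, f y) =
      ∑ y ∈ s, euler (f y) * ∏ y' ∈ s.erase y, f y' := by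
    intro s
    induction s using Finset.induction_on with
    | empty => simp [euler_one]
    | insert a s ha ih =>
      rw [prod_insert ha, euler_mul, ih, sum_insert ha, erase_insert ha, mul_sum]
      congr 1
      refine sum_congr rfl fun y hy => ?_
      have : a ≠ y := by
        rintro rfl
        exact ha hy
      rw [erase_insert_of_ne this, prod_insert fun h => ha (mem_of_mem_erase h)]
      ring
  rw [h1]
  refine sum_congr rfl fun y _ => ?_
  rw [← mul_prod_erase univ _ (mem_univ y), if_pos rfl]
  congr 1
  exact prod_congr rfl fun y' hy' => (if_neg (ne_of_mem_erase hy')).symm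

end Sums

/-! ### Matrices as bipartite graphs: components, connectedness, disjoint unions -/

section Tables

variable {X Y X' Y' X₁ X₂ Y₁ Y₂ : Type} {M : Type} [AddCommMonoid M]

/-- A set of vertices which is a union of connected components. -/
def IsClosedIn (N : X → Y → M) (D : Set (X ⊕ Y)) : Prop :=
  ∀ x y, N x y ≠ 0 → (Sum.inl x ∈ D ↔ Sum.inr y ∈ D)

/-- Connectedness of the bipartite graph with an edge between `x` and `y` whenever `N x y ≠ 0`. -/
def IsConn (N : X → Y → M) : Prop :=
  ∀ D, IsClosedIn N D → D.Nonempty → D = Set.univ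

/-- The connected component of a white vertex. -/
def component (N : X → Y → M) (y₀ : Y) : Set (X ⊕ Y) :=
  {z | ∀ D, IsClosedIn N D → Sum.inr y₀ ∈ D → z ∈ D}

theorem isClosedIn_component (N : X → Y → M) (y₀ : Y) : IsClosedIn N (component N y₀) := by
  intro x y hN
  exact forall_congr' fun D => forall_congr' fun hD => forall_congr' fun _ => hD x y hN

theorem mem_component_self (N : X → Y → M) (y₀ : Y) : Sum.inr y₀ ∈ component N y₀ :=
  fun _ _ h => h

theorem IsClosedIn.compl {N : X → Y → M} {D : Set (X ⊕ Y)} (h : IsClosedIn N D) :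
    IsClosedIn N Dᶜ := fun x y hN => not_congr (h x y hN)

/-- A nonempty closed set that misses `y₀` would have a closed complement containing `y₀`, and this
complement would be everything. -/
theorem isConn_iff_component {N : X → Y → M} (y₀ : Y) :
    IsConn N ↔ component N y₀ = Set.univ := by
  constructor
  · intro h
    exact h _ (isClosedIn_component N y₀) ⟨_, mem_component_self N y₀⟩
  · intro h D hD hne
    have key : ∀ D, IsClosedIn N D → Sum.inr y₀ ∈ D → D = Set.univ := by
      intro D hD h0
      refine Set.eq_univ_of_forall fun z => ?_
      have : z ∈ component N y₀ := h ▸ Set.mem_univ z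
      exact this D hD h0
    by_cases h0 : Sum.inr y₀ ∈ D
    · exact key D hD h0
    · exfalso
      have h1 := key _ hD.compl h0
      obtain ⟨z, hz⟩ := hne
      have : z ∈ Dᶜ := h1 ▸ Set.mem_univ z
      exact this hz

theorem isConn_reindex (eX : X ≃ X') (eY : Y ≃ Y') (N : X' → Y' → M) :
    IsConn (fun x y => N (eX x) (eY y)) ↔ IsConn N := by
  constructor
  · intro h D hD hne
    have h1 := h (Sum.map eX eY ⁻¹' D) (fun x y hN => hD _ _ hN) (by
      obtain ⟨z, hz⟩ := hne
      refine ⟨Sum.map eX.symm eY.symm z, ?_⟩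
      cases z <;> simpa using hz)
    refine Set.eq_univ_of_forall fun z => ?_
    have : Sum.map eX.symm eY.symm z ∈ Sum.map eX eY ⁻¹' D := h1 ▸ Set.mem_univ _
    cases z <;> simpa using this
  · intro h D hD hne
    have h1 := h (Sum.map eX.symm eY.symm ⁻¹' D)
      (fun x y hN => hD (eX.symm x) (eY.symm y) (by simpa using hN)) (by
      obtain ⟨z, hz⟩ := hne
      refine ⟨Sum.map eX eY z, ?_⟩
      cases z <;> simpa using hz)
    refine Set.eq_univ_of_forall fun z => ?_
    have : Sum.map eX eY z ∈ Sum.map eX.symm eY.symm ⁻¹' D := h1 ▸ Set.mem_univ _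
    cases z <;> simpa using this

/-- The disjoint union of two graphs. -/
def blocks (N₁ : X₁ → Y₁ → M) (N₂ : X₂ → Y₂ → M) : X₁ ⊕ X₂ → Y₁ ⊕ Y₂ → M
  | Sum.inl x, Sum.inl y => N₁ x y
  | Sum.inr x, Sum.inr y => N₂ x y
  | _, _ => 0

/-- The vertices of the first graph. -/
def firstBlock : Set ((X₁ ⊕ X₂) ⊕ (Y₁ ⊕ Y₂)) :=
  {z | Sum.elim (fun x => x.isLeft) (fun y => y.isLeft) z = true}

/-- No edge joins the two blocks, so the first block is closed and contains the component of `y₁`.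
Equality holds precisely if nothing smaller inside the block is closed, that is, if the first graph
is connected. -/
theorem component_blocks (N₁ : X₁ → Y₁ → M) (N₂ : X₂ → Y₂ → M) (y₁ : Y₁) :
    component (blocks N₁ N₂) (Sum.inl y₁) = firstBlock ↔ IsConn N₁ := by
  have hclosed : IsClosedIn (blocks N₁ N₂) firstBlock := by
    rintro (x | x) (y | y) hN <;> simp [firstBlock, blocks] at hN ⊢
  rw [isConn_iff_component y₁]
  constructor
  · intro h
    refine Set.eq_univ_of_forall fun z D hD h0 => ?_
    have hz : Sum.map Sum.inl Sum.inl z ∈ component (blocks N₁ N₂) (Sum.inl y₁) := by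
      rw [h]
      cases z <;> simp [firstBlock]
    have := hz {z | ∃ z' ∈ D, z = Sum.map Sum.inl Sum.inl z'} ?_ ⟨Sum.inr y₁, h0, rfl⟩
    · obtain ⟨z', hz', e⟩ := this
      have : z = z' := by
        rcases z with z | z <;> rcases z' with z' | z' <;> simp at e ⊢ <;> exact e
      rwa [this]
    · rintro (x | x) (y | y) hN
      · have := hD x y hN
        simpa using this
      · simp [blocks] at hN
      · simp [blocks] at hN
      · simp
  · intro h
    refine Set.Subset.antisymm (fun z hz => hz _ hclosed rfl) fun z hz D hD h0 => ?_
    have key : ∀ z', Sum.map Sum.inl Sum.inl z' ∈ D := by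
      intro z'
      have hz' : z' ∈ component N₁ y₁ := h ▸ Set.mem_univ z'
      exact hz' (Sum.map Sum.inl Sum.inl ⁻¹' D) (fun x y hN => hD (Sum.inl x) (Sum.inl y) hN) h0
    rcases z with (x | x) | (y | y)
    · exact key (Sum.inl x)
    · simp [firstBlock] at hz
    · exact key (Sum.inr y)
    · simp [firstBlock] at hz

theorem eq_blocks {N : X₁ ⊕ X₂ → Y₁ ⊕ Y₂ → M} (h : IsClosedIn N firstBlock) :
    N = blocks (fun x y => N (Sum.inl x) (Sum.inl y)) fun x y => N (Sum.inr x) (Sum.inr y) := by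
  ext (x | x) (y | y)
  · rfl
  · by_contra hN
    have := h (Sum.inl x) (Sum.inr y) hN
    simp [firstBlock] at this
  · by_contra hN
    have := h (Sum.inr x) (Sum.inl y) hN
    simp [firstBlock] at this
  · rfl

theorem component_reindex (eX : X ≃ X') (eY : Y ≃ Y') (N : X' → Y' → M) (y₀ : Y) :
    component (fun x y => N (eX x) (eY y)) y₀ = Sum.map eX eY ⁻¹' component N (eY y₀) := by
  ext z
  constructor
  · intro h D hD h0
    exact h (Sum.map eX eY ⁻¹' D) (fun x y hN => hD _ _ hN) h0
  · intro h D hD h0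
    have := h (Sum.map eX.symm eY.symm ⁻¹' D)
      (fun x y hN => hD (eX.symm x) (eY.symm y) (by simpa using hN)) (by simpa using h0)
    cases z <;> simpa using this

variable [Fintype X] [Fintype Y] [Fintype X'] [Fintype Y'] [Fintype X₁] [Fintype X₂]
  [Fintype Y₁] [Fintype Y₂] {A : Type} [CommRing A]

/-- The contribution of a matrix of edges: `bl` and `wh` are the factors of the vertices, and `κ`
is the factor of the edges between two vertices. -/
def tableWeight (bl : M → A) (κ : M → A) (wh : Y → M → A) (N : X → Y → M) : A :=
  (∏ x, bl (∑ y, N x y)) * (∏ y, wh y (∑ x, N x y)) * ∏ x, ∏ y, κ (N x y)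

theorem tableWeight_reindex (eX : X ≃ X') (eY : Y ≃ Y') (bl κ : M → A) (wh : Y' → M → A)
    (N : X' → Y' → M) :
    tableWeight bl κ (fun y => wh (eY y)) (fun x y => N (eX x) (eY y)) = tableWeight bl κ wh N := by
  unfold tableWeight
  congr 1
  · congr 1
    · rw [← eX.prod_comp]
      exact prod_congr rfl fun x _ => congrArg bl (eY.sum_comp fun y => N (eX x) y)
    · rw [← eY.prod_comp]
      exact prod_congr rfl fun y _ => congrArg _ (eX.sum_comp fun x => N x (eY y))
  · rw [← eX.prod_comp]
    exact prod_congr rfl fun x _ => eY.prod_comp fun y => κ (N (eX x) y)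

/-- The zero entries between different blocks contribute `κ 0`, which is why `κ 0 = 1` is needed for
multiplicativity. -/
theorem tableWeight_blocks (bl κ : M → A) (hκ : κ 0 = 1) (wh : Y₁ ⊕ Y₂ → M → A)
    (N₁ : X₁ → Y₁ → M) (N₂ : X₂ → Y₂ → M) :
    tableWeight bl κ wh (blocks N₁ N₂) =
      tableWeight bl κ (fun y => wh (Sum.inl y)) N₁ *
        tableWeight bl κ (fun y => wh (Sum.inr y)) N₂ := by
  simp only [tableWeight, Fintype.prod_sum_type, Fintype.sum_sum_type, blocks, hκ, prod_const_one,
    sum_const_zero, add_zero, zero_add, mul_one, one_mul]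
  ring

end Tables

/-! ### Estimates of order that make the sums over graphs locally finite -/

section Bounds

variable {τ : Type}

theorem coeff_coeff_C_mul_eq_zero {b : PowerSeries ℂ} {k : ℕ} (h : PowerSeries.X ^ (k + 1) ∣ b)
    (s : τ →₀ ℕ) (g : MvPowerSeries τ (PowerSeries ℂ)) :
    PowerSeries.coeff k (MvPowerSeries.coeff s (MvPowerSeries.C b * g)) = 0 := by
  rw [MvPowerSeries.coeff_C_mul]
  exact PowerSeries.X_pow_dvd_iff.1 (dvd_mul_of_dvd_left h _) k (Nat.lt_succ_self k)

theorem coeff_prod_eq_zero {σ R ι : Type} [CommRing R] (u : Finset ι) {f : ι → MvPowerSeries σ R}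
    (hf : ∀ i ∈ u, MvPowerSeries.constantCoeff (f i) = 0) {s : σ →₀ ℕ} (hs : s.degree < u.card) :
    MvPowerSeries.coeff s (∏ i ∈ u, f i) = 0 := by
  classical
  induction u using Finset.induction_on generalizing s with
  | empty => simp at hs
  | insert a u ha ih =>
    rw [prod_insert ha, MvPowerSeries.coeff_mul]
    refine sum_eq_zero fun p hp => ?_
    by_cases h1 : p.1 = 0
    · rw [h1, MvPowerSeries.coeff_zero_eq_constantCoeff_apply, hf a (mem_insert_self a u), zero_mul]
    · have h2 : p.1.degree ≠ 0 := by simpa [Finsupp.degree_eq_zero_iff] using h1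
      have h3 : p.1.degree + p.2.degree = s.degree := by
        rw [← map_add, HasAntidiagonal.mem_antidiagonal.1 hp]
      rw [card_insert_of_notMem ha] at hs
      rw [ih (fun i hi => hf i (mem_insert_of_mem hi)) (by omega), mul_zero]

/-- The factors of black vertices: no leaves, and an estimate of the order in `ħ`. -/
structure BlackBound {d : ℕ} (β : (Fin d →₀ ℕ) → PowerSeries ℂ) : Prop where
  eq_zero : ∀ a, a.degree < 2 → β a = 0
  dvd : ∀ a, PowerSeries.X ^ (a.degree - 1) ∣ β a

theorem BlackBound.dvd_prod {d : ℕ} {β : (Fin d →₀ ℕ) → PowerSeries ℂ} (hβ : BlackBound β)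
    {X : Type} [Fintype X] (a : X → Fin d →₀ ℕ) :
    PowerSeries.X ^ (∑ x, ((a x).degree - 1)) ∣ ∏ x, β (a x) := by
  rw [← prod_pow_eq_pow_sum]
  exact prod_dvd_prod_of_dvd _ _ fun x _ => hβ.dvd (a x)

/-- A nonzero contribution has all black degrees at least two, and its order in `ħ` is at least `∑
(degree - 1)`. Each summand is at least 1, so order `k` bounds both the number of black vertices and
their degrees. -/
theorem BlackBound.bound {d : ℕ} {β : (Fin d →₀ ℕ) → PowerSeries ℂ} (hβ : BlackBound β)
    {X : Type} [Fintype X] {a : X → Fin d →₀ ℕ} {s : τ →₀ ℕ} {k : ℕ}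
    {g : MvPowerSeries τ (PowerSeries ℂ)}
    (h : PowerSeries.coeff k (MvPowerSeries.coeff s
      ((∏ x, MvPowerSeries.C (β (a x))) * g)) ≠ 0) :
    Fintype.card X ≤ k ∧ ∀ x, (a x).degree ≤ k + 1 := by
  rw [← map_prod] at h
  have h2 : ∀ x, 2 ≤ (a x).degree := by
    intro x
    by_contra h2
    refine h ?_
    rw [prod_eq_zero (mem_univ x) (hβ.eq_zero (a x) (by omega)), map_zero, zero_mul, map_zero,
      map_zero]
  have h3 : ∑ x, ((a x).degree - 1) ≤ k := by
    by_contra h3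
    exact h (coeff_coeff_C_mul_eq_zero
      ((pow_dvd_pow _ (by omega)).trans (hβ.dvd_prod a)) s g)
  constructor
  · refine le_trans ?_ h3
    rw [Fintype.card_eq_sum_ones]
    exact sum_le_sum fun x _ => by have := h2 x; omega
  · intro x
    have := (single_le_sum (f := fun x => (a x).degree - 1) (fun _ _ => Nat.zero_le _)
      (mem_univ x)).trans h3
    omega

theorem finite_tables {d : ℕ} (X Y : Type) [Fintype X] [Fintype Y] (k : ℕ) :
    {N : X → Y → Fin d →₀ ℕ | ∀ x y, (N x y).degree ≤ k}.Finite := by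
  have h := Set.Finite.pi (ι := X) (t := fun _ => Set.pi (Set.univ : Set Y) fun _ =>
    {a : Fin d →₀ ℕ | a.degree ≤ k})
    fun _ => Set.Finite.pi fun _ => Finsupp.finite_of_degree_le k
  refine h.subset fun N hN => ?_
  simpa [Set.mem_pi] using hN

theorem degree_le_degree_sum {d : ℕ} {Y : Type} [Fintype Y] (a : Y → Fin d →₀ ℕ) (y : Y) :
    (a y).degree ≤ (∑ y, a y).degree := by
  rw [map_sum]
  exact single_le_sum (f := fun y => (a y).degree) (fun _ _ => Nat.zero_le _) (mem_univ y)

end Bounds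

/-! ### Sums over graphs and over connected graphs with fixed vertex sets -/

section ExponentialFormula

variable {τ : Type} {d : ℕ}

/-- The factor `1 / N!` of the edges between two vertices. -/
noncomputable def edgeFactor (τ : Type) (a : Fin d →₀ ℕ) : MvPowerSeries τ (PowerSeries ℂ) :=
  (multiFactorial a)⁻¹ • 1

theorem edgeFactor_zero : edgeFactor τ (0 : Fin d →₀ ℕ) = 1 := by
  rw [edgeFactor, multiFactorial_zero, inv_one, one_smul]

/-- The contribution of a matrix whose black vertices have the factors `β`. -/
noncomputable def graphWeight {X Y : Type} [Fintype X] [Fintype Y]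
    (β : (Fin d →₀ ℕ) → PowerSeries ℂ)
    (wh : Y → (Fin d →₀ ℕ) → MvPowerSeries τ (PowerSeries ℂ)) (N : X → Y → Fin d →₀ ℕ) :
    MvPowerSeries τ (PowerSeries ℂ) :=
  tableWeight (fun a => MvPowerSeries.C (β a)) (edgeFactor τ) wh N

variable {β : (Fin d →₀ ℕ) → PowerSeries ℂ}
  {X Y X' Y' X₁ X₂ Y₁ Y₂ : Type} [Fintype X] [Fintype Y] [Fintype X'] [Fintype Y']
  [Fintype X₁] [Fintype X₂] [Fintype Y₁] [Fintype Y₂]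

theorem graphWeight_bound (hβ : BlackBound β)
    (wh : Y → (Fin d →₀ ℕ) → MvPowerSeries τ (PowerSeries ℂ)) (N : X → Y → Fin d →₀ ℕ)
    {s : τ →₀ ℕ} {k : ℕ}
    (h : PowerSeries.coeff k (MvPowerSeries.coeff s (graphWeight β wh N)) ≠ 0) :
    Fintype.card X ≤ k ∧ ∀ x y, (N x y).degree ≤ k + 1 := by
  rw [graphWeight, tableWeight, mul_assoc] at h
  have := hβ.bound h
  exact ⟨this.1, fun x y => (degree_le_degree_sum (N x) y).trans (this.2 x)⟩

/-- Each white vertex contributes at least one parameter, so the degree in the parameters bounds the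
number of white vertices. -/
theorem graphWeight_white_bound
    {wh : Y → (Fin d →₀ ℕ) → MvPowerSeries τ (PowerSeries ℂ)}
    (hwh : ∀ y a, MvPowerSeries.constantCoeff (wh y a) = 0) (N : X → Y → Fin d →₀ ℕ)
    {s : τ →₀ ℕ} (h : MvPowerSeries.coeff s (graphWeight β wh N) ≠ 0) :
    Fintype.card Y ≤ s.degree := by
  classical
  by_contra hlt
  apply h
  rw [graphWeight, tableWeight, mul_assoc, ← map_prod, MvPowerSeries.coeff_C_mul,
    MvPowerSeries.coeff_mul]
  rw [sum_eq_zero, mul_zero]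
  intro p hp
  have hd : p.1.degree + p.2.degree = s.degree := by
    rw [← map_add, HasAntidiagonal.mem_antidiagonal.1 hp]
  rw [coeff_prod_eq_zero univ (fun y _ => hwh y _) (by rw [card_univ]; omega), zero_mul]

theorem summable_graphWeight (hβ : BlackBound β)
    (wh : Y → (Fin d →₀ ℕ) → MvPowerSeries τ (PowerSeries ℂ)) :
    Summable fun N : X → Y → Fin d →₀ ℕ => graphWeight β wh N := by
  rw [summable_series_iff]
  exact fun s k => (finite_tables X Y (k + 1)).subset fun N hN => (graphWeight_bound hβ wh N hN).2

/-- The sum over all graphs with given vertices. -/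
noncomputable def graphSum (X : Type) {Y : Type} [Fintype X] [Fintype Y]
    (β : (Fin d →₀ ℕ) → PowerSeries ℂ)
    (wh : Y → (Fin d →₀ ℕ) → MvPowerSeries τ (PowerSeries ℂ)) : MvPowerSeries τ (PowerSeries ℂ) :=
  ∑' N : X → Y → Fin d →₀ ℕ, graphWeight β wh N

open Classical in
/-- The sum over the connected graphs with given vertices. -/
noncomputable def connSum (X : Type) {Y : Type} [Fintype X] [Fintype Y]
    (β : (Fin d →₀ ℕ) → PowerSeries ℂ)
    (wh : Y → (Fin d →₀ ℕ) → MvPowerSeries τ (PowerSeries ℂ)) : MvPowerSeries τ (PowerSeries ℂ) :=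
  ∑' N : X → Y → Fin d →₀ ℕ, if IsConn N then graphWeight β wh N else 0

theorem hasSum_graphSum (hβ : BlackBound β)
    (wh : Y → (Fin d →₀ ℕ) → MvPowerSeries τ (PowerSeries ℂ)) :
    HasSum (fun N : X → Y → Fin d →₀ ℕ => graphWeight β wh N) (graphSum X β wh) :=
  (summable_graphWeight hβ wh).hasSum

open Classical in
theorem hasSum_connSum (hβ : BlackBound β)
    (wh : Y → (Fin d →₀ ℕ) → MvPowerSeries τ (PowerSeries ℂ)) :
    HasSum (fun N : X → Y → Fin d →₀ ℕ => if IsConn N then graphWeight β wh N else 0)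
      (connSum X β wh) :=
  (summable_ite (summable_graphWeight hβ wh) _).hasSum

/-- Relabelling of the vertices of a matrix. -/
def tableEquiv (M : Type) (eX : X ≃ X') (eY : Y ≃ Y') : (X' → Y' → M) ≃ (X → Y → M) where
  toFun N x y := N (eX x) (eY y)
  invFun N x y := N (eX.symm x) (eY.symm y)
  left_inv N := by simp
  right_inv N := by simp

theorem graphSum_reindex (eX : X ≃ X') (eY : Y ≃ Y')
    (wh : Y' → (Fin d →₀ ℕ) → MvPowerSeries τ (PowerSeries ℂ)) :
    graphSum X β (fun y => wh (eY y)) = graphSum X' β wh := by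
  rw [graphSum, graphSum, ← (tableEquiv _ eX eY).tsum_eq]
  exact tsum_congr fun N => tableWeight_reindex eX eY _ _ wh N

theorem connSum_reindex (eX : X ≃ X') (eY : Y ≃ Y')
    (wh : Y' → (Fin d →₀ ℕ) → MvPowerSeries τ (PowerSeries ℂ)) :
    connSum X β (fun y => wh (eY y)) = connSum X' β wh := by
  rw [connSum, connSum, ← (tableEquiv _ eX eY).tsum_eq]
  refine tsum_congr fun N => ?_
  have h1 : graphWeight β (fun y => wh (eY y)) (tableEquiv _ eX eY N) = graphWeight β wh N :=
    tableWeight_reindex eX eY _ _ wh N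
  have h2 : IsConn (tableEquiv _ eX eY N) ↔ IsConn N := isConn_reindex eX eY N
  by_cases hN : IsConn N
  · rw [if_pos (h2.2 hN), if_pos hN, h1]
  · rw [if_neg (mt h2.1 hN), if_neg hN]

open Classical in
/-- The graphs in which the component of a white vertex is a given one. -/
theorem hasSum_component_blocks (hβ : BlackBound β)
    (wh : Y₁ ⊕ Y₂ → (Fin d →₀ ℕ) → MvPowerSeries τ (PowerSeries ℂ)) (y₁ : Y₁) :
    HasSum (fun N : X₁ ⊕ X₂ → Y₁ ⊕ Y₂ → Fin d →₀ ℕ =>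
      if component N (Sum.inl y₁) = firstBlock then graphWeight β wh N else 0)
      (connSum X₁ β (fun y => wh (Sum.inl y)) * graphSum X₂ β fun y => wh (Sum.inr y)) := by
  have h := hasSum_series_mul (hasSum_connSum (X := X₁) hβ fun y => wh (Sum.inl y))
    (hasSum_graphSum (X := X₂) hβ fun y => wh (Sum.inr y))
  let g : (X₁ → Y₁ → Fin d →₀ ℕ) × (X₂ → Y₂ → Fin d →₀ ℕ) → X₁ ⊕ X₂ → Y₁ ⊕ Y₂ → Fin d →₀ ℕ :=
    fun p => blocks p.1 p.2
  have hg : Function.Injective g := by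
    rintro ⟨N₁, N₂⟩ ⟨N₁', N₂'⟩ e
    refine Prod.ext ?_ ?_
    · ext1 x
      ext1 y
      exact congrFun (congrFun e (Sum.inl x)) (Sum.inl y)
    · ext1 x
      ext1 y
      exact congrFun (congrFun e (Sum.inr x)) (Sum.inr y)
  rw [← hg.hasSum_iff]
  · convert h using 1
    ext1 p
    simp only [Function.comp_apply, g, component_blocks]
    rw [graphWeight, tableWeight_blocks _ _ edgeFactor_zero, ite_mul, zero_mul]
    rfl
  · intro N hN
    -- A component is closed, so if it equals the first block, the table has no entries between the
    -- blocks and is a disjoint union.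
    refine if_neg fun hc => hN ⟨(fun x y => N (Sum.inl x) (Sum.inl y),
      fun x y => N (Sum.inr x) (Sum.inr y)), (eq_blocks ?_).symm⟩
    rw [← hc]
    exact isClosedIn_component N _

open Classical in
theorem hasSum_component (hβ : BlackBound β) (eX : X ≃ X₁ ⊕ X₂) (eY : Y ≃ Y₁ ⊕ Y₂)
    (wh : Y → (Fin d →₀ ℕ) → MvPowerSeries τ (PowerSeries ℂ)) {y₀ : Y} {y₁ : Y₁}
    (hy : eY y₀ = Sum.inl y₁) :
    HasSum (fun N : X → Y → Fin d →₀ ℕ =>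
      if component N y₀ = Sum.map eX eY ⁻¹' firstBlock then graphWeight β wh N else 0)
      (connSum X₁ β (fun y => wh (eY.symm (Sum.inl y))) *
        graphSum X₂ β fun y => wh (eY.symm (Sum.inr y))) := by
  have h := hasSum_component_blocks (X₁ := X₁) (X₂ := X₂) hβ (fun y => wh (eY.symm y)) y₁
  rw [← (tableEquiv _ eX eY).hasSum_iff]
  convert h using 1
  ext1 N
  have h1 : component (tableEquiv _ eX eY N) y₀ = Sum.map eX eY ⁻¹' component N (Sum.inl y₁) := by
    rw [← hy]
    exact component_reindex eX eY N y₀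
  have h2 : graphWeight β wh (tableEquiv _ eX eY N) = graphWeight β (fun y => wh (eY.symm y)) N := by
    have := tableWeight_reindex eX eY (fun a => MvPowerSeries.C (β a)) (edgeFactor τ)
      (fun y => wh (eY.symm y)) N
    simp only [Equiv.symm_apply_apply] at this
    exact this
  have h3 : Function.Surjective (Sum.map eX eY) := by
    rintro (z | z)
    · exact ⟨Sum.inl (eX.symm z), by simp⟩
    · exact ⟨Sum.inr (eY.symm z), by simp⟩
  simp only [Function.comp_apply, h1, h2, h3.preimage_injective.eq_iff]

end ExponentialFormula

/-! ### Splitting off the component of a marked white vertex -/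

section Recursion

theorem isLeft_finSumEquivOfFinset_symm {α : Type} [LinearOrder α] [Fintype α] {s : Finset α} {m n : ℕ}
    (hm : s.card = m) (hn : sᶜ.card = n) (x : α) :
    ((finSumEquivOfFinset hm hn).symm x).isLeft = true ↔ x ∈ s := by
  obtain ⟨z, rfl⟩ := (finSumEquivOfFinset hm hn).surjective x
  rw [Equiv.symm_apply_apply]
  rcases z with i | i
  · simp
  · refine iff_of_false (by simp) ?_
    rw [finSumEquivOfFinset_inr]
    exact mem_compl.1 (sᶜ.orderEmbOfFin_mem hn i)

/-- An option of a sum is a sum with an option. -/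
def optionSum (α β : Type) : Option (α ⊕ β) ≃ Option α ⊕ β where
  toFun
    | none => Sum.inl none
    | some (Sum.inl a) => Sum.inl (some a)
    | some (Sum.inr b) => Sum.inr b
  invFun
    | Sum.inl none => none
    | Sum.inl (some a) => some (Sum.inl a)
    | Sum.inr b => some (Sum.inr b)
  left_inv := by rintro (_ | _ | _) <;> rfl
  right_inv := by rintro ((_ | _) | _) <;> rfl

variable {τ : Type} {d : ℕ} {β : (Fin d →₀ ℕ) → PowerSeries ℂ}
  {wh whm : (Fin d →₀ ℕ) → MvPowerSeries τ (PowerSeries ℂ)}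

/-- The factors of the white vertices, one of which is marked. -/
def marked {Y M A : Type} (whm wh : M → A) (y : Option Y) : M → A :=
  y.elim whm fun _ => wh

/-- The component of the marked vertex splits off. -/
theorem graphSum_marked (hβ : BlackBound β) (B W : ℕ) :
    graphSum (Fin B) β (marked (Y := Fin W) whm wh) =
      ∑ b ∈ range (B + 1), ∑ w ∈ range (W + 1), ((B.choose b * W.choose w : ℕ) : ℂ) •
        (connSum (Fin b) β (marked (Y := Fin w) whm wh) *
          graphSum (Fin (B - b)) β fun _ : Fin (W - w) => wh) := by
  classical
  let F : ℕ → ℕ → MvPowerSeries τ (PowerSeries ℂ) := fun b w =>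
    connSum (Fin b) β (marked (Y := Fin w) whm wh) *
          graphSum (Fin (B - b)) β fun _ : Fin (W - w) => wh
  have hc : ∀ {n : ℕ} (S : Finset (Fin n)), Sᶜ.card = n - S.card := fun S => by
    rw [card_compl, Fintype.card_fin]
  -- `S` and `T` are the sets of black and of unmarked white vertices in the component of the marked
  -- vertex `none`. These bijections identify them, and their complements, with standard finite
  -- sets.
  let eX : ∀ S : Finset (Fin B), Fin B ≃ Fin S.card ⊕ Fin (B - S.card) := fun S =>
    (finSumEquivOfFinset rfl (hc S)).symm
  let eY : ∀ T : Finset (Fin W), Option (Fin W) ≃ Option (Fin T.card) ⊕ Fin (W - T.card) :=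
    fun T => (Equiv.optionCongr (finSumEquivOfFinset rfl (hc T)).symm).trans (optionSum _ _)
  have key : ∀ S T, HasSum (fun N : Fin B → Option (Fin W) → Fin d →₀ ℕ =>
      if component N none = Sum.map (eX S) (eY T) ⁻¹' firstBlock then
        graphWeight β (marked whm wh) N else 0) (F S.card T.card) := by
    intro S T
    have h := hasSum_component hβ (eX S) (eY T) (marked whm wh) (y₀ := none) (y₁ := none) rfl
    have h1 : (fun y => marked whm wh ((eY T).symm (Sum.inl y))) =
        marked (Y := Fin T.card) whm wh := by
      ext1 y
      cases y <;> rfl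
    rw [h1] at h
    exact h
  have h1 : HasSum (fun N : Fin B → Option (Fin W) → Fin d →₀ ℕ => graphWeight β (marked whm wh) N)
      (∑ S : Finset (Fin B), ∑ T : Finset (Fin W), F S.card T.card) := by
    have h := hasSum_sum (s := univ) fun S _ => hasSum_sum (s := univ) fun T _ => key S T
    convert h using 1
    ext1 N
    -- For each table exactly one pair `(S, T)` satisfies the condition, namely the one read off
    -- from the component of `none`. Hence the sum of the indicators over all pairs is 1.
    have hmem : ∀ S T, component N none = Sum.map (eX S) (eY T) ⁻¹' firstBlock ↔
        univ.filter (fun x => Sum.inl x ∈ component N none) = S ∧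
          univ.filter (fun y => Sum.inr (some y) ∈ component N none) = T := by
      intro S T
      have hx : ∀ x, Sum.inl x ∈ Sum.map (eX S) (eY T) ⁻¹' firstBlock ↔ x ∈ S := fun x =>
        isLeft_finSumEquivOfFinset_symm _ _ x
      have hy : ∀ y, Sum.inr (some y) ∈ Sum.map (eX S) (eY T) ⁻¹' firstBlock ↔ y ∈ T := by
        intro y
        rw [← isLeft_finSumEquivOfFinset_symm rfl (hc T) y]
        change (optionSum _ _ (some ((finSumEquivOfFinset rfl (hc T)).symm y))).isLeft = true ↔ _
        cases (finSumEquivOfFinset rfl (hc T)).symm y <;> rfl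
      constructor
      · intro h
        rw [h]
        exact ⟨by ext x; simp only [mem_filter, mem_univ, true_and, hx],
          by ext x; simp only [mem_filter, mem_univ, true_and, hy]⟩
      · rintro ⟨h1, h2⟩
        ext z
        rcases z with x | _ | y
        · rw [hx, ← h1, mem_filter]
          simp
        · exact iff_of_true (mem_component_self N none) rfl
        · rw [hy, ← h2, mem_filter]
          simp
    simp only [hmem, ite_and]
    rw [sum_eq_single (univ.filter fun x => Sum.inl x ∈ component N none)]
    · simp
    · intro S _ hS
      simp [hS.symm]
    · simp
  rw [graphSum, h1.tsum_eq]
  -- The summand depends on `S` and `T` only through their cardinalities, so grouping by cardinality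
  -- produces the binomial coefficients.
  have h2 := sum_powerset_apply_card (fun b => ∑ T : Finset (Fin W), F b T.card)
    (x := (univ : Finset (Fin B)))
  rw [powerset_univ, card_univ, Fintype.card_fin] at h2
  rw [h2]
  refine sum_congr rfl fun b _ => ?_
  have h3 := sum_powerset_apply_card (fun w => F b w) (x := (univ : Finset (Fin W)))
  rw [powerset_univ, card_univ, Fintype.card_fin] at h3
  rw [h3, smul_sum]
  refine sum_congr rfl fun w _ => ?_
  rw [smul_smul, ← Nat.cast_smul_eq_nsmul ℂ]

/-- The factor of the white vertex `y` is replaced by that of a marked vertex. -/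
def markedAt {Y M A : Type} [DecidableEq Y] (whm wh : M → A) (y : Y) (y' : Y) : M → A :=
  if y' = y then whm else wh

/-- Black vertices and edges have factors without parameters, so the Leibniz rule differentiates one
white vertex at a time. -/
theorem euler_graphWeight {X Y : Type} [Fintype X] [Fintype Y] [DecidableEq Y]
    (N : X → Y → Fin d →₀ ℕ) :
    euler (graphWeight β (fun _ => wh) N) =
      ∑ y, graphWeight β (markedAt (fun a => euler (wh a)) wh y) N := by
  have h1 : (∏ x, ∏ y, edgeFactor τ (N x y)) =
      MvPowerSeries.C (algebraMap ℂ (PowerSeries ℂ) (∏ x, ∏ y, (multiFactorial (N x y))⁻¹)) := by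
    simp only [edgeFactor, Algebra.smul_def, mul_one, ← map_prod]
    exact MvPowerSeries.algebraMap_apply
  simp only [graphWeight, tableWeight, h1, ← map_prod]
  rw [euler_mul, euler_C, mul_zero, add_zero, euler_C_mul, euler_prod, mul_sum, sum_mul]
  refine sum_congr rfl fun y _ => ?_
  congr 2
  refine prod_congr rfl fun y' _ => ?_
  rw [markedAt]
  split_ifs <;> rfl

theorem markedAt_finSuccEquiv' {M A : Type} (whm wh : M → A) {W : ℕ} (y : Fin (W + 1)) :
    markedAt whm wh y = fun y' => marked whm wh (finSuccEquiv' y y') := by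
  ext1 y'
  rw [markedAt]
  split_ifs with h
  · subst h
    rw [finSuccEquiv'_at]
    rfl
  · obtain ⟨z, rfl⟩ := Fin.exists_succAbove_eq h
    rw [finSuccEquiv'_succAbove]
    rfl

theorem euler_graphSum_zero (hβ : BlackBound β) (B : ℕ) :
    euler (graphSum (Fin B) β fun _ : Fin 0 => wh) = 0 := by
  have h := hasSum_euler (hasSum_graphSum (X := Fin B) hβ fun _ : Fin 0 => wh)
  refine h.unique ?_
  simp only [euler_graphWeight, univ_eq_empty, sum_empty]
  exact hasSum_zero

theorem euler_connSum_zero (hβ : BlackBound β) (B : ℕ) :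
    euler (connSum (Fin B) β fun _ : Fin 0 => wh) = 0 := by
  classical
  have h := hasSum_euler (hasSum_connSum (X := Fin B) hβ fun _ : Fin 0 => wh)
  refine h.unique ?_
  simp only [apply_ite euler, euler_graphWeight, univ_eq_empty, sum_empty, map_zero, ite_self]
  exact hasSum_zero

/-- By symmetry, each of the `W + 1` choices of the differentiated white vertex gives the same sum.
-/
theorem euler_graphSum_succ (hβ : BlackBound β) (B W : ℕ) :
    euler (graphSum (Fin B) β fun _ : Fin (W + 1) => wh) =
      ((W + 1 : ℕ) : ℂ) • graphSum (Fin B) β (marked (Y := Fin W) (fun a => euler (wh a)) wh) := by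
  have h := hasSum_euler (hasSum_graphSum (X := Fin B) hβ fun _ : Fin (W + 1) => wh)
  refine h.unique ?_
  simp only [euler_graphWeight]
  have h1 : ∀ y : Fin (W + 1), graphSum (Fin B) β (markedAt (fun a => euler (wh a)) wh y) =
      graphSum (Fin B) β (marked (Y := Fin W) (fun a => euler (wh a)) wh) := fun y => by
    rw [markedAt_finSuccEquiv']
    exact graphSum_reindex (Equiv.refl _) (finSuccEquiv' y) _
  have h2 := hasSum_sum (s := univ) fun (y : Fin (W + 1)) _ => hasSum_graphSum (X := Fin B) hβ
    (markedAt (fun a => euler (wh a)) wh y)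
  simp only [h1, sum_const, card_univ, Fintype.card_fin] at h2
  rwa [Nat.cast_smul_eq_nsmul ℂ]

theorem euler_connSum_succ (hβ : BlackBound β) (B W : ℕ) :
    euler (connSum (Fin B) β fun _ : Fin (W + 1) => wh) =
      ((W + 1 : ℕ) : ℂ) • connSum (Fin B) β (marked (Y := Fin W) (fun a => euler (wh a)) wh) := by
  classical
  have h := hasSum_euler (hasSum_connSum (X := Fin B) hβ fun _ : Fin (W + 1) => wh)
  refine h.unique ?_
  have h1 : ∀ y : Fin (W + 1), connSum (Fin B) β (markedAt (fun a => euler (wh a)) wh y) =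
      connSum (Fin B) β (marked (Y := Fin W) (fun a => euler (wh a)) wh) := fun y => by
    rw [markedAt_finSuccEquiv']
    exact connSum_reindex (Equiv.refl _) (finSuccEquiv' y) _
  have h2 := hasSum_sum (s := univ) fun (y : Fin (W + 1)) _ => hasSum_connSum (X := Fin B) hβ
    (markedAt (fun a => euler (wh a)) wh y)
  simp only [h1, sum_const, card_univ, Fintype.card_fin] at h2
  rw [Nat.cast_smul_eq_nsmul ℂ]
  convert h2 using 1
  ext1 N
  split_ifs
  · exact euler_graphWeight N
  · simp

end Recursion

/-! ### The sum over all graphs and the sum over connected graphs -/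

section PartitionFunction

variable {τ : Type} {d : ℕ} {β : (Fin d →₀ ℕ) → PowerSeries ℂ}
  {wh : (Fin d →₀ ℕ) → MvPowerSeries τ (PowerSeries ℂ)}

/-- The symmetry factor of labelled graphs. -/
noncomputable def labelFactor (p : ℕ × ℕ) : ℂ := ((p.1.factorial * p.2.factorial : ℕ) : ℂ)⁻¹

/-- The sum over all graphs. -/
noncomputable def partitionFunction (β : (Fin d →₀ ℕ) → PowerSeries ℂ)
    (wh : (Fin d →₀ ℕ) → MvPowerSeries τ (PowerSeries ℂ)) : MvPowerSeries τ (PowerSeries ℂ) :=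
  ∑' p : ℕ × ℕ, labelFactor p • graphSum (Fin p.1) β fun _ : Fin p.2 => wh

/-- The sum over all connected graphs. -/
noncomputable def freeEnergy (β : (Fin d →₀ ℕ) → PowerSeries ℂ)
    (wh : (Fin d →₀ ℕ) → MvPowerSeries τ (PowerSeries ℂ)) : MvPowerSeries τ (PowerSeries ℂ) :=
  ∑' p : ℕ × ℕ, labelFactor p • connSum (Fin p.1) β fun _ : Fin p.2 => wh

/-- Finiteness of the set of labelled tables of bounded size. -/
theorem finite_sigma_tables {T : ℕ × ℕ → Type} (m n : ℕ) {S : ∀ p, Set (T p)}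
    (h : ∀ p, (S p).Finite) :
    {x : Σ p : ℕ × ℕ, T p | x.1.1 ≤ m ∧ x.1.2 ≤ n ∧ x.2 ∈ S x.1}.Finite := by
  have : {x : Σ p : ℕ × ℕ, T p | x.1.1 ≤ m ∧ x.1.2 ≤ n ∧ x.2 ∈ S x.1} ⊆
      ⋃ p ∈ (range (m + 1) ×ˢ range (n + 1) : Finset (ℕ × ℕ)), Sigma.mk p '' S p := by
    rintro ⟨p, N⟩ ⟨h1, h2, h3⟩
    simp only [Set.mem_iUnion]
    refine ⟨p, ?_, N, h3, rfl⟩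
    rw [mem_product, mem_range, mem_range]
    exact ⟨Nat.lt_succ_of_le h1, Nat.lt_succ_of_le h2⟩
  exact (Set.Finite.biUnion (finite_toSet _) fun p _ => (h p).image _).subset this

theorem summable_labelled (hβ : BlackBound β)
    (hwh : ∀ a, MvPowerSeries.constantCoeff (wh a) = 0) :
    Summable fun x : Σ p : ℕ × ℕ, (Fin p.1 → Fin p.2 → Fin d →₀ ℕ) =>
      labelFactor x.1 • graphWeight β (fun _ => wh) x.2 := by
  rw [summable_series_iff]
  intro s k
  refine (finite_sigma_tables k s.degree fun p => finite_tables (Fin p.1) (Fin p.2) (k + 1)).subset ?_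
  rintro ⟨p, N⟩ hN
  have h1 : PowerSeries.coeff k (MvPowerSeries.coeff s (graphWeight β (fun _ => wh) N)) ≠ 0 := by
    intro h0
    apply hN
    dsimp only
    rw [coeff_complex_smul, map_smul, h0, smul_zero]
  have h2 := graphWeight_bound hβ _ N h1
  have h3 := graphWeight_white_bound (fun _ => hwh) N (s := s) fun h0 => h1 (by rw [h0, map_zero])
  rw [Fintype.card_fin] at h2 h3
  exact ⟨h2.1, h3, h2.2⟩

theorem hasSum_partitionFunction (hβ : BlackBound β)
    (hwh : ∀ a, MvPowerSeries.constantCoeff (wh a) = 0) :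
    HasSum (fun p : ℕ × ℕ => labelFactor p • graphSum (Fin p.1) β fun _ : Fin p.2 => wh)
      (partitionFunction β wh) := by
  have h := (summable_labelled hβ hwh).hasSum.sigma fun p =>
    hasSum_series_smul (hasSum_graphSum (X := Fin p.1) hβ fun _ : Fin p.2 => wh) (labelFactor p)
  exact h.summable.hasSum

open Classical in
theorem hasSum_freeEnergy_labelled (hβ : BlackBound β)
    (hwh : ∀ a, MvPowerSeries.constantCoeff (wh a) = 0) :
    HasSum (fun x : Σ p : ℕ × ℕ, (Fin p.1 → Fin p.2 → Fin d →₀ ℕ) =>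
      if IsConn x.2 then labelFactor x.1 • graphWeight β (fun _ => wh) x.2 else 0)
      (freeEnergy β wh) := by
  have h0 := (summable_ite (summable_labelled hβ hwh) fun x => IsConn x.2).hasSum
  have h := h0.sigma (g := fun p : ℕ × ℕ => labelFactor p • connSum (Fin p.1) β
      fun _ : Fin p.2 => wh) fun p => by
    have := hasSum_series_smul (hasSum_connSum (X := Fin p.1) hβ fun _ : Fin p.2 => wh)
      (labelFactor p)
    simpa only [smul_ite, smul_zero] using this
  rwa [freeEnergy, h.tsum_eq]

theorem hasSum_freeEnergy (hβ : BlackBound β)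
    (hwh : ∀ a, MvPowerSeries.constantCoeff (wh a) = 0) :
    HasSum (fun p : ℕ × ℕ => labelFactor p • connSum (Fin p.1) β fun _ : Fin p.2 => wh)
      (freeEnergy β wh) := by
  classical
  have h := (hasSum_freeEnergy_labelled hβ hwh).sigma
    (g := fun p : ℕ × ℕ => labelFactor p • connSum (Fin p.1) β
      fun _ : Fin p.2 => wh) fun p => by
    have := hasSum_series_smul (hasSum_connSum (X := Fin p.1) hβ fun _ : Fin p.2 => wh)
      (labelFactor p)
    simpa only [smul_ite, smul_zero] using this
  exact h

/-- Differentiation removes the terms without white vertices and turns one of the `W + 1` white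
vertices into the marked one; this is the corresponding shift of the index. -/
theorem hasSum_succ_of_zero {f g : ℕ × ℕ → MvPowerSeries τ (PowerSeries ℂ)}
    {v : MvPowerSeries τ (PowerSeries ℂ)} (h : HasSum f v) (h0 : ∀ B, f (B, 0) = 0)
    (h1 : ∀ B W, f (B, W + 1) = g (B, W)) : HasSum g v := by
  have hi : Function.Injective fun p : ℕ × ℕ => (p.1, p.2 + 1) := by
    rintro ⟨a, b⟩ ⟨a', b'⟩ e
    simpa using e
  rw [← hi.hasSum_iff] at h
  · simpa [Function.comp_def, h1] using h
  · rintro ⟨B, W⟩ hp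
    cases W with
    | zero => exact h0 B
    | succ W => exact absurd ⟨(B, W), rfl⟩ hp

theorem labelFactor_succ (B W : ℕ) :
    labelFactor (B, W + 1) * ((W + 1 : ℕ) : ℂ) = labelFactor (B, W) := by
  have h : ((W + 1 : ℕ) : ℂ) ≠ 0 := Nat.cast_ne_zero.2 W.succ_ne_zero
  have h1 : (W.factorial : ℂ) ≠ 0 := Nat.cast_ne_zero.2 W.factorial_ne_zero
  have h2 : (B.factorial : ℂ) ≠ 0 := Nat.cast_ne_zero.2 B.factorial_ne_zero
  simp only [labelFactor, Nat.factorial_succ]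
  push_cast at h ⊢
  field_simp

/-- With the factor `1/(B! W!)` the number of ways to choose the vertices of a component is
absorbed, and the binomial convolution of `graphSum_marked` becomes the product of two series. -/
theorem labelFactor_mul_choose {B W b w : ℕ} (hb : b ≤ B) (hw : w ≤ W) :
    labelFactor (B, W) * ((B.choose b * W.choose w : ℕ) : ℂ) =
      labelFactor (b, w) * labelFactor (B - b, W - w) := by
  have h1 := Nat.choose_mul_factorial_mul_factorial hb
  have h2 := Nat.choose_mul_factorial_mul_factorial hw
  have h0 : ∀ n : ℕ, (n.factorial : ℂ) ≠ 0 := fun n => Nat.cast_ne_zero.2 n.factorial_ne_zero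
  simp only [labelFactor, ← h1, ← h2]
  have h3 : ((B.choose b : ℕ) : ℂ) ≠ 0 := Nat.cast_ne_zero.2 (Nat.choose_pos hb).ne'
  have h4 : ((W.choose w : ℕ) : ℂ) ≠ 0 := Nat.cast_ne_zero.2 (Nat.choose_pos hw).ne'
  have := h0 b
  have := h0 w
  have := h0 (B - b)
  have := h0 (W - w)
  push_cast
  field_simp

/-- The exponential formula in differential form. -/
theorem euler_partitionFunction (hβ : BlackBound β)
    (hwh : ∀ a, MvPowerSeries.constantCoeff (wh a) = 0) :
    euler (partitionFunction β wh) = partitionFunction β wh * euler (freeEnergy β wh) := by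
  have hZ := hasSum_partitionFunction hβ hwh
  let km : ℕ × ℕ → MvPowerSeries τ (PowerSeries ℂ) := fun p => labelFactor p •
    connSum (Fin p.1) β (marked (Y := Fin p.2) (fun a => euler (wh a)) wh)
  let z : ℕ × ℕ → MvPowerSeries τ (PowerSeries ℂ) := fun p => labelFactor p •
    graphSum (Fin p.1) β fun _ : Fin p.2 => wh
  have hDZ : HasSum (fun p : ℕ × ℕ => labelFactor p •
      graphSum (Fin p.1) β (marked (Y := Fin p.2) (fun a => euler (wh a)) wh))
      (euler (partitionFunction β wh)) := by
    refine hasSum_succ_of_zero (hasSum_euler hZ) (fun B => ?_) fun B W => ?_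
    · rw [euler_smul, euler_graphSum_zero hβ, smul_zero]
    · rw [euler_smul, euler_graphSum_succ hβ, smul_smul, labelFactor_succ]
  have hDK : HasSum km (euler (freeEnergy β wh)) := by
    refine hasSum_succ_of_zero (hasSum_euler (hasSum_freeEnergy hβ hwh)) (fun B => ?_) fun B W => ?_
    · rw [euler_smul, euler_connSum_zero hβ, smul_zero]
    · rw [euler_smul, euler_connSum_succ hβ, smul_smul, labelFactor_succ]
  have hprod := hasSum_series_mul hDK hZ
  rw [mul_comm]
  -- The product is summed by the total numbers of black and unmarked white vertices. By
  -- `graphSum_marked`, the part with total `(B, W)` is the marked sum with these numbers.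
  refine hDZ.unique (hasSum_fiber (fun q : (ℕ × ℕ) × ℕ × ℕ => q.1 + q.2) hprod ?_)
  rintro ⟨B, W⟩
  -- These are all the pairs with total `(B, W)`: the first entry is the size of the component, and
  -- the second, by subtraction, the size of the rest.
  let e : ℕ × ℕ → (ℕ × ℕ) × ℕ × ℕ := fun q => (q, (B - q.1, W - q.2))
  have h1 : ∑ q ∈ (range (B + 1) ×ˢ range (W + 1)).image e,
      (if q.1 + q.2 = (B, W) then km q.1 * z q.2 else 0) =
      labelFactor (B, W) •
        graphSum (Fin B) β (marked (Y := Fin W) (fun a => euler (wh a)) wh) := by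
    rw [sum_image fun q _ q' _ h => (Prod.ext_iff.1 h).1, graphSum_marked hβ, sum_product, smul_sum]
    refine sum_congr rfl fun b hb => ?_
    rw [smul_sum]
    refine sum_congr rfl fun w hw => ?_
    have hb' : b ≤ B := Nat.lt_succ_iff.1 (mem_range.1 hb)
    have hw' : w ≤ W := Nat.lt_succ_iff.1 (mem_range.1 hw)
    rw [if_pos (by simp only [e, Prod.mk_add_mk, Nat.add_sub_cancel' hb', Nat.add_sub_cancel' hw']),
      smul_smul, labelFactor_mul_choose hb' hw', smul_mul_smul_comm]
  rw [← h1]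
  refine hasSum_sum_of_ne_finset_zero fun q hq => if_neg fun h => hq ?_
  rw [mem_image]
  have h2 := Prod.ext_iff.1 h
  simp only [Prod.fst_add, Prod.snd_add] at h2
  refine ⟨q.1, ?_, ?_⟩
  · rw [mem_product, mem_range, mem_range]
    omega
  · refine Prod.ext rfl (Prod.ext ?_ ?_)
    · change B - q.1.1 = q.2.1
      omega
    · change W - q.1.2 = q.2.2
      omega

/-- Only the empty graph has no parameters: a white vertex carries at least one, and without white
vertices a black vertex has degree 0, where `BlackBound` makes its factor vanish. -/
theorem constantCoeff_partitionFunction (hβ : BlackBound β)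
    (hwh : ∀ a, MvPowerSeries.constantCoeff (wh a) = 0) :
    MvPowerSeries.constantCoeff (partitionFunction β wh) = 1 := by
  have h := hasSum_series_iff_coeff.1 ((summable_labelled hβ hwh).hasSum.sigma fun p =>
    hasSum_series_smul (hasSum_graphSum (X := Fin p.1) hβ fun _ : Fin p.2 => wh) (labelFactor p)) 0
  have h' := hasSum_series_iff_coeff.1 (hasSum_partitionFunction hβ hwh) 0
  rw [← MvPowerSeries.coeff_zero_eq_constantCoeff_apply]
  refine h'.unique ?_
  have key : ∀ p : ℕ × ℕ, p ≠ 0 →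
      MvPowerSeries.coeff 0 (labelFactor p • graphSum (Fin p.1) β fun _ : Fin p.2 => wh) = 0 := by
    rintro ⟨B, W⟩ hp
    rw [coeff_complex_smul]
    have h2 := hasSum_series_iff_coeff.1 (hasSum_graphSum (X := Fin B) hβ fun _ : Fin W => wh) 0
    rw [show MvPowerSeries.coeff 0 (graphSum (Fin B) β fun _ : Fin W => wh) = 0 from ?_, smul_zero]
    refine h2.unique ?_
    have : ∀ N, MvPowerSeries.coeff 0 (graphWeight (X := Fin B) β (fun _ : Fin W => wh) N) = 0 := by
      intro N
      by_contra hne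
      have h3 := graphWeight_white_bound (fun _ => hwh) N hne
      rw [Fintype.card_fin, map_zero, Nat.le_zero] at h3
      subst h3
      cases B with
      | zero => exact hp rfl
      | succ B =>
        apply hne
        rw [graphWeight, tableWeight, prod_eq_zero (mem_univ 0), zero_mul, zero_mul, map_zero]
        rw [univ_eq_empty, sum_empty, hβ.eq_zero 0 (by simp), map_zero]
    simp only [this]
    exact hasSum_zero
  have h0 : MvPowerSeries.coeff 0 (labelFactor 0 • graphSum (Fin (0 : ℕ × ℕ).1) β
      fun _ : Fin (0 : ℕ × ℕ).2 => wh) = 1 := by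
    have h3 : graphSum (Fin 0) β (fun _ : Fin 0 => wh) = 1 := by
      rw [graphSum, tsum_eq_single 0 (fun N hN => absurd (Subsingleton.elim _ _) hN)]
      simp [graphWeight, tableWeight]
    change MvPowerSeries.coeff 0 (labelFactor 0 • graphSum (Fin 0) β fun _ : Fin 0 => wh) = 1
    rw [h3, show labelFactor 0 = 1 by simp [labelFactor], one_smul]
    simp
  rw [← h0]
  exact hasSum_single 0 key

end PartitionFunction

/-! ### Black leaves and their resummation at the white vertices -/

section Leaves

variable {τ : Type} {d : ℕ}

theorem dvd_divPow {δ : Fin d → PowerSeries ℂ} (hδ : ∀ i, PowerSeries.X ∣ δ i) (c : Fin d →₀ ℕ) :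
    PowerSeries.X ^ c.degree ∣ divPow δ c := by
  rw [divPow_eq, Finsupp.degree_eq_sum, ← prod_pow_eq_pow_sum]
  exact dvd_smul_of_dvd _ (prod_dvd_prod_of_dvd _ _ fun i _ => pow_dvd_pow_of_dvd (hδ i) _)

/-- The factor of a white vertex to which the black leaves `c` are attached. -/
noncomputable def leafFactor (δ : Fin d → PowerSeries ℂ)
    (wh : (Fin d →₀ ℕ) → MvPowerSeries τ (PowerSeries ℂ)) (c b : Fin d →₀ ℕ) :
    MvPowerSeries τ (PowerSeries ℂ) :=
  MvPowerSeries.C (divPow δ c) * wh (c + b)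

/-- The factor of a white vertex, summed over the black leaves attached to it. -/
noncomputable def leafSum (δ : Fin d → PowerSeries ℂ)
    (wh : (Fin d →₀ ℕ) → MvPowerSeries τ (PowerSeries ℂ)) (b : Fin d →₀ ℕ) :
    MvPowerSeries τ (PowerSeries ℂ) :=
  ∑' c, leafFactor δ wh c b

theorem coeff_coeff_smul (c : ℂ) (f : MvPowerSeries τ (PowerSeries ℂ)) (s : τ →₀ ℕ) (k : ℕ) :
    PowerSeries.coeff k (MvPowerSeries.coeff s (c • f)) =
      c * PowerSeries.coeff k (MvPowerSeries.coeff s f) := rfl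

theorem C_complex_smul (c : ℂ) (a : PowerSeries ℂ) :
    (MvPowerSeries.C (c • a) : MvPowerSeries τ (PowerSeries ℂ)) = c • MvPowerSeries.C a := by
  classical
  ext1 m
  rw [coeff_complex_smul, MvPowerSeries.coeff_C, MvPowerSeries.coeff_C]
  split_ifs <;> simp

theorem summable_comp_injective {ι κ : Type*} {f : ι → MvPowerSeries τ (PowerSeries ℂ)}
    (hf : Summable f) {g : κ → ι} (hg : Function.Injective g) : Summable fun i => f (g i) := by
  rw [summable_series_iff] at *
  exact fun s k => (hf s k).preimage hg.injOn

theorem finite_degree_le (k : ℕ) : {c : Fin d →₀ ℕ | c.degree ≤ k}.Finite := by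
  have := (finite_tables (d := d) Unit Unit k).image fun N => N () ()
  refine this.subset fun c hc => ⟨fun _ _ => c, fun _ _ => hc, rfl⟩

variable {β : (Fin d →₀ ℕ) → PowerSeries ℂ} {δ : Fin d → PowerSeries ℂ}
  {wh : (Fin d →₀ ℕ) → MvPowerSeries τ (PowerSeries ℂ)}

theorem hasSum_leafSum (hδ : ∀ i, PowerSeries.X ∣ δ i)
    (wh : (Fin d →₀ ℕ) → MvPowerSeries τ (PowerSeries ℂ)) (b : Fin d →₀ ℕ) :
    HasSum (fun c => leafFactor δ wh c b) (leafSum δ wh b) := by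
  refine Summable.hasSum ?_
  rw [summable_series_iff]
  refine fun s k => (finite_degree_le k).subset fun c hc => ?_
  by_contra h
  exact hc (coeff_coeff_C_mul_eq_zero
    ((pow_dvd_pow _ (Nat.succ_le_of_lt (not_le.1 h))).trans (dvd_divPow hδ c)) _ _)

theorem constantCoeff_leafFactor (hwh : ∀ a, MvPowerSeries.constantCoeff (wh a) = 0)
    (c b : Fin d →₀ ℕ) : MvPowerSeries.constantCoeff (leafFactor δ wh c b) = 0 := by
  rw [leafFactor, map_mul, hwh, mul_zero]

theorem constantCoeff_leafSum (hδ : ∀ i, PowerSeries.X ∣ δ i)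
    (hwh : ∀ a, MvPowerSeries.constantCoeff (wh a) = 0) (b : Fin d →₀ ℕ) :
    MvPowerSeries.constantCoeff (leafSum δ wh b) = 0 := by
  have h := hasSum_series_iff_coeff.1 (hasSum_leafSum hδ wh b) 0
  have h0 : (fun c => MvPowerSeries.coeff 0 (leafFactor δ wh c b)) = fun _ => 0 :=
    funext fun c => constantCoeff_leafFactor hwh c b
  rw [h0] at h
  exact h.unique hasSum_zero

/-- The contribution of a labelled graph with black leaves. -/
noncomputable def leafWeight (β : (Fin d →₀ ℕ) → PowerSeries ℂ) (δ : Fin d → PowerSeries ℂ)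
    (wh : (Fin d →₀ ℕ) → MvPowerSeries τ (PowerSeries ℂ))
    (x : Σ p : ℕ × ℕ, (Fin p.1 → Fin p.2 → Fin d →₀ ℕ) × (Fin p.2 → Fin d →₀ ℕ)) :
    MvPowerSeries τ (PowerSeries ℂ) :=
  labelFactor x.1 • graphWeight β (fun y b => leafFactor δ wh (x.2.2 y) b) x.2.1

theorem graphWeight_leaf_bound (hδ : ∀ i, PowerSeries.X ∣ δ i) {B W : ℕ}
    (N : Fin B → Fin W → Fin d →₀ ℕ) (ν : Fin W → Fin d →₀ ℕ) {s : τ →₀ ℕ} {k : ℕ}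
    (h : PowerSeries.coeff k (MvPowerSeries.coeff s
      (graphWeight β (fun y b => leafFactor δ wh (ν y) b) N)) ≠ 0) (y : Fin W) :
    (ν y).degree ≤ k := by
  by_contra hk
  apply h
  obtain ⟨g, hg⟩ : ∃ g, graphWeight β (fun y b => leafFactor δ wh (ν y) b) N =
      MvPowerSeries.C (divPow δ (ν y)) * g := by
    refine Dvd.dvd.trans (Dvd.intro _ rfl) (Dvd.dvd.mul_right (Dvd.dvd.mul_left
      (dvd_prod_of_mem (fun y => leafFactor δ wh (ν y) (∑ x, N x y)) (mem_univ y)) _) _)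
  rw [hg]
  exact coeff_coeff_C_mul_eq_zero ((pow_dvd_pow _ (not_le.1 hk)).trans (dvd_divPow hδ _)) _ _

theorem summable_leafWeight (hβ : BlackBound β) (hδ : ∀ i, PowerSeries.X ∣ δ i)
    (hwh : ∀ a, MvPowerSeries.constantCoeff (wh a) = 0) :
    Summable (leafWeight β δ wh) := by
  rw [summable_series_iff]
  intro s k
  refine (finite_sigma_tables k s.degree
    (T := fun p => (Fin p.1 → Fin p.2 → Fin d →₀ ℕ) × (Fin p.2 → Fin d →₀ ℕ))
    (S := fun p => {N | ∀ x y, (N x y).degree ≤ k + 1} ×ˢ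
      ((fun (N : Unit → Fin p.2 → Fin d →₀ ℕ) => N ()) ''
        {N | ∀ x y, (N x y).degree ≤ k}))
    fun p => (finite_tables _ _ _).prod ((finite_tables _ _ _).image _)).subset ?_
  rintro ⟨p, N, ν⟩ hx
  have hx' : PowerSeries.coeff k (MvPowerSeries.coeff s
      (graphWeight β (fun y b => leafFactor δ wh (ν y) b) N)) ≠ 0 := by
    intro h
    apply hx
    dsimp only [leafWeight]
    rw [coeff_coeff_smul, h, mul_zero]
  have h1 := graphWeight_bound hβ _ N hx'
  have h2 := graphWeight_white_bound (fun y a => constantCoeff_leafFactor hwh (ν y) a) N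
    (fun h0 => hx' (by rw [h0, map_zero]))
  rw [Fintype.card_fin] at h1 h2
  exact ⟨h1.1, h2, h1.2, fun _ => ν, fun _ y => graphWeight_leaf_bound hδ N ν hx' y, rfl⟩

/-- Leaves are attached to the white vertices independently, so the sum over all attachments is a
product of one sum for each white vertex. -/
theorem hasSum_graphWeight_leaf (hδ : ∀ i, PowerSeries.X ∣ δ i) {B W : ℕ}
    (N : Fin B → Fin W → Fin d →₀ ℕ) :
    HasSum (fun ν : Fin W → Fin d →₀ ℕ => graphWeight β (fun y b => leafFactor δ wh (ν y) b) N)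
      (graphWeight β (fun _ => leafSum δ wh) N) := by
  have h4 := hasSum_series_prod fun y : Fin W => hasSum_leafSum hδ wh (∑ x, N x y)
  have h5 := (h4.mul_left (∏ x, (MvPowerSeries.C (β (∑ y, N x y)) :
    MvPowerSeries τ (PowerSeries ℂ)))).mul_right (∏ x, ∏ y, edgeFactor τ (N x y))
  simp only [graphWeight, tableWeight]
  exact h5

theorem hasSum_leafWeight (hβ : BlackBound β) (hδ : ∀ i, PowerSeries.X ∣ δ i)
    (hwh : ∀ a, MvPowerSeries.constantCoeff (wh a) = 0) :
    HasSum (leafWeight β δ wh) (partitionFunction β (leafSum δ wh)) := by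
  have hs := summable_leafWeight hβ hδ hwh
  have h1 : ∀ p : ℕ × ℕ, HasSum (fun x => leafWeight β δ wh ⟨p, x⟩)
      (labelFactor p • graphSum (Fin p.1) β fun _ : Fin p.2 => leafSum δ wh) := by
    intro p
    obtain ⟨v, h2⟩ := summable_comp_injective hs (sigma_mk_injective (i := p))
    have h3 : HasSum (fun N : Fin p.1 → Fin p.2 → Fin d →₀ ℕ => labelFactor p •
        graphWeight β (fun _ => leafSum δ wh) N) v := by
      refine HasSum.prod_fiberwise h2 fun N => ?_
      simp only [leafWeight]
      exact hasSum_series_smul (hasSum_graphWeight_leaf hδ N) _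
    rwa [← h3.unique (hasSum_series_smul (hasSum_graphSum hβ _) _)]
  have h5 := hs.hasSum.sigma h1
  rw [← h5.unique (hasSum_partitionFunction hβ (constantCoeff_leafSum hδ hwh))]
  exact hs.hasSum

/-- The sum of all entries of a table with leaves. -/
noncomputable def leafTotal
    (x : Σ p : ℕ × ℕ, (Fin p.1 → Fin p.2 → Fin d →₀ ℕ) × (Fin p.2 → Fin d →₀ ℕ)) : Fin d →₀ ℕ :=
  ∑ y, x.2.2 y + ∑ x', ∑ y, x.2.1 x' y

/-- Tables with an additional row. -/
def optionTable (M X Y : Type) : (X → Y → M) × (Y → M) ≃ (Option X × Y → M) where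
  toFun N z := z.1.elim (N.2 z.2) fun x => N.1 x z.2
  invFun N := (fun x y => N (some x, y), fun y => N (none, y))
  left_inv _ := rfl
  right_inv N := by
    ext ⟨_ | _, _⟩ <;> rfl

theorem optionTable_symm_apply {M X Y : Type} (N : Option X × Y → M) :
    (optionTable M X Y).symm N = (fun x y => N (some x, y), fun y => N (none, y)) := rfl

/-- The leaves form one extra row `none` of the table, whose factor is a divided power of `δ`, a
coefficient of the exponential of a linear form. Multiplied by the factorial of its degree this
factor is multiplicative in the entries of the row, hence splits over the white vertices. The weight
thus takes the form of a summand of `wick`. -/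
theorem leafWeight_eq (p : ℕ × ℕ) (N : Option (Fin p.1) × Fin p.2 → Fin d →₀ ℕ) :
    leafWeight β δ wh ⟨p, (optionTable _ _ _).symm N⟩ = labelFactor p •
      ((∏ z, (multiFactorial (N z))⁻¹) •
        ((∏ x : Option (Fin p.1), multiFactorial (∑ y, N (x, y)) •
            x.elim (MvPowerSeries.C (divPow δ (∑ y, N (x, y)))) fun _ =>
              MvPowerSeries.C ((multiFactorial (∑ y, N (x, y)))⁻¹ • β (∑ y, N (x, y)))) *
          ∏ y, multiFactorial (∑ x, N (x, y)) •
            ((multiFactorial (∑ x, N (x, y)))⁻¹ • wh (∑ x, N (x, y))))) := by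
  rw [leafWeight]
  congr 1
  have h1 : ∀ y, ∑ x, N (x, y) = N (none, y) + ∑ x : Fin p.1, N (some x, y) := fun y =>
    Fintype.sum_option _
  have h2 : multiFactorial (∑ y, N (none, y)) • (MvPowerSeries.C (divPow δ (∑ y, N (none, y))) :
      MvPowerSeries τ (PowerSeries ℂ)) =
      ∏ y, multiFactorial (N (none, y)) • MvPowerSeries.C (divPow δ (N (none, y))) := by
    simp only [divPow_eq, C_complex_smul, smul_inv_smul₀ (multiFactorial_ne_zero _), map_prod, map_pow]
    rw [prod_comm]
    refine prod_congr rfl fun i _ => ?_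
    rw [prod_pow_eq_pow_sum, Finsupp.finsetSum_apply]
  simp only [smul_inv_smul₀ (multiFactorial_ne_zero _), Fintype.prod_option, Option.elim, C_complex_smul, h2,
    Fintype.prod_prod_type]
  rw [graphWeight, tableWeight]
  simp only [optionTable_symm_apply, leafFactor, edgeFactor, h1, prod_mul_distrib,
    prod_smul, prod_const_one, prod_inv_distrib]
  simp only [smul_mul_assoc, mul_smul_comm, smul_smul, mul_one]
  rw [mul_right_comm, inv_mul_cancel₀ (prod_ne_zero_iff.2 fun y _ => multiFactorial_ne_zero _),
    one_mul]
  congr 1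
  ring

end Leaves

/-! ### From the pairing of two exponentials to the sum over graphs with leaves -/

section Regrouping

variable {τ : Type} {d : ℕ} {β : (Fin d →₀ ℕ) → PowerSeries ℂ} {δ : Fin d → PowerSeries ℂ}
  {wh : (Fin d →₀ ℕ) → MvPowerSeries τ (PowerSeries ℂ)}

theorem hasSum_ite_piAntidiag {Z : Type} [Fintype Z] [DecidableEq Z]
    (F : (Z → Fin d →₀ ℕ) → MvPowerSeries τ (PowerSeries ℂ)) (A : Fin d →₀ ℕ) :
    HasSum (fun N => if ∑ z, N z = A then F N else 0) (∑ N ∈ piAntidiag univ A, F N) := by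
  have h : ∑ N ∈ piAntidiag univ A, F N =
      ∑ N ∈ piAntidiag univ A, if ∑ z, N z = A then F N else 0 :=
    sum_congr rfl fun N hN => by rw [if_pos (mem_piAntidiag.1 hN).1]
  rw [h]
  refine hasSum_sum_of_ne_finset_zero fun N hN => if_neg fun hA => hN ?_
  exact mem_piAntidiag.2 ⟨hA, fun i _ => mem_univ i⟩

theorem smul_factorial_mul {R : Type} [CommRing R] [Algebra ℂ R] (p : ℕ × ℕ) (c : ℂ) (x y : R) :
    c • (((p.1.factorial : ℂ)⁻¹ • x) * ((p.2.factorial : ℂ)⁻¹ • y)) =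
      labelFactor p • (c • (x * y)) := by
  rw [smul_mul_smul_comm, smul_comm, labelFactor, Nat.cast_mul, mul_inv]

/-- All linear terms together count as a single factor `exp`, indexed by `none`, next to the `n`
factors of order at least two. Leaves therefore need neither labels nor symmetry factors. -/
theorem coeff_table_rows {f : MvPowerSeries (Fin d) (PowerSeries ℂ)}
    (hf : ∀ a, MvPowerSeries.coeff a f = (multiFactorial a)⁻¹ • β a) (n : ℕ) (A : Fin d →₀ ℕ) :
    (MvPowerSeries.C (MvPowerSeries.coeff A (f ^ n * expS (linearForm δ))) :
      MvPowerSeries τ (PowerSeries ℂ)) =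
        ∑ a ∈ piAntidiag univ A, ∏ x : Option (Fin n),
          x.elim (MvPowerSeries.C (divPow δ (a x))) fun _ =>
            MvPowerSeries.C ((multiFactorial (a x))⁻¹ • β (a x)) := by
  have e1 : f ^ n * expS (linearForm δ) =
      ∏ x : Option (Fin n), x.elim (expS (linearForm δ)) fun _ => f := by
    rw [Fintype.prod_option]
    simp [mul_comm]
  rw [e1, coeff_prod_univ, map_sum]
  refine sum_congr rfl fun a _ => ?_
  rw [map_prod]
  refine prod_congr rfl fun x _ => ?_
  cases x with
  | none => exact congrArg _ (coeff_expS_linearForm δ _)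
  | some x => exact congrArg _ (hf _)

theorem coeff_table_columns {g : MvPowerSeries (Fin d) (MvPowerSeries τ (PowerSeries ℂ))}
    (hg : ∀ b, MvPowerSeries.coeff b g = (multiFactorial b)⁻¹ • wh b) (n : ℕ) (A : Fin d →₀ ℕ) :
    MvPowerSeries.coeff A (g ^ n) =
      ∑ b ∈ piAntidiag univ A, ∏ y : Fin n, (multiFactorial (b y))⁻¹ • wh (b y) := by
  have e : g ^ n = ∏ y : Fin n, g := by simp
  rw [e, coeff_prod_univ]
  exact sum_congr rfl fun b _ => prod_congr rfl fun y _ => hg _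

/-- Both exponentials are expanded into powers. The term with `n` factors of one kind and `n'` of
the other is evaluated by Wick's formula, and `1/(n! n'!)` becomes the label factor. -/
theorem hasSum_leafWeight_total (hβ : BlackBound β) (hδ : ∀ i, PowerSeries.X ∣ δ i)
    (hwh : ∀ a, MvPowerSeries.constantCoeff (wh a) = 0) {A : Fin d →₀ ℕ} {E₁ : PowerSeries ℂ}
    {E₂ : MvPowerSeries τ (PowerSeries ℂ)} {f : MvPowerSeries (Fin d) (PowerSeries ℂ)}
    {g : MvPowerSeries (Fin d) (MvPowerSeries τ (PowerSeries ℂ))}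
    (hf : ∀ a, MvPowerSeries.coeff a f = (multiFactorial a)⁻¹ • β a)
    (hg : ∀ b, MvPowerSeries.coeff b g = (multiFactorial b)⁻¹ • wh b)
    (h1 : HasSum (fun n : ℕ => (n.factorial : ℂ)⁻¹ •
      (MvPowerSeries.C (MvPowerSeries.coeff A (f ^ n * expS (linearForm δ))) :
        MvPowerSeries τ (PowerSeries ℂ))) (MvPowerSeries.C E₁))
    (h2 : HasSum (fun n : ℕ => (n.factorial : ℂ)⁻¹ • MvPowerSeries.coeff A (g ^ n)) E₂) :
    HasSum (fun x => if leafTotal x = A then leafWeight β δ wh x else 0)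
      (multiFactorial A • (MvPowerSeries.C E₁ * E₂)) := by
  classical
  obtain ⟨v, hv⟩ := summable_ite (summable_leafWeight hβ hδ hwh) fun x => leafTotal x = A
  have h3 := hasSum_series_smul (hasSum_series_mul h1 h2) (multiFactorial A)
  have h4 : ∀ p : ℕ × ℕ, HasSum (fun x => if leafTotal ⟨p, x⟩ = A then leafWeight β δ wh ⟨p, x⟩ else 0)
      (multiFactorial A • ((p.1.factorial : ℂ)⁻¹ •
      (MvPowerSeries.C (MvPowerSeries.coeff A (f ^ p.1 * expS (linearForm δ))) :
        MvPowerSeries τ (PowerSeries ℂ)) * (p.2.factorial : ℂ)⁻¹ •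
          MvPowerSeries.coeff A (g ^ p.2))) := by
    intro p
    rw [smul_factorial_mul, coeff_table_rows hf, coeff_table_columns hg]
    rw [wick (fun (x : Option (Fin p.1)) a => x.elim (MvPowerSeries.C (divPow δ a)) fun _ =>
            MvPowerSeries.C ((multiFactorial a)⁻¹ • β a)) (fun (_ : Fin p.2) b => (multiFactorial b)⁻¹ • wh b),
      smul_sum]
    have h5 := hasSum_ite_piAntidiag (fun N => leafWeight β δ wh ⟨p, (optionTable _ _ _).symm N⟩) A
    have h6 : (fun N : Option (Fin p.1) × Fin p.2 → Fin d →₀ ℕ => if ∑ z, N z = A then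
        leafWeight β δ wh ⟨p, (optionTable _ _ _).symm N⟩ else 0) =
        (fun x => if leafTotal ⟨p, x⟩ = A then leafWeight β δ wh ⟨p, x⟩ else 0) ∘
          (optionTable _ _ _).symm := by
      ext1 N
      have h7 : leafTotal ⟨p, (optionTable _ _ _).symm N⟩ = ∑ z, N z := by
        rw [leafTotal, Fintype.sum_prod_type, Fintype.sum_option]
        rfl
      rw [Function.comp_apply, h7]
    rw [h6, Equiv.hasSum_iff] at h5
    simpa only [leafWeight_eq] using h5
  rw [(h3.unique (hv.sigma h4))]
  exact hv

/-- The sum over all graphs, regrouped by the total number of half-edges of each index. -/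
theorem hasSum_partitionFunction_total (hβ : BlackBound β) (hδ : ∀ i, PowerSeries.X ∣ δ i)
    (hwh : ∀ a, MvPowerSeries.constantCoeff (wh a) = 0) {f : MvPowerSeries (Fin d) (PowerSeries ℂ)}
    {g : MvPowerSeries (Fin d ⊕ τ) (PowerSeries ℂ)}
    (hf : ∀ a, MvPowerSeries.coeff a f = (multiFactorial a)⁻¹ • β a)
    (hg : ∀ b, MvPowerSeries.coeff b (curryS g) = (multiFactorial b)⁻¹ • wh b) :
    HasSum (fun A => multiFactorial A •
      (MvPowerSeries.C (MvPowerSeries.coeff A (expS (f + linearForm δ))) *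
        MvPowerSeries.coeff A (curryS (expS g)))) (partitionFunction β (leafSum δ wh)) := by
  classical
  have hf0 : MvPowerSeries.constantCoeff f = 0 := by
    rw [← MvPowerSeries.coeff_zero_eq_constantCoeff_apply, hf, hβ.eq_zero 0 (by simp), smul_zero]
  have hg0 : MvPowerSeries.constantCoeff g = 0 := by
    have h := congrArg (MvPowerSeries.coeff 0) (hg 0)
    rw [coeff_coeff_curryS, coeff_complex_smul, MvPowerSeries.coeff_zero_eq_constantCoeff_apply,
      hwh, smul_zero, Finsupp.sumElim_zero_zero] at h
    exact h
  refine hasSum_fiber leafTotal (hasSum_leafWeight hβ hδ hwh) fun A =>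
    hasSum_leafWeight_total hβ hδ hwh hf hg ?_ ?_
  -- The factor `exp f` may be truncated uniformly over all splittings of `A`, because `f` has no
  -- constant term and `f ^ n` does not reach degree `|A|` for larger `n`.
  · have hA : MvPowerSeries.coeff A (expS (f + linearForm δ)) =
        ∑ n ∈ range (A.degree + 1), (n.factorial : ℂ)⁻¹ •
          MvPowerSeries.coeff A (f ^ n * expS (linearForm δ)) := by
      rw [expS_add hf0 (constantCoeff_linearForm δ)]
      have hm : ∀ n, MvPowerSeries.coeff A (f ^ n * expS (linearForm δ)) = ∑ p ∈ antidiagonal A,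
          MvPowerSeries.coeff p.1 (f ^ n) * MvPowerSeries.coeff p.2 (expS (linearForm δ)) :=
        fun n => by rw [MvPowerSeries.coeff_mul]
      simp only [hm, smul_sum]
      rw [sum_comm, MvPowerSeries.coeff_mul]
      refine sum_congr rfl fun p hp => ?_
      rw [coeff_expS hf0 p.1 (N := A.degree + 1), sum_mul]
      · simp only [smul_mul_assoc]
      · rw [← HasAntidiagonal.mem_antidiagonal.1 hp, map_add]
        omega
    have hz : ∀ n ∉ range (A.degree + 1), ((n.factorial : ℂ)⁻¹ •
        (MvPowerSeries.C (MvPowerSeries.coeff A (f ^ n * expS (linearForm δ))) :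
        MvPowerSeries τ (PowerSeries ℂ))) = 0 := by
      intro n hn
      rw [mem_range, not_lt] at hn
      rw [MvPowerSeries.coeff_mul, sum_eq_zero, map_zero, smul_zero]
      intro p hp
      rw [coeff_pow_eq_zero hf0, zero_mul]
      have := congrArg Finsupp.degree (HasAntidiagonal.mem_antidiagonal.1 hp)
      rw [map_add] at this
      omega
    rw [hA, map_sum]
    simp only [C_complex_smul]
    exact hasSum_sum_of_ne_finset_zero hz
  · rw [hasSum_series_iff_coeff]
    intro s
    rw [coeff_coeff_curryS, coeff_expS hg0 _ (Nat.lt_succ_self _)]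
    have h : ∀ n, MvPowerSeries.coeff s ((n.factorial : ℂ)⁻¹ •
        MvPowerSeries.coeff A (curryS g ^ n)) = (n.factorial : ℂ)⁻¹ •
          MvPowerSeries.coeff (Finsupp.sumElim A s) (g ^ n) := fun n => by
      rw [coeff_complex_smul, ← map_pow, coeff_coeff_curryS]
    simp only [h]
    refine hasSum_sum_of_ne_finset_zero fun n hn => ?_
    rw [mem_range, not_lt] at hn
    rw [coeff_pow_eq_zero hg0 (by omega), smul_zero]

end Regrouping

/-! ### Rescaling the integrand by powers of `ħ/i` -/

section FormalIntegral

variable {τ : Type} {d : ℕ}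

/-- The formal parameter `ħ/i`. -/
noncomputable def hbarI : PowerSeries ℂ := PowerSeries.C Complex.I⁻¹ * PowerSeries.X

/-- The Laurent series `i/ħ`. -/
noncomputable def invHbarI : LaurentSeries ℂ := HahnSeries.single (-1) Complex.I

theorem ofPowerSeries_hbarI :
    HahnSeries.ofPowerSeries ℤ ℂ hbarI = HahnSeries.single 1 Complex.I⁻¹ := by
  rw [hbarI, map_mul, HahnSeries.ofPowerSeries_C, HahnSeries.ofPowerSeries_X, HahnSeries.C_apply,
    HahnSeries.single_mul_single, zero_add, mul_one]

theorem invHbarI_mul_hbarI : invHbarI * HahnSeries.ofPowerSeries ℤ ℂ hbarI = 1 := by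
  rw [ofPowerSeries_hbarI, invHbarI, HahnSeries.single_mul_single, mul_inv_cancel₀ Complex.I_ne_zero]
  rfl

theorem coeff_invHbarI_pow_mul (n : ℕ) (z : PowerSeries ℂ) (k : ℤ) :
    (invHbarI ^ n * HahnSeries.ofPowerSeries ℤ ℂ z).coeff k =
      Complex.I ^ n * if k + n < 0 then 0 else PowerSeries.coeff (k + n).natAbs z := by
  have h : k = (k + n) + n • (-1 : ℤ) := by simp
  rw [invHbarI, HahnSeries.single_pow, h, HahnSeries.coeff_single_mul_add, ← PowerSeries.coeff_coe]
  simp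

theorem hbarI_ne_zero : hbarI ≠ 0 := by
  rw [hbarI]
  exact mul_ne_zero (by simp) PowerSeries.X_ne_zero

theorem X_dvd_hbarI : PowerSeries.X ∣ hbarI := Dvd.intro_left _ rfl

/-- The coefficients of the scaled series with coefficients `S`, with factorials. -/
noncomputable def blackFactor (S : (l : ℕ) → (Fin l → Fin d) → PowerSeries ℂ) (a : Fin d →₀ ℕ) :
    PowerSeries ℂ :=
  if a.degree < 2 then 0 else
    multiFactorial a • (hbarI ^ (a.degree - 1) * MvPowerSeries.coeff a (tensorSeries S))

theorem blackBound_blackFactor (S : (l : ℕ) → (Fin l → Fin d) → PowerSeries ℂ) :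
    BlackBound (blackFactor S) where
  eq_zero a ha := if_pos ha
  dvd a := by
    rw [blackFactor]
    split_ifs
    · exact dvd_zero _
    · exact dvd_smul_of_dvd _ (Dvd.dvd.mul_right (pow_dvd_pow_of_dvd X_dvd_hbarI _) _)

/-- A scaled coefficient of the series `P`. -/
noncomputable def scaledCoeff (P : MvPowerSeries (Fin d ⊕ τ) (PowerSeries ℂ)) (b : Fin d →₀ ℕ) :
    MvPowerSeries τ (PowerSeries ℂ) :=
  fun s => hbarI ^ (s.degree - 1) * MvPowerSeries.coeff (Finsupp.sumElim b s) P

theorem coeff_scaledCoeff (P : MvPowerSeries (Fin d ⊕ τ) (PowerSeries ℂ)) (b : Fin d →₀ ℕ)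
    (s : τ →₀ ℕ) : MvPowerSeries.coeff s (scaledCoeff P b) =
      hbarI ^ (s.degree - 1) * MvPowerSeries.coeff (Finsupp.sumElim b s) P := rfl

/-- The coefficients of the scaled series `P`, with factorials. -/
noncomputable def whiteFactor (P : MvPowerSeries (Fin d ⊕ τ) (PowerSeries ℂ)) (b : Fin d →₀ ℕ) :
    MvPowerSeries τ (PowerSeries ℂ) := multiFactorial b • scaledCoeff P b

theorem constantCoeff_whiteFactor {P : MvPowerSeries (Fin d ⊕ τ) (PowerSeries ℂ)}
    (hP : ∀ b, MvPowerSeries.coeff (Finsupp.sumElim b 0) P = 0) (b : Fin d →₀ ℕ) :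
    MvPowerSeries.constantCoeff (whiteFactor P b) = 0 := by
  rw [← MvPowerSeries.coeff_zero_eq_constantCoeff_apply, whiteFactor, coeff_complex_smul,
    coeff_scaledCoeff, hP, mul_zero, smul_zero]

/-- The `ħ`-corrections of the linear coefficients. -/
noncomputable def shift (S : (l : ℕ) → (Fin l → Fin d) → PowerSeries ℂ) (y₀ : Fin d → ℝ)
    (i : Fin d) : PowerSeries ℂ := S 1 (fun _ => i) - PowerSeries.C (y₀ i : ℂ)

/-- Restoring the weight cancels the only term that mixes `η` and `q`. The phase then separates, and
its exponential is a product. -/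
theorem phase_add_weight (S : (l : ℕ) → (Fin l → Fin d) → PowerSeries ℂ) (y₀ : Fin d → ℝ)
    (P : MvPowerSeries (Fin d ⊕ τ) (PowerSeries ℂ)) :
    phase S y₀ P + ∑ i, etaVar i * qVar i =
      MvPowerSeries.rename Function.Embedding.inl
        (tensorSeries S - linearForm fun i => PowerSeries.C (y₀ i : ℂ)) +
      MvPowerSeries.rename Function.Embedding.inr P := by
  have h : MvPowerSeries.rename (Function.Embedding.inl : Fin d ↪ Var d τ)
      (linearForm fun i => PowerSeries.C (y₀ i : ℂ)) =
      ∑ i, MvPowerSeries.C (PowerSeries.C (y₀ i : ℂ)) * qVar i := by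
    rw [linearForm, map_sum]
    refine sum_congr rfl fun i _ => ?_
    rw [MvPowerSeries.rename_monomial, Finsupp.mapDomain_single, qVar,
      ← MvPowerSeries.monomial_zero_eq_C_apply, MvPowerSeries.X_def, MvPowerSeries.monomial_mul_monomial]
    simp
  rw [phase, map_sub, h]
  simp only [add_mul, sum_add_distrib]
  abel

/-- The number of occurrences of each index in a list of indices. -/
noncomputable def content {n l : ℕ} (a : Fin l → Fin n) : Fin n →₀ ℕ :=
  ∑ i, Finsupp.single (a i) 1

theorem degree_content {n l : ℕ} (a : Fin l → Fin n) : (content a).degree = l := by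
  simp [content]

theorem coeff_tensorSeries {R : Type} [CommRing R] {n l : ℕ}
    (T : (l : ℕ) → (Fin l → Fin n) → R) {s : Fin n →₀ ℕ} (h : s.degree = l) :
    MvPowerSeries.coeff s (tensorSeries T) =
      ∑ a ∈ univ.filter fun a : Fin l → Fin n => content a = s, T l a := by
  subst h
  rfl

theorem coeff_tensorSeries_zero {R : Type} [CommRing R] {n : ℕ}
    (T : (l : ℕ) → (Fin l → Fin n) → R) (a : Fin 0 → Fin n) :
    MvPowerSeries.coeff 0 (tensorSeries T) = T 0 a := by
  rw [coeff_tensorSeries T (l := 0) (by simp), filter_true_of_mem, Fintype.sum_unique,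
    Subsingleton.elim default a]
  intro a _
  simp [content]

theorem coeff_tensorSeries_single {R : Type} [CommRing R] {n : ℕ}
    (T : (l : ℕ) → (Fin l → Fin n) → R) (i : Fin n) :
    MvPowerSeries.coeff (Finsupp.single i 1) (tensorSeries T) = T 1 fun _ => i := by
  rw [coeff_tensorSeries T (l := 1) (by simp), sum_eq_single fun _ => i]
  · intro a ha hne
    refine absurd (funext fun j => ?_) hne
    have h := (mem_filter.1 ha).2
    rw [content, Fin.sum_univ_one] at h
    rw [Fin.fin_one_eq_zero j]
    exact Finsupp.single_left_injective one_ne_zero h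
  · intro h
    exact absurd (mem_filter.2 ⟨mem_univ _, by simp [content]⟩) h

theorem exists_eq_single_of_degree_eq_one {n : ℕ} {s : Fin n →₀ ℕ} (h : s.degree = 1) :
    ∃ i, s = Finsupp.single i 1 := by
  have h0 : s ≠ 0 := by
    rintro rfl
    simp at h
  obtain ⟨i, hi⟩ := Finsupp.ne_iff.1 h0
  refine ⟨i, ?_⟩
  rw [Finsupp.coe_zero, Pi.zero_apply] at hi
  have h1 : Finsupp.single i 1 ≤ s := by
    rw [Finsupp.single_le_iff]
    exact Nat.one_le_iff_ne_zero.2 hi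
  obtain ⟨r, rfl⟩ := exists_add_of_le h1
  rw [map_add, Finsupp.degree_single, Nat.add_eq_left, Finsupp.degree_eq_zero_iff] at h
  rw [h, add_zero]

/-! ### The rescaled exponents in the momenta and in the interaction -/

section Rescaling

variable (S : (l : ℕ) → (Fin l → Fin d) → PowerSeries ℂ) (y₀ : Fin d → ℝ)
  (P : MvPowerSeries (Fin d ⊕ τ) (PowerSeries ℂ))

/-- The scaled series of the terms of order at least two in the momenta. -/
noncomputable def scaledBlack : MvPowerSeries (Fin d) (PowerSeries ℂ) :=
  fun a => (multiFactorial a)⁻¹ • blackFactor S a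

/-- The scaled series `P`. -/
noncomputable def scaledWhite : MvPowerSeries (Fin d ⊕ τ) (PowerSeries ℂ) :=
  fun m => hbarI ^ ((Finsupp.sumFinsuppEquivProdFinsupp m).2.degree - 1) * MvPowerSeries.coeff m P

theorem coeff_scaledBlack (a : Fin d →₀ ℕ) : MvPowerSeries.coeff a (scaledBlack S) =
    (multiFactorial a)⁻¹ • blackFactor S a := rfl

theorem coeff_curryS_scaledWhite (b : Fin d →₀ ℕ) :
    MvPowerSeries.coeff b (curryS (scaledWhite P)) = (multiFactorial b)⁻¹ • whiteFactor P b := by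
  rw [whiteFactor, inv_smul_smul₀ (multiFactorial_ne_zero _)]
  ext1 s
  rw [coeff_coeff_curryS]
  have : (Finsupp.sumFinsuppEquivProdFinsupp (Finsupp.sumElim b s)).2 = s :=
    congrArg Prod.snd (Finsupp.sumFinsuppEquivProdFinsupp.right_inv (b, s))
  change hbarI ^ ((Finsupp.sumFinsuppEquivProdFinsupp (Finsupp.sumElim b s)).2.degree - 1) * _ = _
  rw [this]
  rfl

/-- The phase as a function of the momenta only, without its constant term. -/
noncomputable def momentumPart : MvPowerSeries (Fin d) (PowerSeries ℂ) :=
  tensorSeries S - linearForm (fun i => PowerSeries.C (y₀ i : ℂ)) -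
    MvPowerSeries.C (MvPowerSeries.constantCoeff (tensorSeries S))

theorem constantCoeff_momentumPart : MvPowerSeries.constantCoeff (momentumPart S y₀) = 0 := by
  simp [momentumPart, constantCoeff_linearForm]

/-- In degree one the factor `(ħ/i)^0` leaves the difference of the linear coefficient and `y₀`,
which is the `shift`. Every higher degree `m` receives `(ħ/i)^(m-1)` and belongs to `scaledBlack`.
-/
theorem coeff_momentumPart {a : Fin d →₀ ℕ} (ha : a ≠ 0) :
    hbarI ^ (a.degree - 1) * MvPowerSeries.coeff a (momentumPart S y₀) =
      MvPowerSeries.coeff a (scaledBlack S + linearForm (shift S y₀)) := by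
  classical
  have h0 : a.degree ≠ 0 := fun h => ha ((Finsupp.degree_eq_zero_iff a).1 h)
  rw [momentumPart, map_sub, MvPowerSeries.coeff_C, if_neg ha, sub_zero, map_sub, map_add,
    coeff_scaledBlack, blackFactor]
  by_cases h1 : a.degree = 1
  · obtain ⟨i, rfl⟩ := exists_eq_single_of_degree_eq_one h1
    have hi : ∀ f : Fin d → PowerSeries ℂ,
        MvPowerSeries.coeff (Finsupp.single i 1) (linearForm f) = f i := fun f => by
      rw [coeff_linearForm, sum_eq_single i, if_pos rfl]
      · intro j _ hj
        exact if_neg fun h => hj (Finsupp.single_left_injective one_ne_zero h).symm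
      · exact fun h => absurd (mem_univ i) h
    rw [if_pos (by omega), hi, hi, coeff_tensorSeries_single, shift, h1]
    simp
  · have hl : ∀ f : Fin d → PowerSeries ℂ, MvPowerSeries.coeff a (linearForm f) = 0 := fun f => by
      rw [coeff_linearForm]
      refine sum_eq_zero fun j _ => if_neg fun h => h1 ?_
      rw [h, Finsupp.degree_single]
    rw [if_neg (by omega), hl, hl, sub_zero, add_zero, inv_smul_smul₀ (multiFactorial_ne_zero _)]

/-- Each variable counted by `w` brings a factor `ħ/i`, and one of these is used up by the `i/ħ` in
the exponent. What remains lies in `ℂ[[ħ]]`, provided that the exponent has no terms of weight zero,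
which is the hypothesis `h0`. -/
theorem expS_rescale_hbar {σ : Type} {f g : MvPowerSeries σ (PowerSeries ℂ)}
    (hf : MvPowerSeries.constantCoeff f = 0) (hg : MvPowerSeries.constantCoeff g = 0)
    (w : (σ →₀ ℕ) →+ ℕ)
    (h : ∀ m, w m ≠ 0 → hbarI ^ (w m - 1) * MvPowerSeries.coeff m f = MvPowerSeries.coeff m g)
    (h0 : ∀ m, w m = 0 → MvPowerSeries.coeff m f = 0 ∧ MvPowerSeries.coeff m g = 0)
    (m : σ →₀ ℕ) :
    HahnSeries.ofPowerSeries ℤ ℂ hbarI ^ w m * MvPowerSeries.coeff m (expS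
      (MvPowerSeries.C invHbarI * MvPowerSeries.map (HahnSeries.ofPowerSeries ℤ ℂ) f)) =
      HahnSeries.ofPowerSeries ℤ ℂ (MvPowerSeries.coeff m (expS g)) := by
  refine expS_rescale _ hg ?_ w _ (fun m => ?_) m
  · rw [map_mul, MvPowerSeries.constantCoeff_map, hf, map_zero, mul_zero]
  · rw [MvPowerSeries.coeff_C_mul, MvPowerSeries.coeff_map]
    by_cases hm : w m = 0
    · rw [(h0 m hm).1, (h0 m hm).2, map_zero, mul_zero, mul_zero]
    · obtain ⟨n, hn⟩ := Nat.exists_eq_succ_of_ne_zero hm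
      rw [← h m hm, hn, map_mul, map_pow, Nat.succ_sub_one, pow_succ]
      linear_combination (HahnSeries.ofPowerSeries ℤ ℂ hbarI ^ n *
        HahnSeries.ofPowerSeries ℤ ℂ (MvPowerSeries.coeff m f)) * invHbarI_mul_hbarI

theorem coeff_scaledBlack_linearForm_zero :
    MvPowerSeries.coeff 0 (scaledBlack S + linearForm (shift S y₀)) = 0 := by
  rw [map_add, coeff_scaledBlack, (blackBound_blackFactor S).eq_zero 0 (by simp), smul_zero,
    MvPowerSeries.coeff_zero_eq_constantCoeff_apply, constantCoeff_linearForm, add_zero]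

theorem coeff_scaledWhite (m : Fin d ⊕ τ →₀ ℕ) : MvPowerSeries.coeff m (scaledWhite P) =
    hbarI ^ ((Finsupp.sumFinsuppEquivProdFinsupp m).2.degree - 1) * MvPowerSeries.coeff m P := rfl

theorem constantCoeff_of_white (hP : ∀ b, MvPowerSeries.coeff (Finsupp.sumElim b 0) P = 0) :
    MvPowerSeries.constantCoeff P = 0 := by
  rw [← MvPowerSeries.coeff_zero_eq_constantCoeff_apply, ← Finsupp.sumElim_zero_zero]
  exact hP 0

theorem phase_sub_const (hP : ∀ b, MvPowerSeries.coeff (Finsupp.sumElim b 0) P = 0) :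
    MvPowerSeries.constantCoeff (phase S y₀ P + ∑ i, etaVar i * qVar i) =
        MvPowerSeries.constantCoeff (tensorSeries S) ∧
      phase S y₀ P + ∑ i, etaVar i * qVar i - MvPowerSeries.C (MvPowerSeries.constantCoeff
        (phase S y₀ P + ∑ i, etaVar i * qVar i)) =
      MvPowerSeries.rename Function.Embedding.inl (momentumPart S y₀) +
      MvPowerSeries.rename Function.Embedding.inr P := by
  have h : MvPowerSeries.constantCoeff (phase S y₀ P + ∑ i, etaVar i * qVar i) =
        MvPowerSeries.constantCoeff (tensorSeries S) := by
    rw [phase_add_weight, map_add, MvPowerSeries.constantCoeff_rename,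
      MvPowerSeries.constantCoeff_rename, map_sub, constantCoeff_linearForm,
      constantCoeff_of_white P hP, sub_zero, add_zero]
  refine ⟨h, ?_⟩
  rw [h, phase_add_weight, momentumPart, map_sub (MvPowerSeries.rename _) _ (MvPowerSeries.C _),
    MvPowerSeries.rename_C]
  ring

theorem constantCoeff_phase (hP : ∀ b, MvPowerSeries.coeff (Finsupp.sumElim b 0) P = 0) :
    MvPowerSeries.constantCoeff (phase S y₀ P) = MvPowerSeries.constantCoeff (tensorSeries S) := by
  rw [← (phase_sub_const S y₀ P hP).1, map_add, map_sum]
  simp [etaVar, qVar]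

/-- The coefficients of the integrand that contribute to the formal integral. -/
theorem coeff_amplitude_phase (hP : ∀ b, MvPowerSeries.coeff (Finsupp.sumElim b 0) P = 0)
    (A : Fin d →₀ ℕ) (s : τ →₀ ℕ) :
    HahnSeries.ofPowerSeries ℤ ℂ hbarI ^ A.degree *
      (HahnSeries.ofPowerSeries ℤ ℂ hbarI ^ s.degree *
        MvPowerSeries.coeff (Finsupp.sumElim A (Finsupp.sumElim A s))
          (amplitude (phase S y₀ P + ∑ i, etaVar i * qVar i))) =
      HahnSeries.ofPowerSeries ℤ ℂ
        (MvPowerSeries.coeff A (expS (scaledBlack S + linearForm (shift S y₀))) *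
          MvPowerSeries.coeff (Finsupp.sumElim A s) (expS (scaledWhite P))) := by
  classical
  have hP0 := constantCoeff_of_white P hP
  have e1 : amplitude (phase S y₀ P + ∑ i, etaVar i * qVar i) =
      expS (MvPowerSeries.C invHbarI * MvPowerSeries.map (HahnSeries.ofPowerSeries ℤ ℂ)
        (MvPowerSeries.rename Function.Embedding.inl (momentumPart S y₀) +
      MvPowerSeries.rename Function.Embedding.inr P)) := by
    rw [← (phase_sub_const S y₀ P hP).2]
    rfl
  have e2 : (MvPowerSeries.C invHbarI * MvPowerSeries.map (HahnSeries.ofPowerSeries ℤ ℂ)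
        (MvPowerSeries.rename (Function.Embedding.inl : Fin d ↪ Var d τ) (momentumPart S y₀) +
      MvPowerSeries.rename Function.Embedding.inr P)) =
      MvPowerSeries.rename Function.Embedding.inl (MvPowerSeries.C invHbarI *
        MvPowerSeries.map (HahnSeries.ofPowerSeries ℤ ℂ) (momentumPart S y₀)) +
      MvPowerSeries.rename Function.Embedding.inr (MvPowerSeries.C invHbarI *
        MvPowerSeries.map (HahnSeries.ofPowerSeries ℤ ℂ) P) := by
    simp only [map_add, mul_add, map_mul, MvPowerSeries.rename_C, MvPowerSeries.rename_map]
  have c1 : MvPowerSeries.constantCoeff (MvPowerSeries.C invHbarI *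
        MvPowerSeries.map (HahnSeries.ofPowerSeries ℤ ℂ) (momentumPart S y₀)) = 0 := by
    rw [map_mul, MvPowerSeries.constantCoeff_map, constantCoeff_momentumPart, map_zero, mul_zero]
  have c2 : MvPowerSeries.constantCoeff (MvPowerSeries.C invHbarI *
        MvPowerSeries.map (HahnSeries.ofPowerSeries ℤ ℂ) P) = 0 := by
    rw [map_mul, MvPowerSeries.constantCoeff_map, hP0, map_zero, mul_zero]
  rw [e1, e2, expS_add (by rw [MvPowerSeries.constantCoeff_rename, c1])
    (by rw [MvPowerSeries.constantCoeff_rename, c2]), expS_rename _ c1, expS_rename _ c2,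
    coeff_rename_inl_mul_rename_inr, map_mul]
  -- On the momentum side every `q` counts, and `(ħ/i)^{|A|}` comes from the integration rule.
  have h1 := expS_rescale_hbar (g := scaledBlack S + linearForm (shift S y₀))
    (constantCoeff_momentumPart S y₀) ?_ Finsupp.degree
    (fun m hm => coeff_momentumPart S y₀ fun h => hm (by rw [h, map_zero])) ?_ A
  -- On the interaction side only the parameters count, not the `η`. Every term of `P` contains a
  -- parameter by `hP`, so the weight is positive wherever `P` has a nonzero coefficient.
  have h2 := expS_rescale_hbar (g := scaledWhite P) hP0 ?_
    (Finsupp.degree.comp (AddMonoidHom.snd (Fin d →₀ ℕ) (τ →₀ ℕ)) |>.comp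
      (Finsupp.sumFinsuppAddEquivProdFinsupp : _ ≃+ (Fin d →₀ ℕ) × (τ →₀ ℕ)).toAddMonoidHom)
    (fun m hm => rfl) ?_ (Finsupp.sumElim A s)
  · have h3 : (Finsupp.degree.comp (AddMonoidHom.snd (Fin d →₀ ℕ) (τ →₀ ℕ)) |>.comp
      (Finsupp.sumFinsuppAddEquivProdFinsupp : _ ≃+ (Fin d →₀ ℕ) × (τ →₀ ℕ)).toAddMonoidHom)
        (Finsupp.sumElim A s) = s.degree :=
      congrArg Finsupp.degree
        (congrArg Prod.snd (Finsupp.sumFinsuppEquivProdFinsupp.right_inv (A, s)))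
    rw [h3] at h2
    rw [← h1, ← h2]
    ring
  · rw [← MvPowerSeries.coeff_zero_eq_constantCoeff_apply, coeff_scaledWhite, ← Finsupp.sumElim_zero_zero, hP,
      mul_zero]
  · intro m hm
    have hm' : m = Finsupp.sumElim (Finsupp.sumFinsuppEquivProdFinsupp m).1 0 := by
      rw [← (Finsupp.degree_eq_zero_iff (Finsupp.sumFinsuppEquivProdFinsupp m).2).1 hm]
      exact (Finsupp.sumFinsuppEquivProdFinsupp.left_inv m).symm
    have h := hP (Finsupp.sumFinsuppEquivProdFinsupp m).1
    rw [← hm'] at h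
    exact ⟨h, by rw [coeff_scaledWhite, h, mul_zero]⟩
  · rw [← MvPowerSeries.coeff_zero_eq_constantCoeff_apply, coeff_scaledBlack_linearForm_zero]
  · intro m hm
    rw [(Finsupp.degree_eq_zero_iff m).1 hm]
    exact ⟨constantCoeff_momentumPart S y₀, coeff_scaledBlack_linearForm_zero S y₀⟩

end Rescaling

end FormalIntegral

/-! ### The formal integral as a sum over graphs, and its unique logarithm -/

section FormalIntegral

variable {τ : Type} {d : ℕ}

/-- The series with coefficients `(i/ħ)^{|s|} Z_s`. -/
noncomputable def unscale (Z : MvPowerSeries τ (PowerSeries ℂ)) :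
    MvPowerSeries τ (LaurentSeries ℂ) :=
  fun s => invHbarI ^ s.degree * HahnSeries.ofPowerSeries ℤ ℂ (MvPowerSeries.coeff s Z)

theorem coeff_unscale (Z : MvPowerSeries τ (PowerSeries ℂ)) (s : τ →₀ ℕ) :
    MvPowerSeries.coeff s (unscale Z) =
      invHbarI ^ s.degree * HahnSeries.ofPowerSeries ℤ ℂ (MvPowerSeries.coeff s Z) := rfl

theorem coeff_coeff_unscale (Z : MvPowerSeries τ (PowerSeries ℂ)) (s : τ →₀ ℕ) (k : ℤ) :
    (MvPowerSeries.coeff s (unscale Z)).coeff k = Complex.I ^ s.degree *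
      if k + s.degree < 0 then 0 else coeffs Z (s, (k + s.degree).natAbs) := by
  rw [coeff_unscale, coeff_invHbarI_pow_mul]
  rfl

theorem invHbarI_pow_mul_cancel {n : ℕ} {x y : LaurentSeries ℂ}
    (h : HahnSeries.ofPowerSeries ℤ ℂ hbarI ^ n * x = y) : x = invHbarI ^ n * y := by
  rw [← h, ← mul_assoc, ← mul_pow, invHbarI_mul_hbarI, one_pow, one_mul]

theorem SumsTo.unique {ι J : Type} {f : ι → J → ℂ} {v v' : J → ℂ} (h : SumsTo f v)
    (h' : SumsTo f v') : v = v' :=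
  funext fun j => (h j).2.trans (h' j).2.symm

theorem sumsTo_unscale {ι : Type} {T : ι → MvPowerSeries τ (PowerSeries ℂ)}
    {Z : MvPowerSeries τ (PowerSeries ℂ)} (h : HasSum T Z) :
    SumsTo (fun A (j : (τ →₀ ℕ) × ℤ) => (MvPowerSeries.coeff j.1 (unscale (T A))).coeff j.2)
      fun j => (MvPowerSeries.coeff j.1 (unscale Z)).coeff j.2 := by
  rw [hasSum_series_iff] at h
  rintro ⟨s, k⟩
  simp only [coeff_coeff_unscale]
  split_ifs
  · simp [Function.support]
  · obtain ⟨h1, h2⟩ := h (s, (k + s.degree).natAbs)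
    refine ⟨h1.subset fun A hA => ?_, ?_⟩
    · exact right_ne_zero_of_mul hA
    · rw [h2, mul_finsum]

variable {S : (l : ℕ) → (Fin l → Fin d) → PowerSeries ℂ} {y₀ : Fin d → ℝ}
  {P : MvPowerSeries (Fin d ⊕ τ) (PowerSeries ℂ)}

/-- The formal integral is given by the sum over all graphs. -/
theorem hasFormalIntegral_iff (hP : ∀ b, MvPowerSeries.coeff (Finsupp.sumElim b 0) P = 0)
    (hS : ∀ i, PowerSeries.X ∣ shift S y₀ i) (I : Oscillatory τ) :
    HasFormalIntegral (phase S y₀ P) I ↔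
      I = AddMonoidAlgebra.single (MvPowerSeries.constantCoeff (tensorSeries S))
        (unscale (partitionFunction (blackFactor S) (leafSum (shift S y₀) (whiteFactor P)))) := by
  have h := sumsTo_unscale (hasSum_partitionFunction_total (blackBound_blackFactor S) hS
    (constantCoeff_whiteFactor hP) (coeff_scaledBlack S) (coeff_curryS_scaledWhite P))
  have e : (fun A (j : (τ →₀ ℕ) × ℤ) => (MvPowerSeries.coeff j.1 (unscale (multiFactorial A •
      (MvPowerSeries.C (MvPowerSeries.coeff A (expS (scaledBlack S + linearForm (shift S y₀)))) *
        MvPowerSeries.coeff A (curryS (expS (scaledWhite P))))))).coeff j.2) =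
      fun (A : Fin d →₀ ℕ) (j : (τ →₀ ℕ) × ℤ) =>
        ((∏ i, ((A i).factorial : LaurentSeries ℂ)) *
          (HahnSeries.single 1 Complex.I⁻¹ : LaurentSeries ℂ) ^ A.degree *
          MvPowerSeries.coeff (Finsupp.sumElim A (Finsupp.sumElim A j.1))
            (amplitude (phase S y₀ P + ∑ i, etaVar i * qVar i))).coeff j.2 := by
    ext A ⟨s, k⟩
    dsimp only
    congr 1
    have h1 := coeff_amplitude_phase S y₀ P hP A s
    rw [mul_left_comm] at h1
    have h2 := invHbarI_pow_mul_cancel h1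
    have h3 : (∏ i, ((A i).factorial : LaurentSeries ℂ)) =
        HahnSeries.ofPowerSeries ℤ ℂ (PowerSeries.C (multiFactorial A)) := by
      rw [multiFactorial, map_prod, map_prod]
      simp only [map_natCast]
    rw [mul_assoc, ← ofPowerSeries_hbarI, h2, h3, coeff_unscale, coeff_complex_smul,
      MvPowerSeries.coeff_C_mul, coeff_coeff_curryS, mul_left_comm, ← map_mul,
      PowerSeries.smul_eq_C_mul]
  rw [e] at h
  rw [HasFormalIntegral, constantCoeff_phase S y₀ P hP]
  constructor
  · rintro ⟨J, rfl, hJ⟩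
    congr 1
    ext s k
    exact congrFun (hJ.unique h) (s, k)
  · rintro rfl
    exact ⟨_, rfl, h⟩

theorem constantCoeff_amplitude {σ : Type} (Ψ : MvPowerSeries σ (PowerSeries ℂ)) :
    MvPowerSeries.constantCoeff (amplitude Ψ) = 1 :=
  constantCoeff_expS (by simp)

theorem amplitude_injective {σ : Type} {Ψ Ψ' : MvPowerSeries σ (PowerSeries ℂ)}
    (h : amplitude Ψ = amplitude Ψ')
    (h0 : MvPowerSeries.constantCoeff Ψ = MvPowerSeries.constantCoeff Ψ') : Ψ = Ψ' := by
  have h1 := expS_injective (by simp) (by simp) h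
  ext1 s
  have h2 := congrArg (MvPowerSeries.coeff s) h1
  rw [MvPowerSeries.coeff_C_mul, MvPowerSeries.coeff_C_mul, MvPowerSeries.coeff_map,
    MvPowerSeries.coeff_map] at h2
  have hu : (HahnSeries.single (-1) Complex.I : LaurentSeries ℂ) ≠ 0 := by simp
  have h3 := HahnSeries.ofPowerSeries_injective (mul_left_cancel₀ hu h2)
  rwa [map_sub, map_sub, h0, sub_left_inj] at h3

/-- The exponential formula identifies `Z` with an exponential, and the hypothesis says that the
exponent is the rescaled `H`. -/
theorem amplitude_eq_unscale {β : (Fin d →₀ ℕ) → PowerSeries ℂ}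
    {wh : (Fin d →₀ ℕ) → MvPowerSeries τ (PowerSeries ℂ)} (hβ : BlackBound β)
    (hwh : ∀ a, MvPowerSeries.constantCoeff (wh a) = 0) {H : MvPowerSeries τ (PowerSeries ℂ)}
    (h : ∀ s ≠ 0, hbarI ^ (s.degree - 1) * MvPowerSeries.coeff s H =
      MvPowerSeries.coeff s (freeEnergy β wh)) :
    amplitude H = unscale (partitionFunction β wh) := by
  classical
  -- The constant term of the free energy, to which the empty graph contributes since it counts as
  -- connected in the sense of `IsConn`, must be subtracted. It does not affect the differential
  -- equation.
  have hZ : partitionFunction β wh = expS (freeEnergy β wh -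
      MvPowerSeries.C (MvPowerSeries.constantCoeff (freeEnergy β wh))) := by
    rw [eq_expS_iff (by simp)]
    refine ⟨constantCoeff_partitionFunction hβ hwh, ?_⟩
    rw [map_sub, euler_C, sub_zero, euler_partitionFunction hβ hwh]
  ext1 s
  rw [coeff_unscale, hZ]
  refine invHbarI_pow_mul_cancel (expS_rescale_hbar (by simp) (by simp) Finsupp.degree
    (fun m hm => ?_) (fun m hm => ?_) s)
  · have hm0 : m ≠ 0 := fun h0 => hm (by rw [h0, map_zero])
    rw [map_sub, map_sub, MvPowerSeries.coeff_C, MvPowerSeries.coeff_C, if_neg hm0, if_neg hm0,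
      sub_zero, sub_zero]
    exact h m hm0
  · rw [(Finsupp.degree_eq_zero_iff m).1 hm]
    simp

/-- The solution of the equation `e^{(i/ħ) H} = ∫ Dy Đq e^{(i/ħ) Ψ}`. -/
theorem hasFormalIntegral_oscExp_iff
    (hP : ∀ b, MvPowerSeries.coeff (Finsupp.sumElim b 0) P = 0)
    (hS : ∀ i, PowerSeries.X ∣ shift S y₀ i) {H : MvPowerSeries τ (PowerSeries ℂ)}
    (h0 : MvPowerSeries.constantCoeff H = MvPowerSeries.constantCoeff (tensorSeries S))
    (h : ∀ s ≠ 0, hbarI ^ (s.degree - 1) * MvPowerSeries.coeff s H = MvPowerSeries.coeff s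
      (freeEnergy (blackFactor S) (leafSum (shift S y₀) (whiteFactor P))))
    (H' : MvPowerSeries τ (PowerSeries ℂ)) :
    HasFormalIntegral (phase S y₀ P) (oscExp H') ↔ H' = H := by
  have hA := amplitude_eq_unscale (blackBound_blackFactor S)
    (constantCoeff_leafSum hS (constantCoeff_whiteFactor hP)) h
  rw [hasFormalIntegral_iff hP hS, ← hA, ← h0, oscExp]
  constructor
  · intro hE
    -- The formal exponent of a `single` can be read off only if its coefficient is nonzero; an
    -- amplitude has constant term 1.
    have hne : amplitude H' ≠ 0 := fun hz => by
      have := constantCoeff_amplitude H'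
      rw [hz, map_zero] at this
      exact zero_ne_one this
    rcases AddMonoidAlgebra.single_inj.1 hE with h1 | h1
    · exact amplitude_injective h1.2 h1.1
    · exact absurd h1.1 hne
  · rintro rfl
    rfl

end FormalIntegral

/-! ### Symmetry of iterated partial derivatives -/

section Derivatives

variable {d : ℕ}

/-- The iterated partial derivative along a list of indices. -/
noncomputable def listDeriv (f : (Fin d → ℝ) → ℂ) : List (Fin d) → (Fin d → ℝ) → ℂ
  | [] => f
  | i :: L => fun y => fderiv ℝ (listDeriv f L) y (Pi.single i 1)

theorem contDiffOn_listDeriv {V : Set (Fin d → ℝ)} (hV : IsOpen V) {f : (Fin d → ℝ) → ℂ}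
    (hf : ContDiffOn ℝ ∞ f V) (L : List (Fin d)) : ContDiffOn ℝ ∞ (listDeriv f L) V := by
  induction L with
  | nil => exact hf
  | cons i L ih => exact (ih.fderiv_of_isOpen hV (m := ∞) (by simp)).clm_apply contDiffOn_const

/-- Permutations of lists are generated by swaps of the two leading entries, up to prepending, so
the symmetry of second derivatives suffices. Equality is needed on all of the open set `V`, so that
it can be differentiated again. -/
theorem listDeriv_perm {V : Set (Fin d → ℝ)} (hV : IsOpen V) {f : (Fin d → ℝ) → ℂ}
    (hf : ContDiffOn ℝ ∞ f V) {L L' : List (Fin d)} (h : L.Perm L') :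
    Set.EqOn (listDeriv f L) (listDeriv f L') V := by
  induction h with
  | nil => exact fun _ _ => rfl
  | cons i _ ih =>
    intro y hy
    change fderiv ℝ _ y _ = fderiv ℝ _ y _
    rw [(ih.eventuallyEq_of_mem (hV.mem_nhds hy)).fderiv_eq]
  | swap i j L =>
    intro y hy
    have hs := (contDiffOn_listDeriv hV hf L).contDiffAt (hV.mem_nhds hy)
    have h2 := hs.isSymmSndFDerivAt (by simpa using (WithTop.coe_le_coe.2 le_top : ((2 : ℕ∞) : WithTop ℕ∞) ≤ ∞))
    have hd : DifferentiableAt ℝ (fderiv ℝ (listDeriv f L)) y :=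
      (hs.fderiv_right (m := 1) (by norm_cast)).differentiableAt (by simp)
    have key : ∀ i j : Fin d, listDeriv f (i :: j :: L) y =
        fderiv ℝ (fderiv ℝ (listDeriv f L)) y (Pi.single i 1) (Pi.single j 1) := by
      intro i j
      change fderiv ℝ (fun y => fderiv ℝ (listDeriv f L) y (Pi.single j 1)) y (Pi.single i 1) = _
      rw [fderiv_clm_apply hd (differentiableAt_const _)]
      simp
    rw [key, key]
    exact h2 _ _
  | trans _ _ h1 h2 => exact h1.trans h2

theorem partialDeriv_eq_listDeriv {V : Set (Fin d → ℝ)} (hV : IsOpen V) {f : (Fin d → ℝ) → ℂ}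
    (hf : ContDiffOn ℝ ∞ f V) {l : ℕ} (b : Fin l → Fin d) :
    Set.EqOn (partialDeriv f l b) (listDeriv f (List.ofFn b)) V := by
  induction l with
  | zero => intro y _; simp [partialDeriv, listDeriv]
  | succ l ih =>
    intro y hy
    have hs := hf.contDiffAt (hV.mem_nhds hy)
    have hd : DifferentiableAt ℝ (iteratedFDeriv ℝ l f) y :=
      hs.differentiableAt_iteratedFDeriv (by exact_mod_cast WithTop.coe_lt_top _)
    rw [partialDeriv, iteratedFDeriv_succ_apply_left, List.ofFn_succ, listDeriv]
    beta_reduce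
    rw [← ((ih fun i => b i.succ).eventuallyEq_of_mem (hV.mem_nhds hy)).fderiv_eq]
    have := fderiv_continuousMultilinear_apply_const_apply hd
      (fun i : Fin l => (Pi.single (b i.succ) 1 : Fin d → ℝ)) (Pi.single (b 0) 1)
    exact this.symm

theorem content_apply {n l : ℕ} (a : Fin l → Fin n) (i : Fin n) :
    content a i = (List.ofFn a).count i := by
  induction l with
  | zero => simp [content]
  | succ l ih =>
    have h := ih fun i => a i.succ
    rw [content, Finsupp.finsetSum_apply] at h ⊢
    rw [Fin.sum_univ_succ, List.ofFn_succ, List.count_cons, ← h, add_comm, Finsupp.single_apply]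
    simp

theorem perm_of_content_eq {n l l' : ℕ} {a : Fin l → Fin n} {a' : Fin l' → Fin n}
    (h : content a = content a') : (List.ofFn a).Perm (List.ofFn a') := by
  rw [List.perm_iff_count]
  intro i
  rw [← content_apply, ← content_apply, h]

theorem partialDeriv_congr {V : Set (Fin d → ℝ)} (hV : IsOpen V) {f : (Fin d → ℝ) → ℂ}
    (hf : ContDiffOn ℝ ∞ f V) {l l' : ℕ} {b : Fin l → Fin d} {b' : Fin l' → Fin d}
    (h : content b = content b') {y : Fin d → ℝ} (hy : y ∈ V) :
    partialDeriv f l b y = partialDeriv f l' b' y := by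
  rw [partialDeriv_eq_listDeriv hV hf b hy, partialDeriv_eq_listDeriv hV hf b' hy,
    listDeriv_perm hV hf (perm_of_content_eq h) hy]

theorem contDiffOn_partialDeriv {V : Set (Fin d → ℝ)} (hV : IsOpen V) {f : (Fin d → ℝ) → ℂ}
    (hf : ContDiffOn ℝ ∞ f V) {l : ℕ} (b : Fin l → Fin d) :
    ContDiffOn ℝ ∞ (partialDeriv f l b) V :=
  (contDiffOn_listDeriv hV hf _).congr (partialDeriv_eq_listDeriv hV hf b)

end Derivatives

/-! ### Lists of indices and multi-indices -/

section Words

variable {n : ℕ}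

theorem prod_X_eq_monomial {R σ : Type} [CommRing R] {l : ℕ} (a : Fin l → σ) :
    ∏ j, (MvPowerSeries.X (a j) : MvPowerSeries σ R) =
      MvPowerSeries.monomial (∑ j, Finsupp.single (a j) 1) 1 := by
  induction l with
  | zero => rw [Fin.prod_univ_zero, Fin.sum_univ_zero, MvPowerSeries.monomial_zero_one]
  | succ l ih =>
    rw [Fin.prod_univ_succ, ih, Fin.sum_univ_succ, MvPowerSeries.X_def,
      MvPowerSeries.monomial_mul_monomial, one_mul]

/-- The number of words with given content is a multinomial coefficient. -/
theorem card_words_mul (c : Fin n →₀ ℕ) {l : ℕ} (hc : c.degree = l) :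
    ((univ.filter fun a : Fin l → Fin n => content a = c).card : ℂ) * multiFactorial c =
      (l.factorial : ℂ) := by
  classical
  -- The coefficient of `exp (∑ X_i)` at `c` is computed in two ways: it is `1/c!` as a divided
  -- power, and the number of words divided by `l!` from the `l`-th power of the linear form.
  have hlin : ∀ m, MvPowerSeries.coeff c (linearForm (fun _ : Fin n => (1 : ℂ)) ^ m) =
      ((univ.filter fun a : Fin m → Fin n => content a = c).card : ℂ) := by
    intro m
    have h1 : linearForm (fun _ : Fin n => (1 : ℂ)) = ∑ i, MvPowerSeries.X i := rfl
    rw [h1, Fintype.sum_pow, map_sum, card_filter, Nat.cast_sum]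
    refine sum_congr rfl fun a _ => ?_
    rw [prod_X_eq_monomial, MvPowerSeries.coeff_monomial, Nat.cast_ite, Nat.cast_one, Nat.cast_zero]
    exact if_congr eq_comm rfl rfl
  have h2 := coeff_expS (constantCoeff_linearForm fun _ : Fin n => (1 : ℂ)) c
    (N := l + 1) (by omega)
  rw [coeff_expS_linearForm, divPow_eq, sum_eq_single l, hlin] at h2
  · simp only [one_pow, prod_const_one, smul_eq_mul, mul_one] at h2
    have h3 : (l.factorial : ℂ) ≠ 0 := Nat.cast_ne_zero.2 l.factorial_ne_zero
    have h4 := multiFactorial_ne_zero c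
    field_simp at h2
    rw [mul_comm]
    exact h2.symm
  · intro m _ hm
    rw [hlin, filter_eq_empty_iff.2, card_empty, Nat.cast_zero, smul_zero]
    intro a _ ha
    apply hm
    rw [← hc, ← ha, degree_content]
  · intro h
    exact absurd (mem_range.2 (Nat.lt_succ_self l)) h

/-- A family of tensors that are symmetric in their indices. -/
def IsSymmetric {R : Type} (T : (l : ℕ) → (Fin l → Fin n) → R) : Prop :=
  ∀ l (a : Fin l → Fin n) (σ : Equiv.Perm (Fin l)), T l (a ∘ σ) = T l a

theorem exists_perm_of_content_eq {l : ℕ} {a b : Fin l → Fin n} (h : content a = content b) :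
    ∃ σ : Equiv.Perm (Fin l), a = b ∘ σ := by
  classical
  have hcard : ∀ (a : Fin l → Fin n) i, Fintype.card {j // a j = i} = content a i := by
    intro a i
    rw [content, Finsupp.finsetSum_apply, Fintype.card_subtype, card_filter]
    exact sum_congr rfl fun j _ => (Finsupp.single_apply).symm
  have e : ∀ i, Nonempty ({j // a j = i} ≃ {j // b j = i}) := fun i =>
    ⟨Fintype.equivOfCardEq (by rw [hcard, hcard, h])⟩
  let σ : Equiv.Perm (Fin l) := (Equiv.sigmaFiberEquiv a).symm.trans
    ((Equiv.sigmaCongrRight fun i => (e i).some).trans (Equiv.sigmaFiberEquiv b))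
  exact ⟨σ, funext fun j => ((e (a j)).some ⟨j, rfl⟩).2.symm⟩

/-- All words with the same content carry the same tensor component, and there are `l!/c!` of them.
This converts the factor `m_v!` of a black vertex into a multi-index factorial. -/
theorem IsSymmetric.coeff {R : Type} [CommRing R] [Algebra ℂ R]
    {T : (l : ℕ) → (Fin l → Fin n) → R} (hT : IsSymmetric T) {l : ℕ} (a : Fin l → Fin n) :
    multiFactorial (content a) • MvPowerSeries.coeff (content a) (tensorSeries T) =
      (l.factorial : ℂ) • T l a := by
  rw [coeff_tensorSeries T (degree_content a), sum_congr rfl (g := fun _ => T l a),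
    sum_const, ← Nat.cast_smul_eq_nsmul ℂ, smul_smul, mul_comm,
    card_words_mul _ (degree_content a)]
  intro b hb
  obtain ⟨σ, rfl⟩ := exists_perm_of_content_eq (mem_filter.1 hb).2
  exact hT l a σ

theorem finite_degree_eq (n l : ℕ) : {c : Fin n →₀ ℕ | c.degree = l}.Finite :=
  (finite_degree_le l).subset fun c (h : c.degree = l) => show c.degree ≤ l from h.le

/-- The multi-indices of given degree. -/
noncomputable def ofDegree (n l : ℕ) : Finset (Fin n →₀ ℕ) := (finite_degree_eq n l).toFinset

theorem mem_ofDegree {l : ℕ} {c : Fin n →₀ ℕ} : c ∈ ofDegree n l ↔ c.degree = l := by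
  rw [ofDegree, Set.Finite.mem_toFinset]
  rfl

theorem sum_words {R : Type} [AddCommGroup R] [Module ℂ R] (l : ℕ) (f : (Fin n →₀ ℕ) → R) :
    ∑ a : Fin l → Fin n, f (content a) =
      ∑ c ∈ ofDegree n l, ((l.factorial : ℂ) * (multiFactorial c)⁻¹) • f c := by
  classical
  rw [← sum_fiberwise_of_maps_to (s := univ) (t := ofDegree n l) (g := content)
    (fun a _ => mem_ofDegree.2 (degree_content a))]
  refine sum_congr rfl fun c hc => ?_
  rw [sum_congr rfl (g := fun _ => f c) fun a ha => by rw [(mem_filter.1 ha).2], sum_const,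
    ← Nat.cast_smul_eq_nsmul ℂ, ← card_words_mul c (mem_ofDegree.1 hc),
    mul_inv_cancel_right₀ (multiFactorial_ne_zero c)]

/-- The tables of multi-indices of given degrees. -/
noncomputable def tablesOf {X Y : Type} [Fintype X] [Fintype Y] (n : ℕ) (m : X → Y → ℕ) :
    Finset (X → Y → Fin n →₀ ℕ) := by
  classical
  exact Fintype.piFinset fun x => Fintype.piFinset fun y => ofDegree n (m x y)

theorem mem_tablesOf {X Y : Type} [Fintype X] [Fintype Y] {m : X → Y → ℕ}
    {N : X → Y → Fin n →₀ ℕ} : N ∈ tablesOf n m ↔ ∀ x y, (N x y).degree = m x y := by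
  classical
  simp [tablesOf, Fintype.mem_piFinset, mem_ofDegree]

/-- The labellings with a given table of contents are independent choices of a word for each pair of
vertices, so their number is a product of multinomial coefficients. -/
theorem sum_labellings {R : Type} [AddCommGroup R] [Module ℂ R] {X Y : Type} [Fintype X] [Fintype Y]
    (m : X → Y → ℕ) (f : (X → Y → Fin n →₀ ℕ) → R) [DecidableEq X] [DecidableEq Y] :
    ∑ e : (∀ x y, Fin (m x y) → Fin n), f (fun x y => content (e x y)) =
      ∑ N ∈ tablesOf n m,
        (∏ x, ∏ y, (((m x y).factorial : ℂ) * (multiFactorial (N x y))⁻¹)) • f N := by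
  classical
  rw [← sum_fiberwise_of_maps_to (s := univ) (t := tablesOf n m)
    (g := fun (e : ∀ x y, Fin (m x y) → Fin n) x y => content (e x y))
    (fun a _ => mem_tablesOf.2 fun x y => degree_content _)]
  refine sum_congr rfl fun N hN => ?_
  rw [sum_congr rfl (g := fun _ => f N) fun a ha => by rw [(mem_filter.1 ha).2], sum_const,
    ← Nat.cast_smul_eq_nsmul ℂ]
  congr 1
  have h1 : (univ.filter fun e : (∀ x y, Fin (m x y) → Fin n) =>
      (fun x y => content (e x y)) = N) = Fintype.piFinset fun x => Fintype.piFinset fun y =>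
        univ.filter fun a : Fin (m x y) → Fin n => content a = N x y := by
    ext e
    simp [Fintype.mem_piFinset, funext_iff]
  rw [h1, Fintype.card_piFinset, Nat.cast_prod]
  refine prod_congr rfl fun x _ => ?_
  rw [Fintype.card_piFinset, Nat.cast_prod]
  refine prod_congr rfl fun y _ => ?_
  rw [← card_words_mul (N x y) (mem_tablesOf.1 hN x y),
    mul_inv_cancel_right₀ (multiFactorial_ne_zero _)]

end Words

/-! ### Contractions of graphs as sums over tables of multi-indices -/

section Contraction

variable {d : ℕ}

theorem content_append {l l' : ℕ} (a : Fin l → Fin d) (b : Fin l' → Fin d) :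
    content (Fin.append a b) = content a + content b := by
  rw [content, Fin.sum_univ_add]
  simp [content]

theorem prod_eq_divPow {l : ℕ} (f : Fin d → PowerSeries ℂ) (a : Fin l → Fin d) :
    ∏ i, f (a i) = multiFactorial (content a) • divPow f (content a) := by
  rw [divPow_eq, smul_inv_smul₀ (multiFactorial_ne_zero _)]
  induction l with
  | zero => simp [content]
  | succ l ih =>
    have h : content a = Finsupp.single (a 0) 1 + content fun i => a i.succ := by
      rw [content, Fin.sum_univ_succ]
      rfl
    rw [Fin.prod_univ_succ, ih, h]
    simp only [Finsupp.add_apply, pow_add, prod_mul_distrib]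
    congr 1
    rw [prod_eq_single (a 0)]
    · simp
    · intro i _ hi
      rw [Finsupp.single_eq_of_ne hi, pow_zero]
    · exact fun h => absurd (mem_univ _) h

/-- The derivatives of `h` at `y₀`, indexed by multi-indices. -/
noncomputable def multiDeriv (h : ℕ → (Fin d → ℝ) → ℂ) (y₀ : Fin d → ℝ) (m : Fin d →₀ ℕ) :
    PowerSeries ℂ :=
  multiFactorial m • MvPowerSeries.coeff m (taylorSeries h y₀)

/-- The derivatives of `h` at `φ`, indexed by multi-indices. -/
noncomputable def pointDeriv (h : ℕ → (Fin d → ℝ) → ℂ) (y₀ : Fin d → ℝ)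
    (φ : Fin d → PowerSeries ℂ) (b : Fin d →₀ ℕ) : PowerSeries ℂ :=
  ∑' c, divPow (fun i => φ i - PowerSeries.C (y₀ i : ℂ)) c * multiDeriv h y₀ (c + b)

variable {V : Set (Fin d → ℝ)} {h : ℕ → (Fin d → ℝ) → ℂ} {y₀ : Fin d → ℝ}
  {φ : Fin d → PowerSeries ℂ}

theorem multiDeriv_content (hV : IsOpen V) (hh : ∀ k, ContDiffOn ℝ ∞ (h k) V) (hy : y₀ ∈ V)
    {l : ℕ} (a : Fin l → Fin d) :
    multiDeriv h y₀ (content a) = PowerSeries.mk fun k => partialDeriv (h k) l a y₀ := by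
  have hT : IsSymmetric fun (l : ℕ) (b : Fin l → Fin d) =>
      PowerSeries.mk fun k => ((l.factorial : ℂ))⁻¹ * partialDeriv (h k) l b y₀ := by
    intro l b σ
    ext k
    rw [PowerSeries.coeff_mk, PowerSeries.coeff_mk,
      partialDeriv_congr hV (hh k) (b := b ∘ σ) (b' := b) (by
        rw [content, content]
        exact Equiv.sum_comp σ fun i => Finsupp.single (b i) 1) hy]
  rw [multiDeriv, taylorSeries, hT.coeff]
  ext k
  rw [PowerSeries.coeff_mk, PowerSeries.coeff_smul, PowerSeries.coeff_mk, smul_eq_mul,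
    mul_inv_cancel_left₀ (Nat.cast_ne_zero.2 l.factorial_ne_zero)]

/-- This is the Taylor expansion at `y₀`, with words grouped by content. Terms of degree `j` in `φ -
y₀` are divisible by `ħ^j`, so the truncation at order `N` in `partialDerivAt` loses nothing. -/
theorem hasSum_partialDerivAt (hV : IsOpen V) (hh : ∀ k, ContDiffOn ℝ ∞ (h k) V) (hy : y₀ ∈ V)
    (hφ : ∀ i, PowerSeries.X ∣ φ i - PowerSeries.C (y₀ i : ℂ)) {l : ℕ} (b : Fin l → Fin d) :
    HasSum (fun c => divPow (fun i => φ i - PowerSeries.C (y₀ i : ℂ)) c *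
      multiDeriv h y₀ (c + content b)) (partialDerivAt h y₀ φ l b) := by
  classical
  set δ : Fin d → PowerSeries ℂ := fun i => φ i - PowerSeries.C (y₀ i : ℂ) with hδ
  rw [hasSum_hbar_iff]
  intro K
  have hsupp : (Function.support fun c => PowerSeries.coeff K (divPow δ c *
      multiDeriv h y₀ (c + content b))) ⊆ ((finite_degree_le (d := d) K).toFinset :
        Set (Fin d →₀ ℕ)) := by
    intro c hc
    rw [Set.Finite.coe_toFinset]
    by_contra hK
    apply hc
    have h1 : PowerSeries.X ^ (K + 1) ∣ divPow δ c * multiDeriv h y₀ (c + content b) :=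
      Dvd.dvd.mul_right ((pow_dvd_pow _ (Nat.succ_le_of_lt (not_le.1 hK))).trans
        (dvd_divPow hφ c)) _
    exact PowerSeries.X_pow_dvd_iff.1 h1 K (Nat.lt_succ_self K)
  refine ⟨(Set.toFinite _).subset hsupp, ?_⟩
  rw [finsum_eq_sum_of_support_subset _ hsupp, partialDerivAt, PowerSeries.coeff_mk, map_sum,
    ← sum_fiberwise_of_maps_to (s := (finite_degree_le (d := d) K).toFinset)
      (t := range (K + 1)) (g := Finsupp.degree) (fun c hc => by
        rw [Set.Finite.mem_toFinset] at hc
        exact mem_range.2 (Nat.lt_succ_of_le hc))]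
  refine sum_congr rfl fun j hj => ?_
  have hfil : (finite_degree_le (d := d) K).toFinset.filter (fun c => c.degree = j) =
      ofDegree d j := by
    ext c
    rw [mem_filter, Set.Finite.mem_toFinset, mem_ofDegree]
    exact ⟨fun h => h.2, fun h => ⟨show c.degree ≤ K from h ▸ Nat.lt_succ_iff.1 (mem_range.1 hj), h⟩⟩
  rw [hfil, ← map_sum]
  congr 1
  let f : (Fin d →₀ ℕ) → PowerSeries ℂ := fun c =>
    ((j.factorial : ℂ)⁻¹ * multiFactorial c) • (divPow δ c * multiDeriv h y₀ (c + content b))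
  have h1 : ∀ a : Fin j → Fin d, PowerSeries.C ((j.factorial : ℂ)⁻¹) * (∏ i, δ (a i)) *
      (PowerSeries.mk fun k => partialDeriv (h k) (j + l) (Fin.append a b) y₀) =
      f (content a) := by
    intro a
    dsimp only [f]
    rw [← multiDeriv_content hV hh hy, content_append, prod_eq_divPow, ← PowerSeries.smul_eq_C_mul,
      smul_smul, smul_mul_assoc]
  refine (sum_congr rfl fun a _ => h1 a).trans ((sum_words j f).trans ?_)
  refine sum_congr rfl fun c _ => ?_
  dsimp only [f]
  rw [smul_smul]
  have h2 : (j.factorial : ℂ) ≠ 0 := Nat.cast_ne_zero.2 j.factorial_ne_zero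
  have h3 := multiFactorial_ne_zero c
  field_simp
  rw [one_smul]

theorem pointDeriv_content (hV : IsOpen V) (hh : ∀ k, ContDiffOn ℝ ∞ (h k) V) (hy : y₀ ∈ V)
    (hφ : ∀ i, PowerSeries.X ∣ φ i - PowerSeries.C (y₀ i : ℂ)) {l : ℕ} (b : Fin l → Fin d) :
    pointDeriv h y₀ φ (content b) = partialDerivAt h y₀ φ l b :=
  (hasSum_partialDerivAt hV hh hy hφ b).tsum_eq

theorem exists_content (b : Fin d →₀ ℕ) : ∃ (l : ℕ) (a : Fin l → Fin d), content a = b := by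
  refine ⟨b.degree, ?_⟩
  have h := card_words_mul b rfl
  have h0 : (univ.filter fun a : Fin b.degree → Fin d => content a = b).card ≠ 0 := by
    intro h0
    rw [h0, Nat.cast_zero, zero_mul] at h
    exact Nat.cast_ne_zero.2 b.degree.factorial_ne_zero h.symm
  obtain ⟨a, ha⟩ := card_ne_zero.1 h0
  exact ⟨a, (mem_filter.1 ha).2⟩

theorem hasSum_pointDeriv (hV : IsOpen V) (hh : ∀ k, ContDiffOn ℝ ∞ (h k) V) (hy : y₀ ∈ V)
    (hφ : ∀ i, PowerSeries.X ∣ φ i - PowerSeries.C (y₀ i : ℂ)) (b : Fin d →₀ ℕ) :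
    HasSum (fun c => divPow (fun i => φ i - PowerSeries.C (y₀ i : ℂ)) c *
      multiDeriv h y₀ (c + b)) (pointDeriv h y₀ φ b) := by
  obtain ⟨l, a, rfl⟩ := exists_content b
  rw [pointDeriv_content hV hh hy hφ]
  exact hasSum_partialDerivAt hV hh hy hφ a

theorem content_finSigma {n : ℕ} {m : Fin n → ℕ} (e : ∀ w, Fin (m w) → Fin d) :
    content (fun j : Fin (∑ w, m w) => e (finSigmaFinEquiv.symm j).1 (finSigmaFinEquiv.symm j).2) =
      ∑ w, content (e w) := by
  refine (Equiv.sum_comp finSigmaFinEquiv.symm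
    fun x : (Σ w, Fin (m w)) => Finsupp.single (e x.1 x.2) 1).trans ?_
  rw [Fintype.sum_sigma]
  rfl

/-- The contraction of a graph as a sum over the tables of its edges. -/
theorem contraction_eq (hV : IsOpen V) (hy : y₀ ∈ V) (γ : BipartiteGraph)
    {S : (l : ℕ) → (Fin l → Fin d) → PowerSeries ℂ} (hS : IsSymmetric S)
    (hφ : ∀ i, PowerSeries.X ∣ shift S y₀ i) {h : Fin γ.white → ℕ → (Fin d → ℝ) → ℂ}
    (hh : ∀ w k, ContDiffOn ℝ ∞ (h w k) V) :
    γ.contraction S y₀ h = ∑ N ∈ tablesOf d γ.mult, (∏ v, ∏ w, (multiFactorial (N v w))⁻¹) •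
      ((∏ v, multiFactorial (∑ w, N v w) •
          MvPowerSeries.coeff (∑ w, N v w) (tensorSeries S)) *
        ∏ w, pointDeriv (h w) y₀ (fun i => S 1 fun _ => i) (∑ v, N v w)) := by
  classical
  let f : (Fin γ.black → Fin γ.white → Fin d →₀ ℕ) → PowerSeries ℂ := fun N =>
    (∏ v, ∏ w, ((γ.mult v w).factorial : ℂ)⁻¹) •
      ((∏ v, multiFactorial (∑ w, N v w) •
          MvPowerSeries.coeff (∑ w, N v w) (tensorSeries S)) *
        ∏ w, pointDeriv (h w) y₀ (fun i => S 1 fun _ => i) (∑ v, N v w))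
  have h1 : ∀ e : γ.Labelling d, (∏ v, PowerSeries.C
        (((γ.blackDegree v).factorial : ℂ) / ∏ w, ((γ.mult v w).factorial : ℂ)) *
      S (γ.blackDegree v) (BipartiteGraph.atBlack e v)) *
    ∏ w, partialDerivAt (h w) y₀ (fun i => S 1 fun _ => i) (γ.whiteDegree w)
      (BipartiteGraph.atWhite e w) = f fun v w => content (e v w) := by
    intro e
    have hb : ∀ v, content (BipartiteGraph.atBlack e v) = ∑ w, content (e v w) := fun v =>
      content_finSigma (e v)
    have hw : ∀ w, content (BipartiteGraph.atWhite e w) = ∑ v, content (e v w) := fun w =>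
      content_finSigma fun v => e v w
    dsimp only [f]
    rw [← smul_mul_assoc, ← prod_smul]
    congr 1
    · refine prod_congr rfl fun v _ => ?_
      rw [← hb, hS.coeff, smul_smul, ← PowerSeries.smul_eq_C_mul]
      congr 1
      rw [prod_inv_distrib, div_eq_mul_inv, mul_comm]
    · refine prod_congr rfl fun w _ => ?_
      rw [← hw, pointDeriv_content hV (hh w) hy hφ]
  -- The number of labellings contributes `∏ mult!/N!`, whose numerators cancel the factorials of
  -- the parallel edges in the contraction and leave the weight `∏ 1/N!` of Wick's formula.
  refine (sum_congr rfl fun e _ => h1 e).trans ((sum_labellings γ.mult f).trans ?_)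
  refine sum_congr rfl fun N _ => ?_
  dsimp only [f]
  rw [smul_smul, ← prod_mul_distrib]
  congr 1
  refine prod_congr rfl fun v _ => ?_
  rw [← prod_mul_distrib]
  refine prod_congr rfl fun w _ => ?_
  have h2 : ((γ.mult v w).factorial : ℂ) ≠ 0 := Nat.cast_ne_zero.2 (Nat.factorial_ne_zero _)
  field_simp

end Contraction

/-! ### The factors of the white vertices -/

section WhiteVertices

variable {τ : Type} {n : ℕ}

theorem hasSum_rename (ρ : Fin n ↪ τ) {ι : Type*} {f : ι → MvPowerSeries (Fin n) (PowerSeries ℂ)}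
    {v : MvPowerSeries (Fin n) (PowerSeries ℂ)} (h : HasSum f v) :
    HasSum (fun i => MvPowerSeries.rename ρ (f i)) (MvPowerSeries.rename ρ v) := by
  refine hasSum_series_map h
    ((MvPowerSeries.rename (R := PowerSeries ℂ) ρ) : _ →ₐ[_] _).toRingHom.toAddMonoidHom fun s => ?_
  by_cases hs : s ∈ Set.range (Finsupp.embDomain ρ)
  · obtain ⟨s', rfl⟩ := hs
    exact ⟨1, s', fun x => by rw [one_mul]; exact MvPowerSeries.coeff_embDomain_rename ρ x s'⟩
  · refine ⟨0, 0, fun x => ?_⟩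
    rw [zero_mul]
    refine MvPowerSeries.coeff_rename_eq_zero _ _ ?_
    rintro ⟨s', rfl⟩
    exact hs ⟨s', Finsupp.embDomain_eq_mapDomain ρ s'⟩

theorem hasSum_tensorSeries {ι : Type*} {f : ι → (l : ℕ) → (Fin l → Fin n) → PowerSeries ℂ}
    {v : (l : ℕ) → (Fin l → Fin n) → PowerSeries ℂ} (h : ∀ l a, HasSum (fun i => f i l a) (v l a)) :
    HasSum (fun i => tensorSeries (f i)) (tensorSeries v) := by
  rw [hasSum_series_iff_coeff]
  exact fun s => hasSum_sum fun a _ => h _ a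

/-- The homogeneous part of order `l` of a formal series, with the variables renamed. -/
noncomputable def wordSum (ρ : Fin n ↪ τ) (T : (l : ℕ) → (Fin l → Fin n) → PowerSeries ℂ) (l : ℕ) :
    MvPowerSeries τ (PowerSeries ℂ) :=
  ∑ a : Fin l → Fin n, (∏ j, MvPowerSeries.X (ρ (a j))) * MvPowerSeries.C (T l a)

theorem hasSum_wordSum (ρ : Fin n ↪ τ) (T : (l : ℕ) → (Fin l → Fin n) → PowerSeries ℂ) :
    HasSum (wordSum ρ T) (MvPowerSeries.rename ρ (tensorSeries T)) := by
  classical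
  have h1 : wordSum ρ T = fun l => MvPowerSeries.rename ρ
      (∑ a : Fin l → Fin n, MvPowerSeries.monomial (content a) (T l a)) := by
    ext1 l
    rw [wordSum, map_sum]
    refine sum_congr rfl fun a _ => ?_
    have h2 : (MvPowerSeries.monomial (content a) (T l a) : MvPowerSeries (Fin n) (PowerSeries ℂ)) =
        (∏ j, MvPowerSeries.X (a j)) * MvPowerSeries.C (T l a) := by
      rw [prod_X_eq_monomial, ← MvPowerSeries.monomial_zero_eq_C_apply,
        MvPowerSeries.monomial_mul_monomial, add_zero, one_mul]
      rfl
    rw [h2, map_mul, map_prod, MvPowerSeries.rename_C]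
    simp only [MvPowerSeries.rename_X]
  rw [h1]
  refine hasSum_rename ρ ?_
  rw [hasSum_series_iff_coeff]
  intro s
  have h2 : ∀ l, MvPowerSeries.coeff s (∑ a : Fin l → Fin n,
      (MvPowerSeries.monomial (content a) (T l a) : MvPowerSeries (Fin n) (PowerSeries ℂ))) =
      ∑ a ∈ univ.filter fun a : Fin l → Fin n => content a = s, T l a := by
    intro l
    rw [map_sum, sum_filter]
    refine sum_congr rfl fun a _ => ?_
    rw [MvPowerSeries.coeff_monomial]
    exact if_congr eq_comm rfl rfl
  simp only [h2]
  rw [coeff_tensorSeries T rfl]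
  refine hasSum_single s.degree fun l hl => ?_
  rw [filter_eq_empty_iff.2, sum_empty]
  intro a _ ha
  exact hl (by rw [← ha, degree_content])

variable {d : ℕ} {V : Set (Fin d → ℝ)} (G : GeneratingFunction d n V)
  (c : MvPowerSeries τ (PowerSeries ℂ)) (ρ : Fin n ↪ τ) (y₀ : Fin d → ℝ)
  (S : (l : ℕ) → (Fin l → Fin d) → PowerSeries ℂ)

/-- The interaction term `c G_ħ(y₀ + η, r)`. -/
noncomputable def interaction : MvPowerSeries (Fin d ⊕ τ) (PowerSeries ℂ) :=
  MvPowerSeries.rename Function.Embedding.inr c *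
    MvPowerSeries.rename ((Function.Embedding.refl _).sumMap ρ) (G.jointSeries y₀)

/-- The factor of a white vertex of any weight. -/
noncomputable def compWhite (b : Fin d →₀ ℕ) : MvPowerSeries τ (PowerSeries ℂ) :=
  c * MvPowerSeries.rename ρ (tensorSeries fun l a =>
    pointDeriv (G.coeff l a) y₀ (fun i => S 1 fun _ => i) b)

/-- The factor of a white vertex of weight `l`. -/
noncomputable def whiteTerm (l : ℕ) (b : Fin d →₀ ℕ) : MvPowerSeries τ (PowerSeries ℂ) :=
  c * wordSum ρ (fun l a => pointDeriv (G.coeff l a) y₀ (fun i => S 1 fun _ => i) b) l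

theorem hasSum_whiteTerm (b : Fin d →₀ ℕ) :
    HasSum (fun l => whiteTerm G c ρ y₀ S l b) (compWhite G c ρ y₀ S b) :=
  (hasSum_wordSum _ _).mul_left c

theorem curryS_rename_inr {σ : Type} (f : MvPowerSeries τ (PowerSeries ℂ)) :
    curryS (MvPowerSeries.rename (Function.Embedding.inr : τ ↪ σ ⊕ τ) f) = MvPowerSeries.C f := by
  classical
  ext1 b
  ext1 s
  rw [coeff_coeff_curryS, MvPowerSeries.coeff_C]
  have h := coeff_rename_inl_mul_rename_inr (1 : MvPowerSeries σ (PowerSeries ℂ)) f b s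
  rw [map_one, one_mul, MvPowerSeries.coeff_one] at h
  rw [h]
  split_ifs
  · rw [one_mul]
  · rw [zero_mul, map_zero]

theorem sumElim_embDomain (b : Fin d →₀ ℕ) (s : Fin n →₀ ℕ) :
    Finsupp.sumElim b (Finsupp.embDomain ρ s) =
      Finsupp.embDomain ((Function.Embedding.refl _).sumMap ρ) (Finsupp.sumElim b s) := by
  ext x
  rcases x with i | x
  · have h : Sum.inl i = ((Function.Embedding.refl _).sumMap ρ) (Sum.inl i : Fin d ⊕ Fin n) := rfl
    rw [h, Finsupp.embDomain_apply_self]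
    rfl
  · by_cases hx : x ∈ Set.range ρ
    · obtain ⟨j, rfl⟩ := hx
      have h : Sum.inr (ρ j) = ((Function.Embedding.refl _).sumMap ρ) (Sum.inr j : Fin d ⊕ Fin n) := rfl
      rw [Finsupp.sumElim_inr, Finsupp.embDomain_apply_self, h, Finsupp.embDomain_apply_self]
      rfl
    · rw [Finsupp.sumElim_inr, Finsupp.embDomain_of_notMem_range _ _ _ hx,
        Finsupp.embDomain_of_notMem_range]
      rintro ⟨i | j, h⟩
      · simp at h
      · exact hx ⟨j, Sum.inr_injective h⟩

theorem coeff_curryS_interaction (b : Fin d →₀ ℕ) :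
    MvPowerSeries.coeff b (curryS (interaction G c ρ y₀)) =
      c * MvPowerSeries.rename ρ (tensorSeries fun l a =>
        MvPowerSeries.coeff b (taylorSeries (G.coeff l a) y₀)) := by
  rw [interaction, map_mul, curryS_rename_inr, MvPowerSeries.coeff_C_mul]
  congr 1
  ext1 s
  rw [coeff_coeff_curryS]
  by_cases hs : ∃ s', s = Finsupp.embDomain ρ s'
  · obtain ⟨s', rfl⟩ := hs
    have h : Finsupp.sumElim b (Finsupp.embDomain ρ s') =
        Finsupp.embDomain ((Function.Embedding.refl _).sumMap ρ) (Finsupp.sumElim b s') :=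
      sumElim_embDomain ρ b s'
    rw [h, MvPowerSeries.coeff_embDomain_rename, MvPowerSeries.coeff_embDomain_rename]
    have h2 : Finsupp.sumFinsuppEquivProdFinsupp (Finsupp.sumElim b s') = (b, s') :=
      Finsupp.sumFinsuppEquivProdFinsupp.right_inv (b, s')
    change (∑ a ∈ words (Finsupp.sumFinsuppEquivProdFinsupp (Finsupp.sumElim b s')).2,
      MvPowerSeries.coeff (Finsupp.sumFinsuppEquivProdFinsupp (Finsupp.sumElim b s')).1
        (taylorSeries (G.coeff _ a) y₀)) = _
    rw [h2]
    rfl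
  · rw [MvPowerSeries.coeff_rename_eq_zero, MvPowerSeries.coeff_rename_eq_zero]
    · rintro ⟨s', h⟩
      exact hs ⟨s', by rw [← h, Finsupp.embDomain_eq_mapDomain]⟩
    · rintro ⟨m, h⟩
      apply hs
      refine ⟨(Finsupp.sumFinsuppEquivProdFinsupp m).2, ?_⟩
      rw [← Finsupp.embDomain_eq_mapDomain, ← Finsupp.sumFinsuppEquivProdFinsupp.left_inv m] at h
      have h2 := (sumElim_embDomain ρ (Finsupp.sumFinsuppEquivProdFinsupp m).1
        (Finsupp.sumFinsuppEquivProdFinsupp m).2).trans h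
      have h3 := congrArg (fun m => (Finsupp.sumFinsuppEquivProdFinsupp m).2) h2
      have h4 : ∀ b (s : τ →₀ ℕ), (Finsupp.sumFinsuppEquivProdFinsupp
        (Finsupp.sumElim (b : Fin d →₀ ℕ) s)).2 = s := fun b s =>
          congrArg Prod.snd (Finsupp.sumFinsuppEquivProdFinsupp.right_inv (b, s))
      rw [h4, h4] at h3
      exact h3.symm

theorem C_mul_eq_smul (a : ℂ) (f : MvPowerSeries τ (PowerSeries ℂ)) :
    MvPowerSeries.C (PowerSeries.C a) * f = a • f := by
  ext1 s
  rw [MvPowerSeries.coeff_C_mul, coeff_complex_smul, PowerSeries.smul_eq_C_mul]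

/-- The Taylor expansion at `φ₀` in powers of `φ_ħ - φ₀`, applied to every coefficient of `G` at
once. -/
theorem hasSum_compWhite {G : GeneratingFunction d n V} (hV : IsOpen V) {y₀ : Fin d → ℝ} (hy : y₀ ∈ V)
    {S : (l : ℕ) → (Fin l → Fin d) → PowerSeries ℂ}
    (hφ : ∀ i, PowerSeries.X ∣ shift S y₀ i) (b : Fin d →₀ ℕ) :
    HasSum (fun a => MvPowerSeries.C (divPow (shift S y₀) a) *
      (multiFactorial (a + b) • MvPowerSeries.coeff (a + b) (curryS (interaction G c ρ y₀))))
      (compWhite G c ρ y₀ S b) := by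
  have h := (hasSum_rename ρ (hasSum_tensorSeries (n := n) fun l a =>
    hasSum_pointDeriv hV (G.smooth l a) hy hφ b)).mul_left c
  have e : (fun a => c * MvPowerSeries.rename ρ (tensorSeries fun l w =>
      divPow (shift S y₀) a * multiDeriv (G.coeff l w) y₀ (a + b))) =
      fun a => MvPowerSeries.C (divPow (shift S y₀) a) *
      (multiFactorial (a + b) • MvPowerSeries.coeff (a + b) (curryS (interaction G c ρ y₀))) := by
    ext1 a
    have h1 : (tensorSeries fun l w => divPow (shift S y₀) a * multiDeriv (G.coeff l w) y₀ (a + b)) =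
        MvPowerSeries.C (divPow (shift S y₀) a * PowerSeries.C (multiFactorial (a + b))) *
          tensorSeries fun l w => MvPowerSeries.coeff (a + b) (taylorSeries (G.coeff l w) y₀) := by
      ext1 s
      rw [MvPowerSeries.coeff_C_mul, coeff_tensorSeries _ rfl, coeff_tensorSeries _ rfl, mul_sum]
      refine sum_congr rfl fun w _ => ?_
      rw [multiDeriv, PowerSeries.smul_eq_C_mul, mul_assoc]
    rw [h1, map_mul, MvPowerSeries.rename_C, coeff_curryS_interaction, ← smul_mul_assoc,
      ← C_mul_eq_smul, map_mul]
    ring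
  rw [← e]
  exact h

/-- Attaching all possible black leaves moves the point of evaluation from `φ₀` to `φ_ħ`. The
rescaling factor depends only on the parameters and not on the number of leaves, so it can be taken
out of the sum. -/
theorem coeff_leafSum_interaction (hV : IsOpen V) (hy : y₀ ∈ V)
    (hφ : ∀ i, PowerSeries.X ∣ shift S y₀ i) (b : Fin d →₀ ℕ) (s : τ →₀ ℕ) :
    MvPowerSeries.coeff s (leafSum (shift S y₀) (whiteFactor (interaction G c ρ y₀)) b) =
      hbarI ^ (s.degree - 1) * MvPowerSeries.coeff s (compWhite G c ρ y₀ S b) := by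
  have h1 := hasSum_series_iff_coeff.1 (hasSum_leafSum hφ (whiteFactor (interaction G c ρ y₀)) b) s
  have h2 := (hasSum_series_iff_coeff.1 (hasSum_compWhite c ρ (G := G) hV hy hφ b) s).mul_left
    (hbarI ^ (s.degree - 1))
  refine h1.unique ?_
  have e : (fun a => hbarI ^ (s.degree - 1) * MvPowerSeries.coeff s
      (MvPowerSeries.C (divPow (shift S y₀) a) *
      (multiFactorial (a + b) • MvPowerSeries.coeff (a + b) (curryS (interaction G c ρ y₀))))) =
      fun a => MvPowerSeries.coeff s
        (leafFactor (shift S y₀) (whiteFactor (interaction G c ρ y₀)) a b) := by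
    ext1 a
    rw [leafFactor, MvPowerSeries.coeff_C_mul, MvPowerSeries.coeff_C_mul, whiteFactor,
      coeff_complex_smul, coeff_complex_smul, coeff_scaledCoeff, coeff_coeff_curryS,
      mul_left_comm, mul_smul_comm]
  rw [← e]
  exact h2

theorem multiDeriv_eq_zero (hV : IsOpen V) (hy : y₀ ∈ V) {h : ℕ → (Fin d → ℝ) → ℂ}
    (h0 : ∀ k, ∀ y ∈ V, h k y = 0) (m : Fin d →₀ ℕ) : multiDeriv h y₀ m = 0 := by
  obtain ⟨l, a, rfl⟩ := exists_content m
  rw [multiDeriv_content hV (fun k => contDiffOn_const.congr (h0 k)) hy]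
  ext k
  rw [PowerSeries.coeff_mk, map_zero, partialDeriv]
  have h1 : h k =ᶠ[nhds y₀] fun _ => 0 := Filter.eventuallyEq_of_mem (hV.mem_nhds hy) (h0 k)
  rw [Filter.EventuallyEq.eq_of_nhds (h1.iteratedFDeriv ℝ l)]
  simp

/-- The interaction has no terms without parameters. -/
def IsFormal : Prop :=
  MvPowerSeries.constantCoeff c = 0 ∨ ∀ a k, ∀ y ∈ V, G.coeff 0 a k y = 0

variable {G c}

theorem IsFormal.constantCoeff_mul (h : IsFormal G c)
    {T : (l : ℕ) → (Fin l → Fin n) → PowerSeries ℂ}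
    (hT : ∀ a, (∀ k, ∀ y ∈ V, G.coeff 0 a k y = 0) → T 0 a = 0) :
    MvPowerSeries.constantCoeff (c * MvPowerSeries.rename ρ (tensorSeries T)) = 0 := by
  rw [map_mul, MvPowerSeries.constantCoeff_rename]
  rcases h with h | h
  · rw [h, zero_mul]
  · rw [← MvPowerSeries.coeff_zero_eq_constantCoeff_apply (φ := tensorSeries T),
      coeff_tensorSeries_zero T Fin.elim0, hT _ fun k => h _ k, mul_zero]

theorem IsFormal.coeff_interaction (h : IsFormal G c) (hV : IsOpen V) (hy : y₀ ∈ V)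
    (b : Fin d →₀ ℕ) :
    MvPowerSeries.coeff (Finsupp.sumElim b 0) (interaction G c ρ y₀) = 0 := by
  rw [← coeff_coeff_curryS, coeff_curryS_interaction]
  refine h.constantCoeff_mul ρ fun a ha => ?_
  have := multiDeriv_eq_zero y₀ hV hy ha b
  rwa [multiDeriv, smul_eq_zero_iff_right (multiFactorial_ne_zero b)] at this

theorem IsFormal.pointDeriv_eq_zero (hV : IsOpen V) (hy : y₀ ∈ V) {h : ℕ → (Fin d → ℝ) → ℂ}
    (h0 : ∀ k, ∀ y ∈ V, h k y = 0) (φ : Fin d → PowerSeries ℂ) (b : Fin d →₀ ℕ) :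
    pointDeriv h y₀ φ b = 0 := by
  rw [pointDeriv]
  simp only [multiDeriv_eq_zero y₀ hV hy h0, mul_zero]
  exact tsum_zero

theorem IsFormal.constantCoeff_compWhite (h : IsFormal G c) (hV : IsOpen V) (hy : y₀ ∈ V)
    (b : Fin d →₀ ℕ) : MvPowerSeries.constantCoeff (compWhite G c ρ y₀ S b) = 0 :=
  h.constantCoeff_mul ρ fun _ ha => IsFormal.pointDeriv_eq_zero y₀ hV hy ha _ b

/-- A white vertex of weight `l` contributes terms of order at least `l`. -/
theorem coeff_wordSum_eq_zero (T : (l : ℕ) → (Fin l → Fin n) → PowerSeries ℂ) {l : ℕ} {s : τ →₀ ℕ}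
    (hs : s.degree < l) : MvPowerSeries.coeff s (wordSum ρ T l) = 0 := by
  classical
  rw [wordSum, map_sum]
  refine sum_eq_zero fun a _ => ?_
  rw [MvPowerSeries.coeff_mul_C, coeff_prod_eq_zero univ (fun j _ => MvPowerSeries.constantCoeff_X _)
    (by rwa [card_univ, Fintype.card_fin]), zero_mul]

end WhiteVertices

/-! ### Connectedness, trees and edge counts -/

section Connectivity

variable {d : ℕ}

theorem skeleton_adj (γ : BipartiteGraph) (v : Fin γ.black) (w : Fin γ.white) :
    γ.skeleton.Adj (Sum.inl v) (Sum.inr w) ↔ 0 < γ.mult v w := by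
  rw [BipartiteGraph.skeleton, SimpleGraph.fromRel_adj]
  constructor
  · rintro ⟨_, ⟨v', w', h1, h2, h⟩ | ⟨v', w', h1, h2, h⟩⟩
    · rwa [Sum.inl.inj h1, Sum.inr.inj h2]
    · simp at h1
  · intro h
    exact ⟨by simp, Or.inl ⟨v, w, rfl, rfl, h⟩⟩

theorem exists_of_skeleton_adj {γ : BipartiteGraph} {x y : Fin γ.black ⊕ Fin γ.white}
    (h : γ.skeleton.Adj x y) : ∃ v w, 0 < γ.mult v w ∧
      ((x = Sum.inl v ∧ y = Sum.inr w) ∨ (y = Sum.inl v ∧ x = Sum.inr w)) := by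
  rw [BipartiteGraph.skeleton, SimpleGraph.fromRel_adj] at h
  obtain ⟨_, ⟨v, w, h1, h2, h⟩ | ⟨v, w, h1, h2, h⟩⟩ := h
  · exact ⟨v, w, h, Or.inl ⟨h1, h2⟩⟩
  · exact ⟨v, w, h, Or.inr ⟨h1, h2⟩⟩

/-- Reachable sets are closed, and closed sets are preserved along walks. Nonemptiness is separate
because `IsConn` holds vacuously for the empty graph. -/
theorem connected_iff_isConn {γ : BipartiteGraph} {N : Fin γ.black → Fin γ.white → Fin d →₀ ℕ}
    (hN : ∀ v w, (N v w).degree = γ.mult v w) :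
    γ.skeleton.Connected ↔ Nonempty (Fin γ.black ⊕ Fin γ.white) ∧ IsConn N := by
  have hpos : ∀ v w, N v w ≠ 0 ↔ 0 < γ.mult v w := fun v w => by
    rw [← hN, Nat.pos_iff_ne_zero, Ne, Ne, Finsupp.degree_eq_zero_iff]
  constructor
  · intro h
    refine ⟨h.nonempty, fun D hD hne => ?_⟩
    obtain ⟨u, hu⟩ := hne
    rw [Set.eq_univ_iff_forall]
    intro v
    obtain ⟨p⟩ := h.preconnected u v
    induction p with
    | nil => exact hu
    | cons hadj _ ih =>
      apply ih
      obtain ⟨v', w', h', ⟨rfl, rfl⟩ | ⟨rfl, rfl⟩⟩ := exists_of_skeleton_adj hadj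
      · exact (hD v' w' ((hpos _ _).2 h')).1 hu
      · exact (hD v' w' ((hpos _ _).2 h')).2 hu
  · rintro ⟨hne, h⟩
    rw [SimpleGraph.connected_iff]
    refine ⟨fun u v => ?_, hne⟩
    have hD : IsClosedIn N {v | γ.skeleton.Reachable u v} := fun v w hvw => by
      have hadj := (skeleton_adj γ v w).2 ((hpos v w).1 hvw)
      exact ⟨fun h => h.trans hadj.reachable, fun h => h.trans hadj.symm.reachable⟩
    have := h _ hD ⟨u, SimpleGraph.Reachable.refl u⟩
    exact (Set.ext_iff.1 this v).2 trivial

/-- The number of edges of the underlying simple graph. -/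
theorem card_edgeSet_skeleton (γ : BipartiteGraph) :
    Nat.card γ.skeleton.edgeSet = ∑ v, ∑ w, if 0 < γ.mult v w then 1 else 0 := by
  classical
  have e : γ.skeleton.edgeSet = (fun p : Fin γ.black × Fin γ.white =>
      (s(Sum.inl p.1, Sum.inr p.2) : Sym2 (Fin γ.black ⊕ Fin γ.white))) ''
        {p | 0 < γ.mult p.1 p.2} := by
    ext z
    induction z using Sym2.ind with
    | _ x y =>
      rw [SimpleGraph.mem_edgeSet]
      constructor
      · intro h
        obtain ⟨v, w, hp, ⟨rfl, rfl⟩ | ⟨rfl, rfl⟩⟩ := exists_of_skeleton_adj h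
        · exact ⟨(v, w), hp, rfl⟩
        · exact ⟨(v, w), hp, Sym2.eq_swap⟩
      · rintro ⟨⟨v, w⟩, hp, h⟩
        rw [← SimpleGraph.mem_edgeSet, ← h, SimpleGraph.mem_edgeSet]
        exact (skeleton_adj γ v w).2 hp
  have hinj : Function.Injective (fun p : Fin γ.black × Fin γ.white =>
      (s(Sum.inl p.1, Sum.inr p.2) : Sym2 (Fin γ.black ⊕ Fin γ.white))) := by
    rintro ⟨v, w⟩ ⟨v', w'⟩ h
    simpa using h
  rw [e, Nat.card_image_of_injective hinj, ← Fintype.sum_prod_type', ← card_filter,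
    Nat.card_eq_fintype_card, Fintype.card_subtype]
  rfl

theorem card_edgeSet_le (γ : BipartiteGraph) :
    Nat.card γ.skeleton.edgeSet ≤ ∑ v, ∑ w, γ.mult v w := by
  rw [card_edgeSet_skeleton]
  refine sum_le_sum fun v _ => sum_le_sum fun w _ => ?_
  split_ifs <;> omega

theorem card_vertices (γ : BipartiteGraph) :
    Nat.card (Fin γ.black ⊕ Fin γ.white) = γ.black + γ.white := by
  simp

theorem vertices_le_of_connected {γ : BipartiteGraph} (h : γ.skeleton.Connected) :
    γ.black + γ.white ≤ (∑ v, ∑ w, γ.mult v w) + 1 := by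
  have h1 := h.card_vert_le_card_edgeSet_add_one
  rw [card_vertices] at h1
  have := card_edgeSet_le γ
  omega

/-- For a connected graph, the number of vertices is at most the number of simple edges plus one,
hence at most `|E| + 1`. Zero loops force equality throughout, so the skeleton is a tree and there
are no parallel edges. The subtraction in `loops` is truncated, so zero by itself gives only one
inequality. -/
theorem isWhiteLeavedTree_iff (γ : BipartiteGraph) :
    γ.IsWhiteLeavedTree ↔ γ.IsConnectedWhiteLeaved ∧ γ.loops = 0 := by
  rw [BipartiteGraph.IsWhiteLeavedTree, BipartiteGraph.IsConnectedWhiteLeaved,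
    and_right_comm (a := γ.skeleton.Connected)]
  refine and_congr_left fun _ => ?_
  rw [SimpleGraph.isTree_iff_connected_and_card, card_vertices, BipartiteGraph.loops]
  have h2 := card_edgeSet_skeleton γ
  have h3 := card_edgeSet_le γ
  constructor
  · rintro ⟨hm, hc, h1⟩
    refine ⟨hc, ?_⟩
    have : ∑ v, ∑ w, γ.mult v w = Nat.card γ.skeleton.edgeSet := by
      rw [h2]
      refine sum_congr rfl fun v _ => sum_congr rfl fun w _ => ?_
      have := hm v w
      split_ifs <;> omega
    omega
  · rintro ⟨hc, h0⟩
    have h1 := hc.card_vert_le_card_edgeSet_add_one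
    rw [card_vertices] at h1
    have h4 : Nat.card γ.skeleton.edgeSet = ∑ v, ∑ w, γ.mult v w := by omega
    refine ⟨fun v w => ?_, hc, by omega⟩
    have hle : ∀ v w, (if 0 < γ.mult v w then 1 else 0) ≤ γ.mult v w := fun v w => by
      split_ifs <;> omega
    rw [h2] at h4
    have h5 := (sum_eq_sum_iff_of_le fun v _ => sum_le_sum fun w _ => hle v w).1 h4 v (mem_univ v)
    have h6 := (sum_eq_sum_iff_of_le fun w _ => hle v w).1 h5 w (mem_univ w)
    split_ifs at h6 <;> omega

theorem blackDegree_pos {γ : BipartiteGraph} (h : γ.skeleton.Connected) (w : Fin γ.white)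
    (v : Fin γ.black) : 0 < γ.blackDegree v := by
  obtain ⟨p⟩ := h.preconnected (Sum.inl v) (Sum.inr w)
  cases p with
  | cons hadj _ =>
    obtain ⟨v', w', hp, ⟨h1, _⟩ | ⟨_, h1⟩⟩ := exists_of_skeleton_adj hadj
    · rw [Sum.inl.inj h1]
      exact hp.trans_le (single_le_sum (f := fun w => γ.mult v' w) (fun _ _ => Nat.zero_le _)
        (mem_univ w'))
    · simp at h1

theorem black_eq_one {γ : BipartiteGraph} (h : γ.skeleton.Connected) (hw : γ.white = 0) :
    γ.black = 1 := by
  have h1 := vertices_le_of_connected h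
  have h2 := h.nonempty
  have : IsEmpty (Fin γ.white) := by rw [hw]; infer_instance
  have h3 : ∑ v, ∑ w, γ.mult v w = 0 := by simp
  have h4 : Nat.card (Fin γ.black ⊕ Fin γ.white) ≠ 0 := Nat.card_pos.ne'
  rw [card_vertices] at h4
  omega

/-- With this bound, `b = |E| - B - W + 1` is at least `B - W + 1`, so the loop number and the
number of white vertices control the number of black ones. -/
theorem two_mul_black_le {γ : BipartiteGraph} (h : γ.IsConnectedWhiteLeaved) (w : Fin γ.white) :
    2 * γ.black ≤ ∑ v, ∑ w, γ.mult v w := by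
  have h1 : ∀ v, 2 ≤ ∑ w, γ.mult v w := fun v => by
    have h2 := blackDegree_pos h.1 w v
    have h3 := h.2 v
    simp only [BipartiteGraph.blackDegree] at h2 h3
    omega
  calc 2 * γ.black = ∑ _v : Fin γ.black, 2 := by simp [mul_comm]
    _ ≤ _ := sum_le_sum fun v _ => h1 v

end Connectivity

/-! ### The contribution of a weighted graph, and bounds on the graphs that contribute -/

section Values

variable {τ : Type} {n d : ℕ} {V : Set (Fin d → ℝ)} (G : GeneratingFunction d n V)
  (c : MvPowerSeries τ (PowerSeries ℂ)) (ρ : Fin n ↪ τ) (y₀ : Fin d → ℝ)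
  (S : (l : ℕ) → (Fin l → Fin d) → PowerSeries ℂ)

theorem hasSum_fibers {τ ι κ : Type} {F : κ → Type} {f : ι → MvPowerSeries τ (PowerSeries ℂ)}
    {v : MvPowerSeries τ (PowerSeries ℂ)} {T : κ → MvPowerSeries τ (PowerSeries ℂ)} (g : ι → κ)
    (j : ∀ k, F k → ι) (hj : ∀ k, Function.Injective (j k)) (hg : ∀ k x, g (j k x) = k)
    (hs : ∀ i, ∃ x, j (g i) x = i) (hf : HasSum f v)
    (h : ∀ k, HasSum (fun x => f (j k x)) (T k)) : HasSum T v := by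
  classical
  refine hasSum_fiber g hf fun k => ?_
  rw [← (hj k).hasSum_iff]
  · simpa [Function.comp_def, hg] using h k
  · intro i hi
    refine if_neg fun hk => hi ?_
    obtain ⟨x, hx⟩ := hs i
    subst hk
    exact ⟨x, hx⟩

/-- The factor of a black vertex. -/
noncomputable def blackTerm (a : Fin d →₀ ℕ) : PowerSeries ℂ :=
  multiFactorial a • MvPowerSeries.coeff a (tensorSeries S)

/-- The contribution of a table of edges, in a weighted graph. -/
noncomputable def tableValue {B W : ℕ} (ℓ : Fin W → ℕ) (N : Fin B → Fin W → Fin d →₀ ℕ) :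
    MvPowerSeries τ (PowerSeries ℂ) :=
  graphWeight (blackTerm S) (fun w b => whiteTerm G c ρ y₀ S (ℓ w) b) N

/-- The contribution of a weighted graph, without the symmetry factor. -/
noncomputable def value (γ : WeightedBipartiteGraph) : MvPowerSeries τ (PowerSeries ℂ) :=
  MvPowerSeries.C (hbarI ^ γ.loops) *
    ∑ N ∈ tablesOf d γ.mult, tableValue G c ρ y₀ S γ.weight N

theorem edgeFactor_prod {X Y : Type} [Fintype X] [Fintype Y] (N : X → Y → Fin d →₀ ℕ) :
    ∏ x, ∏ y, edgeFactor τ (N x y) = (∏ x, ∏ y, (multiFactorial (N x y))⁻¹) • 1 := by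
  simp only [edgeFactor, prod_smul, prod_const_one]

theorem graphWeight_eq {X Y : Type} [Fintype X] [Fintype Y] (β : (Fin d →₀ ℕ) → PowerSeries ℂ)
    (wh : Y → (Fin d →₀ ℕ) → MvPowerSeries τ (PowerSeries ℂ)) (N : X → Y → Fin d →₀ ℕ) :
    graphWeight β wh N = (∏ x, ∏ y, (multiFactorial (N x y))⁻¹) •
      (MvPowerSeries.C (∏ x, β (∑ y, N x y)) * ∏ y, wh y (∑ x, N x y)) := by
  rw [graphWeight, tableWeight, edgeFactor_prod, mul_smul_comm, mul_one, map_prod]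

theorem compositionTerm_eq {d₁ : ℕ} {U : Set (Fin d₁ → ℝ)} (F : GeneratingFunction d₁ d U)
    {x : Fin d₁ → ℝ} (hx : x ∈ U) (hV : IsOpen V) (hy : y₀ ∈ V)
    (hφ : ∀ i, PowerSeries.X ∣ shift (F.at x) y₀ i) (γ : WeightedBipartiteGraph) :
    compositionTerm F G c ρ x y₀ γ = ((γ.symCard : ℂ)⁻¹) • value G c ρ y₀ (F.at x) γ := by
  have hS : IsSymmetric (F.at x) := fun l a σ => by
    ext k
    rw [GeneratingFunction.at, GeneratingFunction.at, PowerSeries.coeff_mk, PowerSeries.coeff_mk]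
    exact F.symm l a k σ x hx
  have h1 : ∀ N : Fin γ.black → Fin γ.white → Fin d →₀ ℕ,
      tableValue G c ρ y₀ (F.at x) γ.weight N = c ^ γ.white *
        ∑ a : (∀ w, Fin (γ.weight w) → Fin n), (∏ w, ∏ j, MvPowerSeries.X (ρ (a w j))) *
          MvPowerSeries.C ((∏ v, ∏ w, (multiFactorial (N v w))⁻¹) •
            ((∏ v, multiFactorial (∑ w, N v w) •
              MvPowerSeries.coeff (∑ w, N v w) (tensorSeries (F.at x))) *
            ∏ w, pointDeriv (G.coeff (γ.weight w) (a w)) y₀ (fun i => F.at x 1 fun _ => i)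
              (∑ v, N v w))) := by
    intro N
    rw [tableValue, graphWeight_eq]
    simp only [whiteTerm, wordSum, prod_mul_distrib, prod_const, card_univ, Fintype.card_fin]
    rw [prod_univ_sum, Fintype.piFinset_univ, mul_left_comm, mul_sum, ← mul_smul_comm,
      smul_sum]
    congr 1
    refine sum_congr rfl fun a _ => ?_
    rw [C_complex_smul, map_mul, mul_smul_comm]
    congr 1
    simp only [prod_mul_distrib, map_prod, blackTerm]
    ring
  rw [compositionTerm, value, sum_congr rfl fun N _ => h1 N, ← mul_sum, sum_comm]
  have h2 : (MvPowerSeries.C (loopFactor γ.symCard γ.loops) : MvPowerSeries τ (PowerSeries ℂ)) =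
      ((γ.symCard : ℂ)⁻¹) • MvPowerSeries.C (hbarI ^ γ.loops) := by
    rw [← C_complex_smul, loopFactor, PowerSeries.smul_eq_C_mul]
    rfl
  rw [h2, mul_smul_comm, smul_mul_assoc, mul_comm (c ^ γ.white), mul_assoc]
  congr 3
  refine sum_congr rfl fun a _ => ?_
  rw [contraction_eq hV hy _ hS hφ (fun w k => G.smooth _ _ k), map_sum, mul_sum]

variable {G c}

theorem IsFormal.constantCoeff_whiteTerm (h : IsFormal G c) (hV : IsOpen V) (hy : y₀ ∈ V) (l : ℕ)
    (b : Fin d →₀ ℕ) : MvPowerSeries.constantCoeff (whiteTerm G c ρ y₀ S l b) = 0 := by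
  rw [whiteTerm, map_mul]
  rcases h with h | h
  · rw [h, zero_mul]
  · rw [← MvPowerSeries.coeff_zero_eq_constantCoeff_apply (φ := wordSum _ _ _)]
    cases l with
    | zero =>
      have h0 : wordSum ρ (fun l a => pointDeriv (G.coeff l a) y₀ (fun i => S 1 fun _ => i) b) 0 = 0 := by
        rw [wordSum]
        refine sum_eq_zero fun a _ => ?_
        rw [IsFormal.pointDeriv_eq_zero y₀ hV hy (h a), map_zero, mul_zero]
      rw [h0, map_zero, mul_zero]
    | succ l => rw [coeff_wordSum_eq_zero _ _ (by simp), mul_zero]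

theorem coeff_mul_eq_zero_of_order {σ R : Type} [CommRing R] {f : MvPowerSeries σ R} {l : ℕ}
    (hf : ∀ s : σ →₀ ℕ, s.degree < l → MvPowerSeries.coeff s f = 0) (g : MvPowerSeries σ R)
    {s : σ →₀ ℕ} (hs : s.degree < l) : MvPowerSeries.coeff s (f * g) = 0 := by
  classical
  rw [MvPowerSeries.coeff_mul]
  refine sum_eq_zero fun p hp => ?_
  rw [hf, zero_mul]
  have := congrArg Finsupp.degree (HasAntidiagonal.mem_antidiagonal.1 hp)
  rw [map_add] at this
  omega

theorem weight_le_of_coeff_ne_zero {B W : ℕ} {ℓ : Fin W → ℕ} {N : Fin B → Fin W → Fin d →₀ ℕ}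
    {s : τ →₀ ℕ} (h : MvPowerSeries.coeff s (tableValue G c ρ y₀ S ℓ N) ≠ 0) (w : Fin W) :
    ℓ w ≤ s.degree := by
  by_contra hlt
  apply h
  obtain ⟨g, hg⟩ : wordSum ρ (fun l a => pointDeriv (G.coeff l a) y₀ (fun i => S 1 fun _ => i)
      (∑ x, N x w)) (ℓ w) ∣ tableValue G c ρ y₀ S ℓ N := by
    rw [tableValue, graphWeight_eq]
    refine dvd_smul_of_dvd _ (Dvd.dvd.mul_left (Dvd.dvd.trans (Dvd.intro_left _ rfl)
      (dvd_prod_of_mem (fun w => whiteTerm G c ρ y₀ S (ℓ w) (∑ x, N x w)) (mem_univ w))) _)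
  rw [hg]
  exact coeff_mul_eq_zero_of_order (fun s hs => coeff_wordSum_eq_zero ρ _ hs) _ (not_le.1 hlt)

/-- The weighted graph underlying a table of edges. -/
noncomputable def tableGraph {B W : ℕ} (ℓ : Fin W → ℕ) (N : Fin B → Fin W → Fin d →₀ ℕ) :
    WeightedBipartiteGraph := ⟨⟨B, W, fun v w => (N v w).degree⟩, ℓ⟩

/-- All numbers that describe a graph are at most `m`. -/
def IsBounded (m : ℕ) (γ : WeightedBipartiteGraph) : Prop :=
  γ.black ≤ m ∧ γ.white ≤ m ∧ (∀ v w, γ.mult v w ≤ m) ∧ ∀ w, γ.weight w ≤ m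

/-- The order in `ħ` bounds the loops by `k`, and the degree in the parameters bounds `W` and each
weight by `|s|`. If `W > 0`, then `2B ≤ |E| ≤ k + B + W - 1` yields `B ≤ k + W - 1` and `|E| ≤ 2k +
2W - 2`. The summand 1 in the bound allows for the single black vertex. -/
theorem isBounded_of_coeff_ne_zero (hc : IsFormal G c) (hV : IsOpen V) (hy : y₀ ∈ V)
    {γ : WeightedBipartiteGraph} (hγ : γ.IsConnectedWhiteLeaved)
    {N : Fin γ.black → Fin γ.white → Fin d →₀ ℕ} {s : τ →₀ ℕ} {k : ℕ}
    (h : PowerSeries.coeff k (MvPowerSeries.coeff s (MvPowerSeries.C (hbarI ^ γ.loops) *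
      tableValue G c ρ y₀ S γ.weight N)) ≠ 0) : IsBounded (2 * k + 2 * s.degree + 1) γ := by
  have h1 : MvPowerSeries.coeff s (tableValue G c ρ y₀ S γ.weight N) ≠ 0 := fun h0 => by
    rw [MvPowerSeries.coeff_C_mul, h0, mul_zero, map_zero] at h
    exact h rfl
  have h2 := graphWeight_white_bound
    (fun w b => hc.constantCoeff_whiteTerm ρ y₀ S hV hy (γ.weight w) b) N h1
  rw [Fintype.card_fin] at h2
  have h3 := weight_le_of_coeff_ne_zero ρ y₀ S h1
  have h4 : γ.loops ≤ k := by
    by_contra hk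
    exact h (coeff_coeff_C_mul_eq_zero ((pow_dvd_pow _ (Nat.succ_le_of_lt (not_le.1 hk))).trans
      (pow_dvd_pow_of_dvd X_dvd_hbarI _)) _ _)
  rw [BipartiteGraph.loops] at h4
  have h5 : ∀ v w, γ.mult v w ≤ ∑ v, ∑ w, γ.mult v w := fun v w =>
    (single_le_sum (f := fun w => γ.mult v w) (fun _ _ => Nat.zero_le _) (mem_univ w)).trans
      (single_le_sum (f := fun v => ∑ w, γ.mult v w) (fun _ _ => Nat.zero_le _) (mem_univ v))
  have h6 : γ.black ≤ 2 * k + 2 * s.degree + 1 ∧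
      ∀ v w, γ.mult v w ≤ 2 * k + 2 * s.degree + 1 := by
    by_cases hW : γ.white = 0
    · have := black_eq_one hγ.1 hW
      refine ⟨by omega, fun v w => ?_⟩
      have := w.2
      omega
    · have h7 := two_mul_black_le hγ ⟨0, Nat.pos_of_ne_zero hW⟩
      refine ⟨by omega, fun v w => ?_⟩
      have := h5 v w
      omega
  exact ⟨h6.1, by omega, h6.2, fun w => (h3 w).trans (by omega)⟩

end Values

/-! ### Multiplicativity of the rescaling of the parameters -/

section Scaling

variable {τ : Type}

/-- `x_s = (ħ/i)^{|s| - k} y_s`. -/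
def IsScaled (k : ℕ) (x y : MvPowerSeries τ (PowerSeries ℂ)) : Prop :=
  ∀ s, hbarI ^ k * MvPowerSeries.coeff s x = hbarI ^ s.degree * MvPowerSeries.coeff s y

theorem IsScaled.mul {k k' : ℕ} {x y x' y' : MvPowerSeries τ (PowerSeries ℂ)} (h : IsScaled k x y)
    (h' : IsScaled k' x' y') : IsScaled (k + k') (x * x') (y * y') := by
  classical
  intro s
  rw [MvPowerSeries.coeff_mul, MvPowerSeries.coeff_mul, mul_sum, mul_sum]
  refine sum_congr rfl fun p hp => ?_
  rw [← HasAntidiagonal.mem_antidiagonal.1 hp, map_add, pow_add, pow_add, mul_mul_mul_comm, h, h']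
  ring

theorem IsScaled.one : IsScaled 0 (1 : MvPowerSeries τ (PowerSeries ℂ)) 1 := by
  classical
  intro s
  rw [MvPowerSeries.coeff_one]
  split_ifs with h
  · rw [h, map_zero]
  · rw [mul_zero, mul_zero]

theorem IsScaled.prod {W : ℕ} {x y : Fin W → MvPowerSeries τ (PowerSeries ℂ)}
    (h : ∀ w, IsScaled 1 (x w) (y w)) : IsScaled W (∏ w, x w) (∏ w, y w) := by
  induction W with
  | zero =>
    rw [Fin.prod_univ_zero, Fin.prod_univ_zero]
    exact IsScaled.one
  | succ W ih =>
    have h1 := (h 0).mul (ih fun w => h w.succ)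
    rwa [← Fin.prod_univ_succ, ← Fin.prod_univ_succ, Nat.add_comm 1 W] at h1

theorem isScaled_one_iff {x y : MvPowerSeries τ (PowerSeries ℂ)}
    (hx : MvPowerSeries.constantCoeff x = 0) (hy : MvPowerSeries.constantCoeff y = 0)
    (h : ∀ s ≠ 0, MvPowerSeries.coeff s x = hbarI ^ (s.degree - 1) * MvPowerSeries.coeff s y) :
    IsScaled 1 x y := by
  intro s
  by_cases hs : s = 0
  · rw [hs, MvPowerSeries.coeff_zero_eq_constantCoeff_apply,
      MvPowerSeries.coeff_zero_eq_constantCoeff_apply, hx, hy, mul_zero, mul_zero]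
  · have h1 : s.degree ≠ 0 := fun h => hs ((Finsupp.degree_eq_zero_iff s).1 h)
    obtain ⟨k, hk⟩ := Nat.exists_eq_succ_of_ne_zero h1
    rw [h s hs, hk, Nat.succ_sub_one, pow_one, pow_succ]
    ring

end Scaling

/-! ### Power counting: the loop number as exponent of `ħ/i` -/

section FreeEnergy

variable {τ : Type} {n d : ℕ} {V : Set (Fin d → ℝ)} {G : GeneratingFunction d n V}
  {c : MvPowerSeries τ (PowerSeries ℂ)} (ρ : Fin n ↪ τ) {y₀ : Fin d → ℝ}
  {S : (l : ℕ) → (Fin l → Fin d) → PowerSeries ℂ}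

theorem isScaled_leafSum (hc : IsFormal G c) (hV : IsOpen V) (hy : y₀ ∈ V)
    (hφ : ∀ i, PowerSeries.X ∣ shift S y₀ i) (b : Fin d →₀ ℕ) :
    IsScaled 1 (leafSum (shift S y₀) (whiteFactor (interaction G c ρ y₀)) b)
      (compWhite G c ρ y₀ S b) :=
  isScaled_one_iff (constantCoeff_leafSum hφ
    (constantCoeff_whiteFactor fun b => hc.coeff_interaction ρ y₀ hV hy b) b)
    (hc.constantCoeff_compWhite ρ y₀ S hV hy b)
    fun s _ => coeff_leafSum_interaction G c ρ y₀ S hV hy hφ b s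

theorem hbarI_pow_mul_blackFactor {a : Fin d →₀ ℕ} (ha : 2 ≤ a.degree) :
    hbarI * blackFactor S a = hbarI ^ a.degree * blackTerm S a := by
  obtain ⟨k, hk⟩ := Nat.exists_eq_add_of_le ha
  rw [blackFactor, if_neg (by omega), blackTerm, mul_smul_comm, mul_smul_comm, ← mul_assoc,
    ← pow_succ', hk]
  congr 3
  omega

open Classical in
/-- The contribution of a table of edges, if it is connected and white-leaved. -/
noncomputable def connValue (G : GeneratingFunction d n V) (c : MvPowerSeries τ (PowerSeries ℂ))
    (ρ : Fin n ↪ τ) (y₀ : Fin d → ℝ) (S : (l : ℕ) → (Fin l → Fin d) → PowerSeries ℂ) {B W : ℕ}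
    (N : Fin B → Fin W → Fin d →₀ ℕ) : MvPowerSeries τ (PowerSeries ℂ) :=
  if (tableGraph 0 N).IsConnectedWhiteLeaved then
    MvPowerSeries.C (hbarI ^ (tableGraph 0 N).loops) *
      graphWeight (blackTerm S) (fun _ => compWhite G c ρ y₀ S) N else 0

theorem coeff_graphWeight_empty (β : (Fin d →₀ ℕ) → PowerSeries ℂ) {B : ℕ}
    (wh : Fin 0 → (Fin d →₀ ℕ) → MvPowerSeries τ (PowerSeries ℂ)) (N : Fin B → Fin 0 → Fin d →₀ ℕ)
    {s : τ →₀ ℕ} (hs : s ≠ 0) : MvPowerSeries.coeff s (graphWeight β wh N) = 0 := by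
  classical
  rw [graphWeight_eq, coeff_complex_smul, Fin.prod_univ_zero, mul_one, MvPowerSeries.coeff_C, if_neg hs,
    smul_zero]

-- The rescaled black vertices contribute `(ħ/i)^(|E| - B)` and the rescaled white vertices
-- `(ħ/i)^(|s| - W)`. As `|E| - B + |s| - W = (|s| - 1) + b`, removing the factor of the logarithm
-- leaves `(ħ/i)^b`. This identity holds for each table separately.
open Classical in
theorem hbarI_pow_mul_coeff_connValue (hc : IsFormal G c) (hV : IsOpen V) (hy : y₀ ∈ V)
    (hφ : ∀ i, PowerSeries.X ∣ shift S y₀ i) {B W : ℕ} (N : Fin B → Fin W → Fin d →₀ ℕ)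
    {s : τ →₀ ℕ} (hs : s ≠ 0) :
    hbarI ^ (s.degree - 1) * MvPowerSeries.coeff s (connValue G c ρ y₀ S N) =
      MvPowerSeries.coeff s (if IsConn N then graphWeight (blackFactor S)
        (fun _ => leafSum (shift S y₀) (whiteFactor (interaction G c ρ y₀))) N else 0) := by
  cases W with
  -- A graph without white vertices has no parameters, so it does not contribute at `s ≠ 0`. The
  -- empty graph and the isolated black vertex, where the two notions of contribution differ, fall
  -- under this case.
  | zero =>
    have h1 := coeff_graphWeight_empty (blackTerm S) (fun _ => compWhite G c ρ y₀ S) N hs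
    have h2 := coeff_graphWeight_empty (blackFactor S)
      (fun _ => leafSum (shift S y₀) (whiteFactor (interaction G c ρ y₀))) N hs
    have h3 : MvPowerSeries.coeff s (connValue G c ρ y₀ S N) = 0 := by
      rw [connValue]
      split_ifs
      · rw [MvPowerSeries.coeff_C_mul, h1, mul_zero]
      · exact map_zero _
    rw [h3, mul_zero]
    split_ifs
    · exact h2.symm
    · exact (map_zero _).symm
  | succ W =>
    rw [connValue]
    have hconn : (tableGraph 0 N).skeleton.Connected ↔ IsConn N := by
      rw [connected_iff_isConn (N := N) fun v w => rfl]
      exact and_iff_right ⟨Sum.inr (0 : Fin (W + 1))⟩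
    by_cases hN : IsConn N
    · rw [if_pos hN]
      by_cases hl : (tableGraph 0 N).WhiteLeaved
      · have hcl : (tableGraph 0 N).IsConnectedWhiteLeaved := ⟨hconn.2 hN, hl⟩
        rw [if_pos hcl]
        have hdeg : ∀ v, (tableGraph 0 N).blackDegree v = (∑ w, N v w).degree := fun v =>
          (map_sum Finsupp.degree _ _).symm
        have h2 : ∀ v, 2 ≤ (∑ w, N v w).degree := fun v => by
          have h3 := (blackDegree_pos hcl.1 (0 : Fin (W + 1)) v).trans_eq (hdeg v)
          have h4 : (∑ w, N v w).degree ≠ 1 := fun h => hl v ((hdeg v).trans h)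
          omega
        have hE : ∑ v, (∑ w, N v w).degree = ∑ v, ∑ w, (tableGraph 0 N).mult v w :=
          sum_congr rfl fun v _ => (hdeg v).symm
        have hloops : (tableGraph 0 N).loops + (B + (W + 1)) = (∑ v, (∑ w, N v w).degree) + 1 := by
          have h5 : B + (W + 1) ≤ _ := vertices_le_of_connected hcl.1
          rw [hE, BipartiteGraph.loops]
          exact Nat.sub_add_cancel h5
        have hblack : hbarI ^ B * ∏ v, blackFactor S (∑ w, N v w) =
            hbarI ^ (∑ v, (∑ w, N v w).degree) * ∏ v, blackTerm S (∑ w, N v w) := by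
          rw [← prod_pow_eq_pow_sum, ← prod_mul_distrib,
            ← prod_congr rfl fun v _ => hbarI_pow_mul_blackFactor (h2 v), prod_mul_distrib,
            prod_const, card_univ, Fintype.card_fin]
        have hwhite := IsScaled.prod (fun w => isScaled_leafSum ρ hc hV hy hφ (∑ v, N v w)) s
        have hd : s.degree - 1 + 1 = s.degree := Nat.sub_add_cancel (Nat.one_le_iff_ne_zero.2
          fun h => hs ((Finsupp.degree_eq_zero_iff s).1 h))
        rw [graphWeight_eq, graphWeight_eq, MvPowerSeries.coeff_C_mul, coeff_complex_smul,
          coeff_complex_smul, mul_smul_comm, mul_smul_comm, MvPowerSeries.coeff_C_mul,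
          MvPowerSeries.coeff_C_mul]
        congr 1
        -- Multiplying by `(ħ/i)^(B + W)` clears all truncated subtractions from the exponents; the
        -- factor cancels because `ℂ[[ħ]]` is a domain.
        refine mul_left_cancel₀ (pow_ne_zero (B + (W + 1)) hbarI_ne_zero) ?_
        have e1 : hbarI ^ (B + (W + 1)) * (hbarI ^ (s.degree - 1) *
            (hbarI ^ (tableGraph 0 N).loops * ((∏ v, blackTerm S (∑ w, N v w)) *
              MvPowerSeries.coeff s (∏ w, compWhite G c ρ y₀ S (∑ v, N v w))))) =
            hbarI ^ (s.degree - 1) * hbarI ^ ((tableGraph 0 N).loops + (B + (W + 1))) *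
            ((∏ v, blackTerm S (∑ w, N v w)) *
              MvPowerSeries.coeff s (∏ w, compWhite G c ρ y₀ S (∑ v, N v w))) := by
          rw [pow_add _ (BipartiteGraph.loops _)]
          ring
        rw [e1, hloops, pow_succ, pow_add]
        calc _ = (hbarI ^ (∑ v, (∑ w, N v w).degree) * ∏ v, blackTerm S (∑ w, N v w)) *
              (hbarI ^ (s.degree - 1 + 1) *
                MvPowerSeries.coeff s (∏ w, compWhite G c ρ y₀ S (∑ v, N v w))) := by
              rw [pow_succ _ (s.degree - 1)]
              ring
          _ = _ := by
              rw [← hblack, hd, ← hwhite]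
              ring
      -- A black vertex of degree one has factor zero in `blackFactor`, since leaves have already
      -- been summed into the white vertices.
      · rw [if_neg fun h => hl h.2]
        have h3 : ∃ v, (∑ w, N v w).degree = 1 := by
          by_contra! h4
          exact hl fun v hv => h4 v ((map_sum Finsupp.degree _ _).trans hv)
        obtain ⟨v, hv⟩ := h3
        rw [graphWeight_eq, prod_eq_zero (f := fun v => blackFactor S (∑ w, N v w)) (mem_univ v)
          ((blackBound_blackFactor S).eq_zero _ (by omega))]
        simp
    · rw [if_neg hN, if_neg fun h => hN (hconn.1 h.1)]
      simp

end FreeEnergy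

/-! ### The effective action: one sum over decorated graphs, organised in two ways -/

section LabelledSums

variable {τ : Type} {n d : ℕ} {V : Set (Fin d → ℝ)} {G : GeneratingFunction d n V}
  {c : MvPowerSeries τ (PowerSeries ℂ)} (ρ : Fin n ↪ τ) {y₀ : Fin d → ℝ}
  {S : (l : ℕ) → (Fin l → Fin d) → PowerSeries ℂ}

/-- Labelled graphs, with an index on each edge and a weight on each white vertex. -/
abbrev Decorated (d : ℕ) : Type :=
  Σ p : ℕ × ℕ, (Fin p.1 → Fin p.2 → Fin d →₀ ℕ) × (Fin p.2 → ℕ)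

open Classical in
/-- The contribution of a decorated graph. -/
noncomputable def decoratedTerm (G : GeneratingFunction d n V)
    (c : MvPowerSeries τ (PowerSeries ℂ)) (ρ : Fin n ↪ τ) (y₀ : Fin d → ℝ)
    (S : (l : ℕ) → (Fin l → Fin d) → PowerSeries ℂ) (x : Decorated d) :
    MvPowerSeries τ (PowerSeries ℂ) :=
  if (tableGraph x.2.2 x.2.1).IsConnectedWhiteLeaved then
    labelFactor x.1 • (MvPowerSeries.C (hbarI ^ (tableGraph x.2.2 x.2.1).loops) *
      tableValue G c ρ y₀ S x.2.2 x.2.1) else 0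

theorem finite_decorated (m : ℕ) :
    {x : Decorated d | IsBounded m (tableGraph x.2.2 x.2.1)}.Finite := by
  have h := finite_sigma_tables
    (T := fun p => (Fin p.1 → Fin p.2 → Fin d →₀ ℕ) × (Fin p.2 → ℕ)) m m
    (S := fun p => {N | ∀ v w, (N v w).degree ≤ m} ×ˢ Set.Iic fun _ => m)
    fun p => Set.Finite.prod (Set.Finite.pi' fun _ => Set.Finite.pi' fun _ => finite_degree_le m)
      (Set.finite_Iic _)
  exact h.subset fun x hx => ⟨hx.1, hx.2.1, hx.2.2.1, hx.2.2.2⟩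

theorem isBounded_of_decoratedTerm (hc : IsFormal G c) (hV : IsOpen V) (hy : y₀ ∈ V)
    {s : τ →₀ ℕ} {k : ℕ} {x : Decorated d} (hx : PowerSeries.coeff k
      (MvPowerSeries.coeff s (decoratedTerm G c ρ y₀ S x)) ≠ 0) :
    IsBounded (2 * k + 2 * s.degree + 1) (tableGraph x.2.2 x.2.1) := by
  rw [decoratedTerm] at hx
  split_ifs at hx with h
  · refine isBounded_of_coeff_ne_zero (N := x.2.1) ρ y₀ S hc hV hy h fun h0 => hx ?_
    rw [coeff_complex_smul, PowerSeries.coeff_smul]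
    erw [h0]
    exact smul_zero _
  · exact absurd (by rw [map_zero, map_zero]) hx

theorem summable_decoratedTerm (hc : IsFormal G c) (hV : IsOpen V) (hy : y₀ ∈ V) :
    Summable (decoratedTerm G c ρ y₀ S) :=
  summable_series_iff.2 fun _ _ => (finite_decorated _).subset fun _ hx =>
    isBounded_of_decoratedTerm ρ hc hV hy hx

/-- The effective action. -/
noncomputable def effective (G : GeneratingFunction d n V)
    (c : MvPowerSeries τ (PowerSeries ℂ)) (ρ : Fin n ↪ τ) (y₀ : Fin d → ℝ)
    (S : (l : ℕ) → (Fin l → Fin d) → PowerSeries ℂ) : MvPowerSeries τ (PowerSeries ℂ) :=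
  ∑' x, decoratedTerm G c ρ y₀ S x

-- The edge indices are summed first. The fibre over a weighted graph consists of the tables whose
-- degrees are its edge multiplicities, which gives the graph contributions of the theorem.
open Classical in
theorem hasSum_effective (hc : IsFormal G c) (hV : IsOpen V) (hy : y₀ ∈ V) :
    HasSum (fun γ : WeightedBipartiteGraph => if γ.IsConnectedWhiteLeaved then
      labelFactor (γ.black, γ.white) • value G c ρ y₀ S γ else 0) (effective G c ρ y₀ S) := by
  have hmk : ∀ (γ : WeightedBipartiteGraph) (N : Fin γ.black → Fin γ.white → Fin d →₀ ℕ),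
      N ∈ tablesOf d γ.mult → tableGraph γ.weight N = γ := by
    rintro ⟨⟨B, W, mult⟩, ℓ⟩ N hN
    rw [mem_tablesOf] at hN
    have : (fun v w => (N v w).degree) = mult := funext fun v => funext fun w => hN v w
    exact congrArg (fun m => (⟨⟨B, W, m⟩, ℓ⟩ : WeightedBipartiteGraph)) this
  refine hasSum_fibers (F := fun γ : WeightedBipartiteGraph => {N // N ∈ tablesOf d γ.mult})
    (fun x : Decorated d => tableGraph x.2.2 x.2.1)
    (fun γ N => ⟨(γ.black, γ.white), N.1, γ.weight⟩) (fun γ N N' h => ?_) (fun γ N => hmk γ N.1 N.2)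
    (fun x => ⟨⟨x.2.1, mem_tablesOf.2 fun _ _ => rfl⟩, rfl⟩)
    (summable_decoratedTerm ρ hc hV hy (S := S)).hasSum fun γ => ?_
  · have h1 := eq_of_heq (Sigma.mk.inj h).2
    exact Subtype.ext (Prod.mk.inj h1).1
  · have h1 : ∀ N : {N // N ∈ tablesOf d γ.mult}, decoratedTerm G c ρ y₀ S
        ⟨(γ.black, γ.white), N.1, γ.weight⟩ = if γ.IsConnectedWhiteLeaved then
          labelFactor (γ.black, γ.white) • (MvPowerSeries.C (hbarI ^ γ.loops) *
            tableValue G c ρ y₀ S γ.weight N.1) else 0 := fun N => by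
      have h2 := hmk γ N.1 N.2
      rw [decoratedTerm]
      dsimp only
      rw [h2]
    simp only [h1]
    split_ifs with h
    · rw [value, mul_sum, smul_sum]
      exact Finset.hasSum (tablesOf d γ.mult) _
    · exact hasSum_zero

-- Here the weights are summed first, which combines the white factors of all weights into
-- `compWhite`. This form is the one comparable with the free energy.
open Classical in
theorem hasSum_connValue (hc : IsFormal G c) (hV : IsOpen V) (hy : y₀ ∈ V) :
    HasSum (fun x : Σ p : ℕ × ℕ, (Fin p.1 → Fin p.2 → Fin d →₀ ℕ) =>
      labelFactor x.1 • connValue G c ρ y₀ S x.2) (effective G c ρ y₀ S) := by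
  refine hasSum_fibers
    (F := fun y : Σ p : ℕ × ℕ, (Fin p.1 → Fin p.2 → Fin d →₀ ℕ) => Fin y.1.2 → ℕ)
    (fun x : Decorated d => ⟨x.1, x.2.1⟩)
    (fun y ℓ => ⟨y.1, y.2, ℓ⟩) (fun y ℓ ℓ' h => ?_) (fun y ℓ => rfl)
    (fun x => ⟨x.2.2, rfl⟩) (summable_decoratedTerm ρ hc hV hy (S := S)).hasSum fun y => ?_
  · have h1 := eq_of_heq (Sigma.mk.inj h).2
    exact (Prod.mk.inj h1).2
  · rw [connValue, smul_ite, smul_zero]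
    change HasSum (fun ℓ : Fin y.1.2 → ℕ => if (tableGraph 0 y.2).IsConnectedWhiteLeaved then
      labelFactor y.1 • (MvPowerSeries.C (hbarI ^ (tableGraph 0 y.2).loops) *
        tableValue G c ρ y₀ S ℓ y.2) else 0) _
    split_ifs with h
    · refine hasSum_series_smul (HasSum.mul_left _ ?_) _
      rw [graphWeight_eq]
      simp only [tableValue, graphWeight_eq]
      exact hasSum_series_smul ((hasSum_series_prod fun w => hasSum_whiteTerm G c ρ y₀ S _).mul_left
        _) _
    · exact hasSum_zero

theorem hbarI_pow_mul_coeff_effective (hc : IsFormal G c) (hV : IsOpen V) (hy : y₀ ∈ V)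
    (hφ : ∀ i, PowerSeries.X ∣ shift S y₀ i) {s : τ →₀ ℕ} (hs : s ≠ 0) :
    hbarI ^ (s.degree - 1) * MvPowerSeries.coeff s (effective G c ρ y₀ S) =
      MvPowerSeries.coeff s (freeEnergy (blackFactor S)
        (leafSum (shift S y₀) (whiteFactor (interaction G c ρ y₀)))) := by
  classical
  have h1 := (hasSum_series_iff_coeff.1 (hasSum_connValue ρ hc hV hy (S := S)) s).mul_left
    (hbarI ^ (s.degree - 1))
  have h2 := hasSum_series_iff_coeff.1 (hasSum_freeEnergy_labelled (blackBound_blackFactor S)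
    (constantCoeff_leafSum hφ (constantCoeff_whiteFactor
      fun b => hc.coeff_interaction ρ y₀ hV hy b))) s
  have h3 : ∀ x : Σ p : ℕ × ℕ, (Fin p.1 → Fin p.2 → Fin d →₀ ℕ), hbarI ^ (s.degree - 1) *
      MvPowerSeries.coeff s (labelFactor x.1 • connValue G c ρ y₀ S x.2) =
      MvPowerSeries.coeff s (if IsConn x.2 then labelFactor x.1 • graphWeight (blackFactor S)
        (fun _ => leafSum (shift S y₀) (whiteFactor (interaction G c ρ y₀))) x.2 else 0) := by
    intro x
    rw [coeff_complex_smul, mul_smul_comm, hbarI_pow_mul_coeff_connValue ρ hc hV hy hφ x.2 hs]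
    split_ifs
    · rw [coeff_complex_smul]
    · rw [map_zero, smul_zero]
  simp only [h3] at h1
  exact h1.unique h2

/-- The only connected graph without parameters is a single black vertex of degree 0, with value
`F⁰`. It supplies the constant term that the rescaled free energy does not see. -/
theorem constantCoeff_effective (hc : IsFormal G c) (hV : IsOpen V) (hy : y₀ ∈ V) :
    MvPowerSeries.constantCoeff (effective G c ρ y₀ S) =
      MvPowerSeries.constantCoeff (tensorSeries S) := by
  classical
  rw [← MvPowerSeries.coeff_zero_eq_constantCoeff_apply]
  refine (hasSum_series_iff_coeff.1 (hasSum_connValue ρ hc hV hy (S := S)) 0).unique ?_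
  have hone : ∀ N : Fin 1 → Fin 0 → Fin d →₀ ℕ, (tableGraph 0 N).IsConnectedWhiteLeaved := by
    refine fun N => ⟨(connected_iff_isConn (N := N) fun v w => rfl).2
      ⟨⟨Sum.inl (0 : Fin 1)⟩, fun D _ hne => ?_⟩, fun v => ?_⟩
    · obtain ⟨u, hu⟩ := hne
      refine Set.eq_univ_of_forall fun v => ?_
      have : Subsingleton (Fin 1 ⊕ Fin 0) := (Equiv.sumEmpty (Fin 1) (Fin 0)).subsingleton
      rwa [show v = u from Subsingleton.elim (α := Fin 1 ⊕ Fin 0) v u]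
    · exact (sum_empty).trans_ne zero_ne_one
  have h1 := hasSum_single (f := fun x : Σ p : ℕ × ℕ, (Fin p.1 → Fin p.2 → Fin d →₀ ℕ) =>
      MvPowerSeries.coeff 0 (labelFactor x.1 • connValue G c ρ y₀ S x.2))
      ⟨(1, 0), fun _ w => w.elim0⟩ ?_
  · convert h1
    rw [connValue, if_pos (hone _), coeff_complex_smul, MvPowerSeries.coeff_C_mul, graphWeight_eq,
      coeff_complex_smul]
    have hl : (tableGraph (0 : Fin 0 → ℕ) fun (_ : Fin 1) w => (w.elim0 : Fin d →₀ ℕ)).loops = 0 :=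
      rfl
    erw [hl]
    simp [labelFactor, blackTerm, multiFactorial]
  · rintro ⟨⟨B, W⟩, N⟩ hx
    dsimp only
    rw [coeff_complex_smul, connValue]
    split_ifs with h
    · by_cases hW : W = 0
      · subst hW
        have hB : B = 1 := black_eq_one h.1 rfl
        subst hB
        refine absurd ?_ hx
        congr
        ext v w
        exact w.elim0
      · have h2 : MvPowerSeries.coeff 0 (graphWeight (blackTerm S)
            (fun _ : Fin W => compWhite G c ρ y₀ S) N) = 0 := by
          by_contra h3
          have h4 := graphWeight_white_bound
            (fun _ b => hc.constantCoeff_compWhite ρ y₀ S hV hy b) N h3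
          rw [Fintype.card_fin, map_zero] at h4
          omega
        rw [MvPowerSeries.coeff_C_mul, h2, mul_zero, smul_zero]
    · rw [map_zero, smul_zero]

theorem hasFormalIntegral_effective_iff (hc : IsFormal G c) (hV : IsOpen V) (hy : y₀ ∈ V)
    (hφ : ∀ i, PowerSeries.X ∣ shift S y₀ i) (H : MvPowerSeries τ (PowerSeries ℂ)) :
    HasFormalIntegral (phase S y₀ (interaction G c ρ y₀)) (oscExp H) ↔
      H = effective G c ρ y₀ S :=
  hasFormalIntegral_oscExp_iff (fun b => hc.coeff_interaction ρ y₀ hV hy b) hφ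
    (constantCoeff_effective ρ hc hV hy)
    (fun _ hs => hbarI_pow_mul_coeff_effective ρ hc hV hy hφ hs) H

end LabelledSums

/-! ### From labelled graphs to isomorphism classes -/

section Isomorphisms

/-- Isomorphism invariant properties of graphs. -/
def IsInvariant (P : BipartiteGraph → Prop) : Prop := ∀ γ γ' : BipartiteGraph, γ ≈ γ' → P γ → P γ'

theorem loops_congr {γ γ' : BipartiteGraph} (h : γ ≈ γ') : γ.loops = γ'.loops := by
  obtain ⟨σ, τ, h⟩ := h
  have hB : γ.black = γ'.black := Fin.equiv_iff_eq.1 ⟨σ⟩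
  have hW : γ.white = γ'.white := Fin.equiv_iff_eq.1 ⟨τ⟩
  have hE : ∑ v, ∑ w, γ'.mult v w = ∑ v, ∑ w, γ.mult v w := by
    rw [← σ.sum_comp]
    refine sum_congr rfl fun v _ => ?_
    rw [← τ.sum_comp]
    exact sum_congr rfl fun w _ => h v w
  rw [BipartiteGraph.loops, BipartiteGraph.loops, hE]
  omega

theorem isInvariant_isConnectedWhiteLeaved : IsInvariant BipartiteGraph.IsConnectedWhiteLeaved := by
  rintro γ γ' ⟨σ, τ, h⟩ ⟨hc, hl⟩
  refine ⟨?_, fun v hv => hl (σ.symm v) ?_⟩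
  · have e : γ.skeleton ≃g γ'.skeleton := ⟨σ.sumCongr τ, by
      rintro (v | w) (v' | w')
      · refine iff_of_false (fun h => ?_) fun h => ?_ <;>
          obtain ⟨_, _, _, h' | h'⟩ := exists_of_skeleton_adj h <;> simp at h'
      · exact (skeleton_adj γ' (σ v) (τ w')).trans (by rw [h, skeleton_adj])
      · rw [SimpleGraph.adj_comm, SimpleGraph.adj_comm γ.skeleton]
        exact (skeleton_adj γ' (σ v') (τ w)).trans (by rw [h, skeleton_adj])
      · refine iff_of_false (fun h => ?_) fun h => ?_ <;>
          obtain ⟨_, _, _, h' | h'⟩ := exists_of_skeleton_adj h <;> simp at h'⟩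
    exact e.connected_iff.1 hc
  · rw [← hv, BipartiteGraph.blackDegree, BipartiteGraph.blackDegree, ← τ.sum_comp]
    refine sum_congr rfl fun w _ => ?_
    rw [← h, Equiv.apply_symm_apply]

theorem isInvariant_isWhiteLeavedTree : IsInvariant BipartiteGraph.IsWhiteLeavedTree := by
  intro γ γ' h
  rw [isWhiteLeavedTree_iff, isWhiteLeavedTree_iff, loops_congr h]
  exact fun hγ => ⟨isInvariant_isConnectedWhiteLeaved γ γ' h hγ.1, hγ.2⟩

/-- Orbit and stabiliser. Isomorphic graphs have the same vertex sets `Fin B` and `Fin W`, so the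
pairs of permutations act transitively on the graphs isomorphic to `γ`, with stabiliser the
automorphism group. -/
theorem card_isomorphic_mul_symCard (γ : WeightedBipartiteGraph) :
    Finite {γ' // γ' ≈ γ} ∧
      Nat.card {γ' // γ' ≈ γ} * γ.symCard = γ.black.factorial * γ.white.factorial := by
  let e : Equiv.Perm (Fin γ.black) × Equiv.Perm (Fin γ.white) → {γ' // γ' ≈ γ} := fun p =>
    ⟨⟨⟨γ.black, γ.white, fun v w => γ.mult (p.1 v) (p.2 w)⟩, fun w => γ.weight (p.2 w)⟩,
      p.1, p.2, fun _ _ => rfl, fun _ => rfl⟩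
  have he : Function.Surjective e := by
    rintro ⟨⟨⟨B, W, m⟩, ℓ⟩, σ, τ, h, h'⟩
    have hB : B = γ.black := Fin.equiv_iff_eq.1 ⟨σ⟩
    have hW : W = γ.white := Fin.equiv_iff_eq.1 ⟨τ⟩
    subst hB hW
    refine ⟨(σ, τ), Subtype.ext ?_⟩
    have h1 : (fun v w => γ.mult (σ v) (τ w)) = m := funext fun v => funext fun w => h v w
    have h2 : (fun w => γ.weight (τ w)) = ℓ := funext h'
    exact congrArg₂ (fun m ℓ => (⟨⟨γ.black, γ.white, m⟩, ℓ⟩ : WeightedBipartiteGraph)) h1 h2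
  have hfib : ∀ p q, e p = e q ↔ (∀ v w, γ.mult (p.1 v) (p.2 w) = γ.mult (q.1 v) (q.2 w)) ∧
      ∀ w, γ.weight (p.2 w) = γ.weight (q.2 w) := fun p q => by
    rw [Subtype.ext_iff]
    constructor
    · intro h
      injection h with h1 h2
      injection h1 with _ _ h1
      exact ⟨fun v w => congrFun (congrFun h1 v) w, fun w => congrFun h2 w⟩
    · rintro ⟨h1, h2⟩
      exact congrArg₂ (fun m ℓ => (⟨⟨γ.black, γ.white, m⟩, ℓ⟩ : WeightedBipartiteGraph))
        (funext fun v => funext fun w => h1 v w) (funext h2)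
  refine ⟨Finite.of_surjective e he, ?_⟩
  choose g hg using he
  -- Each fibre of `e` is a coset of the automorphism group; a chosen element of the fibre
  -- translates it to the group itself.
  let k : ∀ y, {p // e p = y} ≃ {p : Equiv.Perm (Fin γ.black) × Equiv.Perm (Fin γ.white) //
      (∀ b w, γ.mult (p.1 b) (p.2 w) = γ.mult b w) ∧ ∀ w, γ.weight (p.2 w) = γ.weight w} :=
    fun y => (Equiv.mulRight (g y)⁻¹).subtypeEquiv fun p => by
      rw [← hg y, hfib, hg]
      constructor
      · rintro ⟨h1, h2⟩
        exact ⟨fun v w => by simpa using h1 ((g y).1⁻¹ v) ((g y).2⁻¹ w),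
          fun w => by simpa using h2 ((g y).2⁻¹ w)⟩
      · rintro ⟨h1, h2⟩
        exact ⟨fun v w => by simpa using h1 ((g y).1 v) ((g y).2 w),
          fun w => by simpa using h2 ((g y).2 w)⟩
  have hcard := Nat.card_congr ((Equiv.sigmaFiberEquiv e).symm.trans
    ((Equiv.sigmaCongrRight k).trans (Equiv.sigmaEquivProd _ _)))
  rw [Nat.card_prod, Nat.card_prod, Nat.card_eq_fintype_card (α := Equiv.Perm (Fin γ.black)),
    Nat.card_eq_fintype_card (α := Equiv.Perm (Fin γ.white)), Fintype.card_perm, Fintype.card_perm,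
    Fintype.card_fin, Fintype.card_fin] at hcard
  exact hcard.symm

/-- A graph with the same weight on all white vertices. -/
def withWeight (l : ℕ) (γ : BipartiteGraph) : WeightedBipartiteGraph := ⟨γ, fun _ => l⟩

theorem withWeight_equiv_iff {l : ℕ} {γ γ' : BipartiteGraph} :
    withWeight l γ ≈ withWeight l γ' ↔ γ ≈ γ' :=
  ⟨fun ⟨σ, τ, h, _⟩ => ⟨σ, τ, h⟩, fun ⟨σ, τ, h⟩ => ⟨σ, τ, h, fun _ => rfl⟩⟩

theorem symCard_withWeight (l : ℕ) (γ : BipartiteGraph) : (withWeight l γ).symCard = γ.symCard :=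
  Nat.card_congr (Equiv.subtypeEquivRight fun _ => and_iff_left fun _ => rfl)

theorem card_isomorphic_mul_symCard' (γ : BipartiteGraph) :
    Finite {γ' // γ' ≈ γ} ∧
      Nat.card {γ' // γ' ≈ γ} * γ.symCard = γ.black.factorial * γ.white.factorial := by
  have e : {γ' // γ' ≈ γ} ≃ {γ' // γ' ≈ withWeight 0 γ} :=
    { toFun := fun x => ⟨withWeight 0 x.1, withWeight_equiv_iff.2 x.2⟩
      invFun := fun x => ⟨x.1.toBipartiteGraph, by
        obtain ⟨σ, τ, h, _⟩ := x.2
        exact ⟨σ, τ, h⟩⟩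
      left_inv := fun x => rfl
      right_inv := fun x => Subtype.ext (by
        obtain ⟨⟨γ', ℓ⟩, σ, τ, h, h'⟩ := x
        exact congrArg (WeightedBipartiteGraph.mk γ') (funext fun w => h' w)) }
  obtain ⟨h1, h2⟩ := card_isomorphic_mul_symCard (withWeight 0 γ)
  refine ⟨Finite.of_equiv _ e.symm, ?_⟩
  rw [Nat.card_congr e, ← symCard_withWeight 0, h2]
  rfl

/-- Summation over isomorphism classes, for an arbitrary equivalence relation. -/
theorem hasSum_quotient {τ ι : Type} (s : Setoid ι) (P : ι → Prop) [DecidablePred P]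
    (hP : ∀ i j, s.r i j → P i → P j) (a b : ι → ℂ) (hfin : ∀ i, Finite {j // s.r j i})
    (ha : ∀ i j, s.r i j → a i = a j) (hb : ∀ i, Nat.card {j // s.r j i} * a i = b i)
    {f : ι → MvPowerSeries τ (PowerSeries ℂ)} (hf : ∀ i j, s.r i j → f i = f j)
    {v : MvPowerSeries τ (PowerSeries ℂ)} (h : HasSum (fun i => if P i then a i • f i else 0) v) :
    HasSum (fun k : Quotient (s.comap (Subtype.val : {i // P i} → ι)) =>
      b k.out.val • f k.out.val) v := by
  have h1 : HasSum (fun i : {i // P i} => a i.1 • f i.1) v := by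
    refine (hasSum_subtype_iff_indicator (s := {i | P i}) (f := fun i => a i • f i)).2 ?_
    convert h using 2 with i
    rw [Set.indicator_apply]
    rfl
  refine hasSum_fibers (F := fun k : Quotient (s.comap (Subtype.val : {i // P i} → ι)) =>
      {j // s.r j k.out.val}) (fun i => Quotient.mk _ i)
    (fun k j => ⟨j.1, hP _ _ (s.symm' j.2) k.out.2⟩) (fun k j j' h => ?_) (fun k j => ?_)
    (fun i => ?_) h1 fun k => ?_
  · exact Subtype.ext (congrArg (fun i : {i // P i} => i.1) h)
  · conv_rhs => rw [← Quotient.out_eq k]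
    exact Quotient.sound j.2
  · exact ⟨⟨i.1, s.symm' (Quotient.mk_out (s := s.comap Subtype.val) i)⟩, rfl⟩
  · have := hfin k.out.val
    have := Fintype.ofFinite {j // s.r j k.out.val}
    have h2 : ∀ j : {j // s.r j k.out.val}, a j.1 • f j.1 = a k.out.val • f k.out.val :=
      fun j => by rw [ha _ _ j.2, hf _ _ j.2]
    simp only [h2]
    convert hasSum_fintype _
    rw [sum_const, card_univ, ← Nat.card_eq_fintype_card, ← hb, mul_smul, Nat.cast_smul_eq_nsmul]

/-- The labelled graphs in one class, each counted with `1/(B! W!)`, add up to `1/|sym(γ)|`. -/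
theorem card_mul_labelFactor {N B W m : ℕ} (h : N * m = B.factorial * W.factorial) :
    (N : ℂ) * labelFactor (B, W) = (m : ℂ)⁻¹ := by
  have h0 : ((B.factorial * W.factorial : ℕ) : ℂ) ≠ 0 :=
    Nat.cast_ne_zero.2 (Nat.mul_ne_zero (Nat.factorial_ne_zero _) (Nat.factorial_ne_zero _))
  have h1 : (m : ℂ) ≠ 0 := fun hm => h0 (by rw [← h, Nat.cast_mul, hm, mul_zero])
  rw [labelFactor, ← h, Nat.cast_mul, mul_inv, ← mul_assoc, mul_inv_cancel₀, one_mul]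
  exact fun hN => h0 (by rw [← h, Nat.cast_mul, hN, zero_mul])

theorem black_white_congr {γ γ' : BipartiteGraph} (h : γ ≈ γ') :
    labelFactor (γ.black, γ.white) = labelFactor (γ'.black, γ'.white) := by
  obtain ⟨σ, τ, _⟩ := h
  rw [Fin.equiv_iff_eq.1 ⟨σ⟩, Fin.equiv_iff_eq.1 ⟨τ⟩]

theorem equiv_of_weighted {γ γ' : WeightedBipartiteGraph} (h : γ ≈ γ') :
    γ.toBipartiteGraph ≈ γ'.toBipartiteGraph := by
  obtain ⟨σ, τ, h, _⟩ := h
  exact ⟨σ, τ, h⟩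

theorem hasSum_weightedClasses {σ : Type} {P : BipartiteGraph → Prop} [DecidablePred P]
    (hP : IsInvariant P)
    {f : WeightedBipartiteGraph → MvPowerSeries σ (PowerSeries ℂ)}
    (hf : ∀ γ γ', γ ≈ γ' → f γ = f γ') {v : MvPowerSeries σ (PowerSeries ℂ)}
    (h : HasSum (fun γ : WeightedBipartiteGraph => if P γ.toBipartiteGraph then
      labelFactor (γ.black, γ.white) • f γ else 0) v) :
    HasSum (fun k : WeightedBipartiteGraph.Classes P => ((k.rep.symCard : ℂ)⁻¹) • f k.rep) v :=
  hasSum_quotient WeightedBipartiteGraph.isoSetoid (fun γ => P γ.toBipartiteGraph)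
    (fun _ _ h => hP _ _ (equiv_of_weighted h)) (fun γ => labelFactor (γ.black, γ.white))
    (fun γ => (γ.symCard : ℂ)⁻¹) (fun γ => (card_isomorphic_mul_symCard γ).1)
    (fun _ _ h => black_white_congr (equiv_of_weighted h))
    (fun γ => card_mul_labelFactor (card_isomorphic_mul_symCard γ).2) hf h

theorem hasSum_classes {σ : Type} {P : BipartiteGraph → Prop} [DecidablePred P]
    (hP : IsInvariant P) {f : BipartiteGraph → MvPowerSeries σ (PowerSeries ℂ)}
    (hf : ∀ γ γ', γ ≈ γ' → f γ = f γ') {v : MvPowerSeries σ (PowerSeries ℂ)}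
    (h : HasSum (fun γ : BipartiteGraph => if P γ then
      labelFactor (γ.black, γ.white) • f γ else 0) v) :
    HasSum (fun k : BipartiteGraph.Classes P => ((k.rep.symCard : ℂ)⁻¹) • f k.rep) v :=
  hasSum_quotient BipartiteGraph.isoSetoid P hP (fun γ => labelFactor (γ.black, γ.white))
    (fun γ => (γ.symCard : ℂ)⁻¹) (fun γ => (card_isomorphic_mul_symCard' γ).1)
    (fun _ _ h => black_white_congr h)
    (fun γ => card_mul_labelFactor (card_isomorphic_mul_symCard' γ).2) hf h

/-- If only graphs with all weights equal to `l` contribute, weights can be dropped. -/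
theorem hasSum_withWeight {σ : Type} {P : BipartiteGraph → Prop} [DecidablePred P] (l : ℕ)
    {f : WeightedBipartiteGraph → MvPowerSeries σ (PowerSeries ℂ)}
    (hf : ∀ γ w, γ.weight w ≠ l → f γ = 0) {v : MvPowerSeries σ (PowerSeries ℂ)}
    (h : HasSum (fun γ : WeightedBipartiteGraph => if P γ.toBipartiteGraph then
      labelFactor (γ.black, γ.white) • f γ else 0) v) :
    HasSum (fun γ : BipartiteGraph => if P γ then
      labelFactor (γ.black, γ.white) • f (withWeight l γ) else 0) v := by
  refine (Function.Injective.hasSum_iff (g := withWeight l) (fun γ γ' h => ?_) ?_).2 h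
  · exact congrArg WeightedBipartiteGraph.toBipartiteGraph h
  · rintro ⟨γ, ℓ⟩ hγ
    have : ∃ w, ℓ w ≠ l := by
      by_contra! h1
      exact hγ ⟨γ, congrArg (WeightedBipartiteGraph.mk γ) (funext fun w => (h1 w).symm)⟩
    obtain ⟨w, hw⟩ := this
    rw [hf ⟨γ, ℓ⟩ w hw, smul_zero, ite_self]

variable {τ : Type} {n d : ℕ} {V : Set (Fin d → ℝ)} (G : GeneratingFunction d n V)
  (c : MvPowerSeries τ (PowerSeries ℂ)) (ρ : Fin n ↪ τ) (y₀ : Fin d → ℝ)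
  (S : (l : ℕ) → (Fin l → Fin d) → PowerSeries ℂ)

theorem value_congr {γ γ' : WeightedBipartiteGraph} (h : γ ≈ γ') :
    value G c ρ y₀ S γ = value G c ρ y₀ S γ' := by
  rw [value, value, loops_congr (equiv_of_weighted h)]
  obtain ⟨σ, τ, h, h'⟩ := h
  congr 1
  refine (sum_nbij' (fun N v w => N (σ v) (τ w)) (fun N v w => N (σ.symm v) (τ.symm w))
    (fun N hN => ?_) (fun N hN => ?_) (fun N _ => ?_) (fun N _ => ?_) fun N _ => ?_).symm
  · rw [mem_tablesOf] at hN ⊢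
    exact fun v w => (hN _ _).trans (h v w)
  · rw [mem_tablesOf] at hN ⊢
    exact fun v w => (hN _ _).trans (by rw [← h, Equiv.apply_symm_apply, Equiv.apply_symm_apply])
  · simp
  · simp
  · have := tableWeight_reindex σ τ (fun a => MvPowerSeries.C (blackTerm S a)) (edgeFactor _)
      (fun w b => whiteTerm G c ρ y₀ S (γ'.weight w) b) N
    simp only [h'] at this
    exact this.symm

end Isomorphisms

/-! ### Smooth dependence on the base point -/

section Smoothness

variable {d₁ : ℕ} {U : Set (Fin d₁ → ℝ)} {τ : Type}

/-- Formal power series in `ħ` with smooth coefficients. -/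
def SmoothHbar (U : Set (Fin d₁ → ℝ)) (f : (Fin d₁ → ℝ) → PowerSeries ℂ) : Prop :=
  ∀ k, ContDiffOn ℝ ∞ (fun x => PowerSeries.coeff k (f x)) U

/-- Formal power series in `τ` and `ħ` with smooth coefficients. -/
def SmoothSeries (U : Set (Fin d₁ → ℝ)) (f : (Fin d₁ → ℝ) → MvPowerSeries τ (PowerSeries ℂ)) :
    Prop :=
  ∀ s, SmoothHbar U fun x => MvPowerSeries.coeff s (f x)

theorem SmoothHbar.const (a : PowerSeries ℂ) : SmoothHbar U fun _ => a :=
  fun _ => contDiffOn_const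

theorem SmoothHbar.sum {ι : Type} {s : Finset ι} {f : ι → (Fin d₁ → ℝ) → PowerSeries ℂ}
    (h : ∀ i ∈ s, SmoothHbar U (f i)) : SmoothHbar U fun x => ∑ i ∈ s, f i x := fun k => by
  simp only [map_sum]
  exact ContDiffOn.sum fun i hi => h i hi k

theorem SmoothHbar.mul {f g : (Fin d₁ → ℝ) → PowerSeries ℂ} (hf : SmoothHbar U f)
    (hg : SmoothHbar U g) : SmoothHbar U fun x => f x * g x := fun k => by
  simp only [PowerSeries.coeff_mul]
  exact ContDiffOn.sum fun p _ => (hf p.1).mul (hg p.2)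

theorem SmoothHbar.smul {f : (Fin d₁ → ℝ) → PowerSeries ℂ} (hf : SmoothHbar U f) (a : ℂ) :
    SmoothHbar U fun x => a • f x := by
  simp only [PowerSeries.smul_eq_C_mul]
  exact (SmoothHbar.const _).mul hf

theorem SmoothHbar.prod {ι : Type} {s : Finset ι} {f : ι → (Fin d₁ → ℝ) → PowerSeries ℂ}
    (h : ∀ i, SmoothHbar U (f i)) : SmoothHbar U fun x => ∏ i ∈ s, f i x := by
  classical
  induction s using Finset.induction_on with
  | empty => simpa only [prod_empty] using SmoothHbar.const 1
  | insert i s hi ih => simpa only [prod_insert hi] using (h i).mul ih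

theorem SmoothHbar.congr {f g : (Fin d₁ → ℝ) → PowerSeries ℂ} (hf : SmoothHbar U f)
    (h : ∀ x ∈ U, g x = f x) : SmoothHbar U g :=
  fun k => (hf k).congr fun x hx => by rw [h x hx]

theorem SmoothSeries.const (a : MvPowerSeries τ (PowerSeries ℂ)) : SmoothSeries U fun _ => a :=
  fun _ _ => contDiffOn_const

theorem SmoothSeries.C {f : (Fin d₁ → ℝ) → PowerSeries ℂ} (hf : SmoothHbar U f) :
    SmoothSeries U fun x => (MvPowerSeries.C (f x) : MvPowerSeries τ (PowerSeries ℂ)) := by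
  classical
  intro s
  simp only [MvPowerSeries.coeff_C]
  split_ifs
  · exact hf
  · exact SmoothHbar.const 0

theorem SmoothSeries.mul {f g : (Fin d₁ → ℝ) → MvPowerSeries τ (PowerSeries ℂ)}
    (hf : SmoothSeries U f) (hg : SmoothSeries U g) : SmoothSeries U fun x => f x * g x := by
  classical
  intro s
  have h := SmoothHbar.sum (s := antidiagonal s) fun p _ => (hf p.1).mul (hg p.2)
  exact h.congr fun x _ => by rw [MvPowerSeries.coeff_mul]

theorem SmoothSeries.sum {ι : Type} {s : Finset ι}
    {f : ι → (Fin d₁ → ℝ) → MvPowerSeries τ (PowerSeries ℂ)}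
    (h : ∀ i ∈ s, SmoothSeries U (f i)) : SmoothSeries U fun x => ∑ i ∈ s, f i x := fun m => by
  simp only [map_sum]
  exact SmoothHbar.sum fun i hi => h i hi m

theorem SmoothSeries.smul {f : (Fin d₁ → ℝ) → MvPowerSeries τ (PowerSeries ℂ)}
    (hf : SmoothSeries U f) (a : ℂ) : SmoothSeries U fun x => a • f x := fun s => by
  simp only [coeff_complex_smul]
  exact (hf s).smul a

theorem SmoothSeries.prod {ι : Type} {s : Finset ι}
    {f : ι → (Fin d₁ → ℝ) → MvPowerSeries τ (PowerSeries ℂ)}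
    (h : ∀ i, SmoothSeries U (f i)) : SmoothSeries U fun x => ∏ i ∈ s, f i x := by
  classical
  induction s using Finset.induction_on with
  | empty => simpa only [prod_empty] using SmoothSeries.const 1
  | insert i s hi ih => simpa only [prod_insert hi] using (h i).mul ih

variable {n d : ℕ} {V : Set (Fin d → ℝ)} {F : GeneratingFunction d₁ d U}
  {φ₀ : (Fin d₁ → ℝ) → (Fin d → ℝ)}

theorem smoothHbar_at (l : ℕ) (a : Fin l → Fin d) : SmoothHbar U fun x => F.at x l a := fun k => by
  simp only [GeneratingFunction.at, PowerSeries.coeff_mk]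
  exact F.smooth l a k

theorem contDiffOn_zerothOrder (hφ₀ : ∀ x ∈ U, ∀ i, F.coeff 1 (fun _ => i) 0 x = (φ₀ x i : ℂ)) :
    ContDiffOn ℝ ∞ φ₀ U := by
  rw [contDiffOn_pi]
  intro i
  have h1 : ContDiffOn ℝ ∞ (fun x => Complex.reCLM (F.coeff 1 (fun _ => i) 0 x)) U :=
    Complex.reCLM.contDiff.comp_contDiffOn (F.smooth 1 _ 0)
  exact h1.congr fun x hx => by rw [hφ₀ x hx]; simp

theorem X_dvd_shift (hφ₀ : ∀ x ∈ U, ∀ i, F.coeff 1 (fun _ => i) 0 x = (φ₀ x i : ℂ))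
    {x : Fin d₁ → ℝ} (hx : x ∈ U) (i : Fin d) : PowerSeries.X ∣ shift (F.at x) (φ₀ x) i := by
  rw [PowerSeries.X_dvd_iff, shift, map_sub, PowerSeries.constantCoeff_C,
    ← PowerSeries.coeff_zero_eq_constantCoeff_apply, GeneratingFunction.at, PowerSeries.coeff_mk,
    hφ₀ x hx, sub_self]

theorem smoothHbar_pointDeriv (hφ₀ : ∀ x ∈ U, ∀ i, F.coeff 1 (fun _ => i) 0 x = (φ₀ x i : ℂ))
    (hV : IsOpen V) (hm : Set.MapsTo φ₀ U V) {h : ℕ → (Fin d → ℝ) → ℂ}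
    (hh : ∀ k, ContDiffOn ℝ ∞ (h k) V) (b : Fin d →₀ ℕ) :
    SmoothHbar U fun x => pointDeriv h (φ₀ x) (fun i => F.at x 1 fun _ => i) b := by
  have hφs := contDiffOn_zerothOrder hφ₀
  obtain ⟨l, a, rfl⟩ := exists_content b
  -- Each coefficient of `partialDerivAt` is a finite sum of products of smooth functions, whereas
  -- `pointDeriv` is defined as an infinite sum.
  refine SmoothHbar.congr (f := fun x => partialDerivAt h (φ₀ x) (fun i => F.at x 1 fun _ => i) _ a)
    ?_ fun x hx => pointDeriv_content hV hh (hm hx) (X_dvd_shift hφ₀ hx) a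
  intro N
  simp only [partialDerivAt, PowerSeries.coeff_mk]
  refine SmoothHbar.sum (fun j _ => SmoothHbar.sum fun e _ =>
    ((SmoothHbar.const _).mul (SmoothHbar.prod fun i k => ?_)).mul fun k => ?_) N
  · simp only [map_sub, PowerSeries.coeff_C]
    refine (smoothHbar_at 1 _ k).sub ?_
    split_ifs
    · exact Complex.ofRealCLM.contDiff.comp_contDiffOn (contDiffOn_pi.1 hφs _)
    · exact contDiffOn_const
  · simp only [PowerSeries.coeff_mk]
    exact (contDiffOn_partialDeriv hV (hh k) _).comp hφs hm

theorem smoothSeries_tableValue (hφ₀ : ∀ x ∈ U, ∀ i, F.coeff 1 (fun _ => i) 0 x = (φ₀ x i : ℂ))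
    (hV : IsOpen V) (hm : Set.MapsTo φ₀ U V) (G : GeneratingFunction d n V)
    (c : MvPowerSeries τ (PowerSeries ℂ)) (ρ : Fin n ↪ τ) {B W : ℕ} (ℓ : Fin W → ℕ)
    (N : Fin B → Fin W → Fin d →₀ ℕ) :
    SmoothSeries U fun x => tableValue G c ρ (φ₀ x) (F.at x) ℓ N := by
  simp only [tableValue, graphWeight_eq]
  refine SmoothSeries.smul (SmoothSeries.mul (SmoothSeries.C (SmoothHbar.prod fun v => ?_))
    (SmoothSeries.prod fun w => ?_)) _
  · exact SmoothHbar.smul (SmoothHbar.sum fun a _ => smoothHbar_at _ a) _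
  · refine (SmoothSeries.const c).mul (SmoothSeries.sum fun a _ => (SmoothSeries.const _).mul
      (SmoothSeries.C (smoothHbar_pointDeriv hφ₀ hV hm (fun k => G.smooth _ _ k) _)))

/-- The bound on the contributing graphs depends on the coefficient but not on `x`, so each
coefficient is on `U` a fixed finite sum of smooth functions. -/
theorem contDiffOn_coeffs_effective
    (hφ₀ : ∀ x ∈ U, ∀ i, F.coeff 1 (fun _ => i) 0 x = (φ₀ x i : ℂ))
    (hV : IsOpen V) (hm : Set.MapsTo φ₀ U V) {G : GeneratingFunction d n V}
    {c : MvPowerSeries τ (PowerSeries ℂ)} (hc : IsFormal G c) (ρ : Fin n ↪ τ)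
    (j : (τ →₀ ℕ) × ℕ) :
    ContDiffOn ℝ ∞ (fun x => coeffs (effective G c ρ (φ₀ x) (F.at x)) j) U := by
  classical
  let m := 2 * j.2 + 2 * j.1.degree + 1
  have h1 : ∀ x ∈ U, coeffs (effective G c ρ (φ₀ x) (F.at x)) j =
      ∑ e ∈ (finite_decorated (d := d) m).toFinset, coeffs (decoratedTerm G c ρ (φ₀ x) (F.at x) e) j := by
    intro x hx
    have h2 := hasSum_series_iff_coeff.1
      (summable_decoratedTerm ρ hc hV (hm hx) (S := F.at x)).hasSum j.1
    rw [hasSum_hbar_iff] at h2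
    refine (h2 j.2).2.trans (finsum_eq_sum_of_support_subset _ fun e he => ?_)
    rw [Set.Finite.coe_toFinset]
    exact isBounded_of_decoratedTerm ρ hc hV (hm hx) he
  refine ContDiffOn.congr (ContDiffOn.sum fun e _ => ?_) h1
  have h3 : SmoothSeries U fun x => decoratedTerm G c ρ (φ₀ x) (F.at x) e := by
    unfold decoratedTerm
    split_ifs
    · exact SmoothSeries.smul ((SmoothSeries.const _).mul
        (smoothSeries_tableValue hφ₀ hV hm G c ρ _ _)) _
    · exact SmoothSeries.const 0
  exact h3 j.1 j.2

end Smoothness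

/-! ### The value at `ħ = 0`, and the graph expansion -/

section ClassicalLimit

variable {τ : Type}

/-- The value at `ħ = 0`, as a series without `ħ`-corrections. -/
noncomputable def classicalPart : MvPowerSeries τ (PowerSeries ℂ) →+* MvPowerSeries τ (PowerSeries ℂ) :=
  MvPowerSeries.map ((PowerSeries.C (R := ℂ)).comp PowerSeries.constantCoeff)

theorem coeff_coeff_classicalPart (f : MvPowerSeries τ (PowerSeries ℂ)) (s : τ →₀ ℕ) (k : ℕ) :
    PowerSeries.coeff k (MvPowerSeries.coeff s (classicalPart f)) =
      if k = 0 then PowerSeries.coeff 0 (MvPowerSeries.coeff s f) else 0 := by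
  rw [classicalPart, MvPowerSeries.coeff_map, RingHom.comp_apply, PowerSeries.coeff_C,
    PowerSeries.coeff_zero_eq_constantCoeff_apply]

theorem classicalPart_smul (a : ℂ) (f : MvPowerSeries τ (PowerSeries ℂ)) :
    classicalPart (a • f) = a • classicalPart f := by
  ext s k
  rw [coeff_complex_smul, PowerSeries.coeff_smul, coeff_coeff_classicalPart,
    coeff_coeff_classicalPart, coeff_complex_smul, PowerSeries.coeff_smul]
  split_ifs
  · rfl
  · exact (smul_zero a).symm

theorem hasSum_classicalPart {ι : Type} {f : ι → MvPowerSeries τ (PowerSeries ℂ)}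
    {v : MvPowerSeries τ (PowerSeries ℂ)} (h : HasSum f v) :
    HasSum (fun i => classicalPart (f i)) (classicalPart v) := by
  rw [hasSum_series_iff] at *
  rintro ⟨s, k⟩
  simp only [coeffs, coeff_coeff_classicalPart]
  by_cases hk : k = 0
  · simp only [if_pos hk]
    exact h (s, 0)
  · simp only [if_neg hk]
    exact ⟨by simp, by simp⟩

theorem sumsTo_of_classicalPart {ι : Type} {f : ι → MvPowerSeries τ (PowerSeries ℂ)}
    {v : MvPowerSeries τ (PowerSeries ℂ)}
    (h : HasSum (fun i => classicalPart (f i)) (classicalPart v)) :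
    SumsTo (fun i s => MvPowerSeries.coeff s (MvPowerSeries.map PowerSeries.constantCoeff (f i)))
      (fun s => MvPowerSeries.coeff s (MvPowerSeries.map PowerSeries.constantCoeff v)) := by
  rw [hasSum_series_iff] at h
  intro s
  have h1 := h (s, 0)
  simp only [coeffs, coeff_coeff_classicalPart, if_true] at h1
  simpa only [MvPowerSeries.coeff_map, ← PowerSeries.coeff_zero_eq_constantCoeff_apply] using h1

theorem classicalPart_C_hbarI_mul {l : ℕ} (hl : l ≠ 0) (f : MvPowerSeries τ (PowerSeries ℂ)) :
    classicalPart (MvPowerSeries.C (hbarI ^ l) * f) = 0 := by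
  have h1 : PowerSeries.constantCoeff hbarI = 0 := PowerSeries.X_dvd_iff.1 X_dvd_hbarI
  rw [map_mul, classicalPart, MvPowerSeries.map_C, RingHom.comp_apply, map_pow, h1, zero_pow hl,
    map_zero, map_zero, zero_mul]

variable {d : ℕ} {V : Set (Fin d → ℝ)} {y₀ : Fin d → ℝ}

theorem constantCoeff_partialDerivAt (hV : IsOpen V) (hy : y₀ ∈ V) {h : ℕ → (Fin d → ℝ) → ℂ}
    (hh : ContDiffOn ℝ ∞ (h 0) V) (φ : Fin d → PowerSeries ℂ) {l : ℕ} (b : Fin l → Fin d) :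
    PowerSeries.constantCoeff (partialDerivAt h y₀ φ l b) = partialDeriv (h 0) l b y₀ := by
  rw [← PowerSeries.coeff_zero_eq_constantCoeff_apply, partialDerivAt, PowerSeries.coeff_mk,
    zero_add, sum_range_one, Fintype.sum_unique, PowerSeries.coeff_zero_eq_constantCoeff_apply,
    map_mul, map_mul, ← PowerSeries.coeff_zero_eq_constantCoeff_apply (PowerSeries.mk _),
    PowerSeries.coeff_mk, Fin.prod_univ_zero, map_one, PowerSeries.constantCoeff_C,
    Nat.factorial_zero, Nat.cast_one, inv_one, one_mul, one_mul]
  refine partialDeriv_congr hV hh ?_ hy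
  rw [content_append, content, Fin.sum_univ_zero, zero_add]

/-- Without parallel edges the denominators at the black vertices are 1, and at `ħ = 0` the
derivatives are evaluated at `y₀` itself. -/
theorem constantCoeff_contraction (hV : IsOpen V) (hy : y₀ ∈ V) (γ : BipartiteGraph)
    (hγ : ∀ v w, γ.mult v w ≤ 1) (S : (l : ℕ) → (Fin l → Fin d) → PowerSeries ℂ)
    {h : Fin γ.white → ℕ → (Fin d → ℝ) → ℂ} (hh : ∀ w, ContDiffOn ℝ ∞ (h w 0) V) :
    PowerSeries.constantCoeff (γ.contraction S y₀ h) =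
      γ.classicalContraction (fun l b => PowerSeries.constantCoeff (S l b)) y₀ fun w => h w 0 := by
  rw [BipartiteGraph.contraction, BipartiteGraph.classicalContraction, map_sum]
  refine sum_congr rfl fun e _ => ?_
  rw [map_mul, map_prod, map_prod]
  congr 1
  · refine prod_congr rfl fun v _ => ?_
    rw [map_mul, PowerSeries.constantCoeff_C, prod_eq_one, div_one]
    intro w _
    rw [Nat.factorial_eq_one.2 (hγ v w), Nat.cast_one]
  · exact prod_congr rfl fun w _ => constantCoeff_partialDerivAt hV hy (hh w) _ _

variable {d₁ n : ℕ} {U : Set (Fin d₁ → ℝ)} {F : GeneratingFunction d₁ d U}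
  {φ₀ : (Fin d₁ → ℝ) → (Fin d → ℝ)} (G : GeneratingFunction d n V)
  {c : MvPowerSeries τ (PowerSeries ℂ)} {c₀ : MvPowerSeries τ ℂ} (ρ : Fin n ↪ τ)

theorem map_compositionTerm (hc₀ : MvPowerSeries.map PowerSeries.constantCoeff c = c₀)
    (hV : IsOpen V) (hy : y₀ ∈ V) (x : Fin d₁ → ℝ) {γ : WeightedBipartiteGraph}
    (hγ : γ.IsWhiteLeavedTree) :
    MvPowerSeries.map PowerSeries.constantCoeff (compositionTerm F G c ρ x y₀ γ) =
      classicalCompositionTerm F G c₀ ρ x y₀ γ := by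
  rw [compositionTerm, classicalCompositionTerm, map_mul, map_mul, map_pow, hc₀, map_sum,
    MvPowerSeries.map_C, loopFactor, ((isWhiteLeavedTree_iff _).1 hγ).2, pow_zero, mul_one,
    PowerSeries.constantCoeff_C]
  congr 1
  refine sum_congr rfl fun a _ => ?_
  rw [map_mul, map_prod, MvPowerSeries.map_C, constantCoeff_contraction hV hy _ hγ.1.1 _
    fun w => G.smooth _ _ 0]
  congr 1
  refine prod_congr rfl fun w _ => ?_
  rw [map_prod]
  exact prod_congr rfl fun j _ => MvPowerSeries.map_X _ _

variable {G}

-- A positive loop number leaves a factor `ħ`, which vanishes at `ħ = 0`; connected white-leaved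
-- graphs without loops are trees.
open Classical in
theorem hasSum_classicalPart_effective {S : (l : ℕ) → (Fin l → Fin d) → PowerSeries ℂ}
    (hc : IsFormal G c) (hV : IsOpen V) (hy : y₀ ∈ V) :
    HasSum (fun γ : WeightedBipartiteGraph => if γ.IsWhiteLeavedTree then
      labelFactor (γ.black, γ.white) • classicalPart (value G c ρ y₀ S γ) else 0)
      (classicalPart (effective G c ρ y₀ S)) := by
  convert hasSum_classicalPart (hasSum_effective ρ hc hV hy (S := S)) using 2 with γ
  have h := isWhiteLeavedTree_iff γ.toBipartiteGraph
  by_cases h1 : γ.IsConnectedWhiteLeaved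
  · rw [if_pos h1, classicalPart_smul]
    by_cases h2 : γ.loops = 0
    · rw [if_pos (h.2 ⟨h1, h2⟩)]
    · rw [if_neg fun h3 => h2 (h.1 h3).2, value, classicalPart_C_hbarI_mul h2, smul_zero]
  · rw [if_neg h1, if_neg fun h3 => h1 (h.1 h3).1, map_zero]

theorem hasGraphExpansion_weighted
    (hφ₀ : ∀ x ∈ U, ∀ i, F.coeff 1 (fun _ => i) 0 x = (φ₀ x i : ℂ))
    (hV : IsOpen V) (hm : Set.MapsTo φ₀ U V) (hc : IsFormal G c)
    (hc₀ : MvPowerSeries.map PowerSeries.constantCoeff c = c₀) :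
    HasGraphExpansion U (fun x => CompositionLaw F G c ρ x (φ₀ x))
      (fun x (γ : WeightedBipartiteGraph.Classes BipartiteGraph.IsConnectedWhiteLeaved) =>
        compositionTerm F G c ρ x (φ₀ x) γ.rep)
      (fun x (t : WeightedBipartiteGraph.Classes BipartiteGraph.IsWhiteLeavedTree) =>
        classicalCompositionTerm F G c₀ ρ x (φ₀ x) t.rep) := by
  classical
  refine ⟨fun x => effective G c ρ (φ₀ x) (F.at x),
    contDiffOn_coeffs_effective hφ₀ hV hm hc ρ, fun x hx =>
    ⟨hasFormalIntegral_effective_iff ρ hc hV (hm hx) (X_dvd_shift hφ₀ hx), ?_, ?_⟩⟩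
  · rw [← hasSum_series_iff]
    simp only [compositionTerm_eq G c ρ _ F hx hV (hm hx) (X_dvd_shift hφ₀ hx)]
    exact hasSum_weightedClasses isInvariant_isConnectedWhiteLeaved
      (fun γ γ' => value_congr G c ρ (φ₀ x) (F.at x)) (hasSum_effective ρ hc hV (hm hx))
  · have h := hasSum_weightedClasses isInvariant_isWhiteLeavedTree
      (fun γ γ' h => congrArg classicalPart (value_congr G c ρ (φ₀ x) (F.at x) h))
      (hasSum_classicalPart_effective ρ hc hV (hm hx) (S := F.at x))
    simp only [← classicalPart_smul,
      ← compositionTerm_eq G c ρ _ F hx hV (hm hx) (X_dvd_shift hφ₀ hx)] at h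
    have h1 := sumsTo_of_classicalPart h
    have h2 : ∀ t : WeightedBipartiteGraph.Classes BipartiteGraph.IsWhiteLeavedTree,
        t.rep.IsWhiteLeavedTree := fun t => (Quotient.out t).2
    simpa only [map_compositionTerm G ρ hc₀ hV (hm hx) x (h2 _)] using h1

/-- If `G` is homogeneous of degree `l`, a white vertex of any other weight carries the zero
function. Sums over weighted graphs thus reduce to graphs with constant weight `l`. -/
theorem value_eq_zero {S : (l : ℕ) → (Fin l → Fin d) → PowerSeries ℂ} (hV : IsOpen V)
    (hy : y₀ ∈ V) {l : ℕ} (hG : ∀ l' ≠ l, ∀ a k, ∀ y ∈ V, G.coeff l' a k y = 0)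
    (γ : WeightedBipartiteGraph) (w : Fin γ.white) (hw : γ.weight w ≠ l) :
    value G c ρ y₀ S γ = 0 := by
  rw [value, sum_eq_zero, mul_zero]
  intro N _
  have h1 : whiteTerm G c ρ y₀ S (γ.weight w) (∑ v, N v w) = 0 := by
    rw [whiteTerm, wordSum, sum_eq_zero, mul_zero]
    intro a _
    rw [IsFormal.pointDeriv_eq_zero y₀ hV hy (hG _ hw a), map_zero, mul_zero]
  rw [tableValue, graphWeight_eq, prod_eq_zero (f := fun w => whiteTerm G c ρ y₀ S (γ.weight w)
    (∑ v, N v w)) (mem_univ w) h1, mul_zero, smul_zero]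

/-- The expansion if `G` is homogeneous of degree `l` in the momenta. -/
theorem hasGraphExpansion_homogeneous
    (hφ₀ : ∀ x ∈ U, ∀ i, F.coeff 1 (fun _ => i) 0 x = (φ₀ x i : ℂ))
    (hV : IsOpen V) (hm : Set.MapsTo φ₀ U V) (hc : IsFormal G c)
    (hc₀ : MvPowerSeries.map PowerSeries.constantCoeff c = c₀) {l : ℕ}
    (hG : ∀ l' ≠ l, ∀ a k, ∀ y ∈ V, G.coeff l' a k y = 0) :
    HasGraphExpansion U (fun x => CompositionLaw F G c ρ x (φ₀ x))
      (fun x (γ : BipartiteGraph.Classes BipartiteGraph.IsConnectedWhiteLeaved) =>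
        compositionTerm F G c ρ x (φ₀ x) (withWeight l γ.rep))
      (fun x (t : BipartiteGraph.Classes BipartiteGraph.IsWhiteLeavedTree) =>
        classicalCompositionTerm F G c₀ ρ x (φ₀ x) (withWeight l t.rep)) := by
  classical
  refine ⟨fun x => effective G c ρ (φ₀ x) (F.at x),
    contDiffOn_coeffs_effective hφ₀ hV hm hc ρ, fun x hx =>
    ⟨hasFormalIntegral_effective_iff ρ hc hV (hm hx) (X_dvd_shift hφ₀ hx), ?_, ?_⟩⟩
  · rw [← hasSum_series_iff]
    simp only [compositionTerm_eq G c ρ _ F hx hV (hm hx) (X_dvd_shift hφ₀ hx), symCard_withWeight]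
    exact hasSum_classes (f := fun γ => value G c ρ (φ₀ x) (F.at x) (withWeight l γ))
      isInvariant_isConnectedWhiteLeaved
      (fun γ γ' h => value_congr G c ρ (φ₀ x) (F.at x) (withWeight_equiv_iff.2 h))
      (hasSum_withWeight l (value_eq_zero ρ hV (hm hx) hG) (hasSum_effective ρ hc hV (hm hx)))
  · have h := hasSum_classes
      (f := fun γ => classicalPart (value G c ρ (φ₀ x) (F.at x) (withWeight l γ)))
      isInvariant_isWhiteLeavedTree
      (fun γ γ' h => congrArg classicalPart
        (value_congr G c ρ (φ₀ x) (F.at x) (withWeight_equiv_iff.2 h)))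
      (hasSum_withWeight (f := fun γ => classicalPart (value G c ρ (φ₀ x) (F.at x) γ)) l
        (fun γ w hw => by rw [value_eq_zero ρ hV (hm hx) hG γ w hw, map_zero])
        (hasSum_classicalPart_effective ρ hc hV (hm hx) (S := F.at x)))
    simp only [← classicalPart_smul, ← symCard_withWeight l,
      ← compositionTerm_eq G c ρ _ F hx hV (hm hx) (X_dvd_shift hφ₀ hx)] at h
    have h1 := sumsTo_of_classicalPart h
    have h2 : ∀ t : BipartiteGraph.Classes BipartiteGraph.IsWhiteLeavedTree,
        (withWeight l t.rep).IsWhiteLeavedTree := fun t => (Quotient.out t).2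
    simpa only [map_compositionTerm G ρ hc₀ hV (hm hx) x (h2 _)] using h1

end ClassicalLimit

/-! ### Functions and maps as homogeneous generating functions -/

section Homogeneous

variable {d n : ℕ} {V : Set (Fin d → ℝ)}

theorem jointSeries_eq_sum {G : GeneratingFunction d n V} {y₀ : Fin d → ℝ} (hV : IsOpen V)
    (hy : y₀ ∈ V) {l : ℕ} (hG : ∀ l' ≠ l, ∀ a k, ∀ y ∈ V, G.coeff l' a k y = 0) :
    G.jointSeries y₀ = ∑ a : Fin l → Fin n,
      MvPowerSeries.rename Function.Embedding.inl (taylorSeries (G.coeff l a) y₀) *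
        MvPowerSeries.rename Function.Embedding.inr (∏ j, MvPowerSeries.X (a j)) := by
  classical
  ext1 m
  obtain ⟨⟨b, s⟩, rfl⟩ := Finsupp.sumFinsuppEquivProdFinsupp.symm.surjective m
  change _ = MvPowerSeries.coeff (Finsupp.sumElim b s) _
  have h1 : MvPowerSeries.coeff (Finsupp.sumFinsuppEquivProdFinsupp.symm (b, s)) (G.jointSeries y₀) =
      MvPowerSeries.coeff s (tensorSeries fun l a =>
        MvPowerSeries.coeff b (taylorSeries (G.coeff l a) y₀)) := by
    change (fun p : (Fin d →₀ ℕ) × (Fin n →₀ ℕ) => ∑ a ∈ words p.2,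
      MvPowerSeries.coeff p.1 (taylorSeries (G.coeff _ a) y₀)) _ = _
    rw [Equiv.apply_symm_apply]
    rfl
  rw [h1, map_sum]
  simp only [coeff_rename_inl_mul_rename_inr, prod_X_eq_monomial, MvPowerSeries.coeff_monomial,
    mul_ite, mul_one, mul_zero]
  rw [coeff_tensorSeries _ rfl, ← sum_filter]
  by_cases hl : s.degree = l
  · subst hl
    exact sum_congr (filter_congr fun a _ => eq_comm) fun _ _ => rfl
  · rw [sum_eq_zero, sum_eq_zero]
    · intro a ha
      exact absurd ((congrArg Finsupp.degree (mem_filter.1 ha).2).trans (degree_content a)) hl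
    · intro a _
      have h2 := multiDeriv_eq_zero y₀ hV hy (hG _ hl a) b
      rwa [multiDeriv, smul_eq_zero_iff_right (multiFactorial_ne_zero b)] at h2

theorem contDiffOn_classicalFunction {g : (Fin d → ℝ) → ℝ} (hg : ContDiffOn ℝ ∞ g V) (k : ℕ) :
    ContDiffOn ℝ ∞ (classicalFunction g k) V := by
  by_cases hk : k = 0
  · have : classicalFunction g k = fun y => (g y : ℂ) := funext fun y => if_pos hk
    rw [this]
    exact Complex.ofRealCLM.contDiff.comp_contDiffOn hg
  · have : classicalFunction g k = fun y => 0 := funext fun y => if_neg hk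
    rw [this]
    exact contDiffOn_const

/-- A function, seen as a generating function without momenta. -/
noncomputable def scalarFunction {g : (Fin d → ℝ) → ℝ} (hg : ContDiffOn ℝ ∞ g V) :
    GeneratingFunction d 0 V where
  coeff l _ k := if l = 0 then classicalFunction g k else fun _ => 0
  smooth l a k := by
    split_ifs
    · exact contDiffOn_classicalFunction hg k
    · exact contDiffOn_const
  symm _ _ _ _ _ _ := rfl

/-- The generating function `ψ^α(y) q'_α` of a map `ψ`. -/
noncomputable def mapFunction {ψ : (Fin d → ℝ) → (Fin n → ℝ)} (hψ : ContDiffOn ℝ ∞ ψ V) :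
    GeneratingFunction d n V where
  coeff l a k := if h : l = 1 then classicalFunction (fun y => ψ y (a ⟨0, by omega⟩)) k
    else fun _ => 0
  smooth l a k := by
    split_ifs
    · exact contDiffOn_classicalFunction (contDiffOn_pi.1 hψ _) k
    · exact contDiffOn_const
  symm l a k σ x _ := by
    by_cases h : l = 1
    · subst h
      rw [Subsingleton.elim σ 1, Equiv.Perm.coe_one, Function.comp_id]
    · rw [dif_neg h, dif_neg h]

/-- The composition of a generating function with a smooth map. -/
noncomputable def GeneratingFunction.comp {d₁ : ℕ} {U : Set (Fin d₁ → ℝ)}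
    (F : GeneratingFunction d₁ n U) {U' : Set (Fin d → ℝ)} {χ : (Fin d → ℝ) → (Fin d₁ → ℝ)}
    (hχ : ContDiffOn ℝ ∞ χ U') (hm : Set.MapsTo χ U' U) : GeneratingFunction d n U' where
  coeff l a k x := F.coeff l a k (χ x)
  smooth l a k := (F.smooth l a k).comp hχ hm
  symm l a k σ x hx := F.symm l a k σ (χ x) (hm hx)

end Homogeneous

/-! ### Pullback and change of coordinates as special compositions -/

section Cases

variable {d₁ d₂ : ℕ} {U : Set (Fin d₁ → ℝ)} {V : Set (Fin d₂ → ℝ)}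
  {F : GeneratingFunction d₁ d₂ U} {φ₀ : (Fin d₁ → ℝ) → (Fin d₂ → ℝ)}

/-- This is the composition with `G = g` without momenta and `c = ε`. All weights are 0, so there
are no indices at the white vertices, and each product of momenta is empty. -/
theorem hasGraphExpansion_pullback
    (hφ₀ : ∀ x ∈ U, ∀ i, F.coeff 1 (fun _ => i) 0 x = (φ₀ x i : ℂ))
    (hV : IsOpen V) (hm : Set.MapsTo φ₀ U V) {g : (Fin d₂ → ℝ) → ℝ} (hg : ContDiffOn ℝ ∞ g V) :
    HasGraphExpansion U (fun x => PullbackLaw F g x (φ₀ x))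
      (fun x (γ : BipartiteGraph.Classes BipartiteGraph.IsConnectedWhiteLeaved) =>
        pullbackTerm F g x (φ₀ x) γ.rep)
      (fun x (t : BipartiteGraph.Classes BipartiteGraph.IsWhiteLeavedTree) =>
        classicalPullbackTerm F g x (φ₀ x) t.rep) := by
  have hG : ∀ l' ≠ 0, ∀ a k, ∀ y ∈ V, (scalarFunction hg).coeff l' a k y = 0 :=
    fun l' hl' a k y _ => by rw [scalarFunction]; dsimp only; rw [if_neg hl']
  have hterm : ∀ x y₀ γ, pullbackTerm F g x y₀ γ = compositionTerm F (scalarFunction hg)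
      (MvPowerSeries.X ()) (Function.Embedding.ofIsEmpty : Fin 0 ↪ Unit) x y₀ (withWeight 0 γ) := by
    intro x y₀ γ
    have : Unique (∀ w, Fin ((withWeight 0 γ).weight w) → Fin 0) :=
      ⟨⟨fun _ j => j⟩, fun _ => funext fun w => funext fun j => j.elim0⟩
    rw [compositionTerm, Fintype.sum_unique, pullbackTerm, symCard_withWeight, map_mul,
      ← mul_assoc]
    refine congrArg₂ (· * ·) rfl (Eq.trans ?_ (congrArg (· * _)
      (prod_eq_one fun w _ => Fin.prod_univ_zero _)).symm)
    exact (one_mul _).symm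
  have hterm0 : ∀ x y₀ γ, classicalPullbackTerm F g x y₀ γ = classicalCompositionTerm F
      (scalarFunction hg)
      (MvPowerSeries.X ()) (Function.Embedding.ofIsEmpty : Fin 0 ↪ Unit) x y₀ (withWeight 0 γ) := by
    intro x y₀ γ
    have : Unique (∀ w, Fin ((withWeight 0 γ).weight w) → Fin 0) :=
      ⟨⟨fun _ j => j⟩, fun _ => funext fun w => funext fun j => j.elim0⟩
    rw [classicalCompositionTerm, Fintype.sum_unique, classicalPullbackTerm, symCard_withWeight, map_mul,
      ← mul_assoc]
    refine congrArg₂ (· * ·) rfl (Eq.trans ?_ (congrArg (· * _)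
      (prod_eq_one fun w _ => Fin.prod_univ_zero _)).symm)
    exact (one_mul _).symm
  have hlaw : ∀ x ∈ U, ∀ H, PullbackLaw F g x (φ₀ x) H ↔ CompositionLaw F (scalarFunction hg)
      (MvPowerSeries.X ()) (Function.Embedding.ofIsEmpty : Fin 0 ↪ Unit) x (φ₀ x) H := by
    intro x hx H
    rw [PullbackLaw, CompositionLaw, jointSeries_eq_sum hV (hm hx) hG, Fintype.sum_unique,
      Fin.prod_univ_zero, map_one, mul_one, MvPowerSeries.rename_X, MvPowerSeries.rename_rename]
    rfl
  obtain ⟨H, h1, h2⟩ := hasGraphExpansion_homogeneous (c := MvPowerSeries.X ()) (l := 0)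
    (Function.Embedding.ofIsEmpty : Fin 0 ↪ Unit) hφ₀ hV hm (G := scalarFunction hg)
    (Or.inl (MvPowerSeries.constantCoeff_X ())) (MvPowerSeries.map_X _ _) hG
  simp only [hterm, hterm0]
  exact ⟨H, h1, fun x hx => ⟨fun H' => (hlaw x hx H').trans ((h2 x hx).1 H'), (h2 x hx).2⟩⟩

/-- A sum over the indices at white vertices of weight one. -/
theorem sum_indices_withWeight {R : Type} [AddCommMonoid R] (γ : BipartiteGraph)
    (f : (∀ w, Fin ((withWeight 1 γ).weight w) → Fin d₂) → R) :
    ∑ a, f a = ∑ a : Fin γ.white → Fin d₂, f fun w _ => a w :=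
  ((Equiv.piCongrRight fun _ : Fin γ.white => Equiv.funUnique (Fin 1) (Fin d₂)).symm.sum_comp
    f).symm

/-- This is the composition with `G = ψ^α(y) q'_α` and `c = 1`. All weights are 1, so each white
vertex carries one index. `F` is first composed with `χ`, so that smoothness is obtained in the new
variable `x'`. -/
theorem hasGraphExpansion_transformation
    (hφ₀ : ∀ x ∈ U, ∀ i, F.coeff 1 (fun _ => i) 0 x = (φ₀ x i : ℂ))
    (hV : IsOpen V) {U' : Set (Fin d₁ → ℝ)} {χ : (Fin d₁ → ℝ) → (Fin d₁ → ℝ)}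
    (hχ : ContDiffOn ℝ ∞ χ U') (hχU : Set.MapsTo χ U' U) (hm : Set.MapsTo (fun x => φ₀ (χ x)) U' V)
    {ψ : (Fin d₂ → ℝ) → (Fin d₂ → ℝ)} (hψ : ContDiffOn ℝ ∞ ψ V) :
    HasGraphExpansion U' (fun x' => TransformationLaw F ψ (χ x') (φ₀ (χ x')))
      (fun x' (γ : BipartiteGraph.Classes BipartiteGraph.IsConnectedWhiteLeaved) =>
        transformationTerm F ψ (χ x') (φ₀ (χ x')) γ.rep)
      (fun x' (t : BipartiteGraph.Classes BipartiteGraph.IsWhiteLeavedTree) =>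
        classicalTransformationTerm F ψ (χ x') (φ₀ (χ x')) t.rep) := by
  have hG : ∀ l' ≠ 1, ∀ a k, ∀ y ∈ V, (mapFunction hψ).coeff l' a k y = 0 :=
    fun l' hl' a k y _ => by rw [mapFunction]; dsimp only; rw [dif_neg hl']
  have hterm : ∀ x' γ, transformationTerm F ψ (χ x') (φ₀ (χ x')) γ =
      compositionTerm (F.comp hχ hχU) (mapFunction hψ) 1 (Function.Embedding.refl _) x'
        (φ₀ (χ x')) (withWeight 1 γ) := by
    intro x' γ
    rw [compositionTerm, sum_indices_withWeight, transformationTerm, symCard_withWeight, one_pow,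
      one_mul]
    refine congrArg _ (sum_congr rfl fun a _ => congrArg₂ _ (prod_congr rfl fun w _ => ?_) rfl)
    exact (Fin.prod_univ_one fun _ => MvPowerSeries.X (a w)).symm
  have hterm0 : ∀ x' γ, classicalTransformationTerm F ψ (χ x') (φ₀ (χ x')) γ =
      classicalCompositionTerm (F.comp hχ hχU) (mapFunction hψ) 1 (Function.Embedding.refl _) x'
        (φ₀ (χ x')) (withWeight 1 γ) := by
    intro x' γ
    rw [classicalCompositionTerm, sum_indices_withWeight, classicalTransformationTerm,
      symCard_withWeight, one_pow, one_mul]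
    refine congrArg _ (sum_congr rfl fun a _ => congrArg₂ _ (prod_congr rfl fun w _ => ?_) rfl)
    exact (Fin.prod_univ_one fun _ => MvPowerSeries.X (a w)).symm
  have hlaw : ∀ x' ∈ U', ∀ H, TransformationLaw F ψ (χ x') (φ₀ (χ x')) H ↔
      CompositionLaw (F.comp hχ hχU) (mapFunction hψ) 1 (Function.Embedding.refl _) x'
        (φ₀ (χ x')) H := by
    intro x' hx' H
    have hP : MvPowerSeries.rename (Function.Embedding.inr : Fin d₂ ↪ Fin d₂ ⊕ Fin d₂)
          (1 : MvPowerSeries (Fin d₂) (PowerSeries ℂ)) *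
        MvPowerSeries.rename ((Function.Embedding.refl (Fin d₂)).sumMap (Function.Embedding.refl _))
          ((mapFunction hψ).jointSeries (φ₀ (χ x'))) =
        ∑ α, MvPowerSeries.rename Function.Embedding.inl
          (taylorSeries (classicalFunction fun y => ψ y α) (φ₀ (χ x'))) *
            MvPowerSeries.X (Sum.inr α) := by
      rw [map_one, one_mul, jointSeries_eq_sum hV (hm hx') hG, map_sum,
        ← (Equiv.funUnique (Fin 1) (Fin d₂)).symm.sum_comp]
      refine sum_congr rfl fun α _ => ?_
      rw [Fin.prod_univ_one, MvPowerSeries.rename_X, map_mul, MvPowerSeries.rename_X,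
        MvPowerSeries.rename_rename]
      rfl
    rw [TransformationLaw, CompositionLaw, hP]
    rfl
  obtain ⟨H, h1, h2⟩ := hasGraphExpansion_homogeneous (F := F.comp hχ hχU) (c := 1) (l := 1)
    (φ₀ := fun x' => φ₀ (χ x')) (Function.Embedding.refl _) (fun x' hx' => hφ₀ _ (hχU hx')) hV hm
    (G := mapFunction hψ) (Or.inr (hG 0 zero_ne_one)) (map_one _) hG
  simp only [hterm, hterm0]
  exact ⟨H, h1, fun x' hx' => ⟨fun H' => (hlaw x' hx' H').trans ((h2 x' hx').1 H'), (h2 x' hx').2⟩⟩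

end Cases

end QuantumThick

theorem mainTheorem3 {d₁ d₂ : ℕ} {U : Set (Fin d₁ → ℝ)} (hU : IsOpen U)
    (F : GeneratingFunction d₁ d₂ U) (φ₀ : (Fin d₁ → ℝ) → (Fin d₂ → ℝ))
    (hφ₀ : ∀ x ∈ U, ∀ i, F.coeff 1 (fun _ => i) 0 x = (φ₀ x i : ℂ)) :
    -- composition
    (∀ {d₃ : ℕ} {V : Set (Fin d₂ → ℝ)}, IsOpen V → Set.MapsTo φ₀ U V →
      ∀ G : GeneratingFunction d₂ d₃ V,
        -- as a functional power series in `G`: `G` is replaced by `ε G`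
        HasGraphExpansion U
          (fun x => CompositionLaw F G (MvPowerSeries.X none) Function.Embedding.some x (φ₀ x))
          (fun x (γ : WeightedBipartiteGraph.Classes BipartiteGraph.IsConnectedWhiteLeaved) =>
            compositionTerm F G (MvPowerSeries.X none) Function.Embedding.some x (φ₀ x) γ.rep)
          (fun x (t : WeightedBipartiteGraph.Classes BipartiteGraph.IsWhiteLeavedTree) =>
            classicalCompositionTerm F G (MvPowerSeries.X none) Function.Embedding.some x (φ₀ x)
              t.rep) ∧
        -- as a power series in `r`, if `G` has no term of order zero in `r`
        ((∀ a k, ∀ y ∈ V, G.coeff 0 a k y = 0) →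
          HasGraphExpansion U
            (fun x => CompositionLaw F G 1 (Function.Embedding.refl _) x (φ₀ x))
            (fun x (γ : WeightedBipartiteGraph.Classes BipartiteGraph.IsConnectedWhiteLeaved) =>
              compositionTerm F G 1 (Function.Embedding.refl _) x (φ₀ x) γ.rep)
            (fun x (t : WeightedBipartiteGraph.Classes BipartiteGraph.IsWhiteLeavedTree) =>
              classicalCompositionTerm F G 1 (Function.Embedding.refl _) x (φ₀ x) t.rep))) ∧
    -- pullback of `exp (i g / ħ)`, as a functional power series in `g`
    (∀ {V : Set (Fin d₂ → ℝ)}, IsOpen V → Set.MapsTo φ₀ U V →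
      ∀ g : (Fin d₂ → ℝ) → ℝ, ContDiffOn ℝ ∞ g V →
        HasGraphExpansion U
          (fun x => PullbackLaw F g x (φ₀ x))
          (fun x (γ : BipartiteGraph.Classes BipartiteGraph.IsConnectedWhiteLeaved) =>
            pullbackTerm F g x (φ₀ x) γ.rep)
          (fun x (t : BipartiteGraph.Classes BipartiteGraph.IsWhiteLeavedTree) =>
            classicalPullbackTerm F g x (φ₀ x) t.rep)) ∧
    -- changes of coordinates `x = χ(x')`, `y = υ(y')`
    (∀ (χ : OpenPartialHomeomorph (Fin d₁ → ℝ) (Fin d₁ → ℝ))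
        (υ : OpenPartialHomeomorph (Fin d₂ → ℝ) (Fin d₂ → ℝ)),
      ContDiffOn ℝ ∞ χ χ.source → ContDiffOn ℝ ∞ χ.symm χ.target → χ.target ⊆ U →
      ContDiffOn ℝ ∞ υ υ.source → ContDiffOn ℝ ∞ υ.symm υ.target →
      Set.MapsTo φ₀ χ.target υ.target →
        HasGraphExpansion χ.source
          (fun x' => TransformationLaw F υ.symm (χ x') (φ₀ (χ x')))
          (fun x' (γ : BipartiteGraph.Classes BipartiteGraph.IsConnectedWhiteLeaved) =>
            transformationTerm F υ.symm (χ x') (φ₀ (χ x')) γ.rep)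
          (fun x' (t : BipartiteGraph.Classes BipartiteGraph.IsWhiteLeavedTree) =>
            classicalTransformationTerm F υ.symm (χ x') (φ₀ (χ x')) t.rep)) := by
  refine ⟨fun hV hm G => ⟨?_, fun hG => ?_⟩, fun hV hm g hg => ?_,
    fun χ υ hχ _ hχU _ hυ hm => ?_⟩
  -- The two versions of composition are the two alternatives of `IsFormal`: either the prefactor
  -- `ε` has no constant term, or `G` has no term of order zero in the momenta. In both, every
  -- interaction term contains a parameter.
  · exact hasGraphExpansion_weighted _ hφ₀ hV hm (Or.inl (MvPowerSeries.constantCoeff_X none))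
      (MvPowerSeries.map_X _ _)
  · exact hasGraphExpansion_weighted _ hφ₀ hV hm (Or.inr hG) (map_one _)
  · exact hasGraphExpansion_pullback hφ₀ hV hm hg
  · exact hasGraphExpansion_transformation hφ₀ υ.open_target hχ
      (fun x hx => hχU (χ.map_source hx)) (fun x hx => hm (χ.map_source hx)) hυ
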